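/- Let $P\subset\mathbb R^3$ be a convex polyhedron (the convex hull of a finite set of points, with non-empty interior) with $n$ facets $F_1,\dots,F_n$, and let $\nu(F_i)$ be a normal of $F_i$ that points into $P$. A pair $(F_i,d)$ with $d\in\mathbb R^3$ is \emph{valid} (the solid $P$ can be pulled in direction $d$ out of a one-part mold with top facet $F_i$) if $d\cdot\nu(F_i)<0$ and $d\cdot\nu(F_j)\ge 0$ for all $j\ne i$. The facet $F_i$ is a \emph{valid top facet} if $(F_i,d)$ is valid for some $d$; the vectors $d$ for which $(F_i,d)$ is valid are its valid pull-out directions. The problem AllFAD (all facets, all directions) asks for all valid top facets of $P$ and, for each of them, all its valid pull-out directions. The input is a doubly connected edge list of the boundary of $P$: the coordinates of the vertices; for every half-edge its origin, its twin, its successor counterclockwise (seen from outside) around its facet, and its facet; and for every facet one of its half-edges. The output is a list of the valid top facets, each once, together with, for each $F_i$ in the list, the sequence of vectors $v_1,\dots,v_k$, one on each extreme ray of the cone of its valid pull-out directions, in counterclockwise cyclic order; that is, $$\{d : (F_i,d)\text{ valid}\}=\Big\{\sum_{l=1}^k c_l v_l : c_l\ge 0\Big\}\setminus\{0\},$$ no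 $v_l$ is a nonnegative combination of the others, and $\det(v_a,v_b,v_c)>0$ for $a<b<c$. \textbf{Theorem.} Given a convex polyhedron $P$ with $n$ facets, the AllFAD problem for $P$ can be solved in time $O(n)$ on a real RAM (registers and arrays of natural numbers, with addition, truncated subtraction and comparison, and registers and arrays of real numbers, with $+,-,\times,\div$ and comparison, every operation at unit cost): there are a program and a constant $C$ such that for every convex polyhedron $P$ and every doubly connected edge list of its boundary, the program halts after at most $C\,n$ steps with a correct output, where $n$ is the number of facets of $P$. -/

import Mathlib

open scoped Matrix

/-! ## A real RAM: while programs over registers and arrays of numbers -/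

namespace RealRAM

/-- The memory: cells holding natural numbers (used as indices and pointers) and cells holding real
numbers. Both kinds come as scalar registers and as arrays; the names of registers and arrays are fixed in the program text, array positions are computed. -/
structure State where
  ireg : ℕ → ℕ
  rreg : ℕ → ℝ
  iarr : ℕ → ℕ → ℕ
  rarr : ℕ → ℕ → ℝ

/-- Index expressions; `sub` is truncated subtraction. -/
inductive IExpr : Type
  | const (k : ℕ)
  | reg (x : ℕ)
  | arr (a : ℕ) (i : IExpr)
  | add (e₁ e₂ : IExpr)
  | sub (e₁ e₂ : IExpr)

def IExpr.eval (s : State) : IExpr → ℕ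
  | .const k => k
  | .reg x => s.ireg x
  | .arr a i => s.iarr a (i.eval s)
  | .add e₁ e₂ => e₁.eval s + e₂.eval s
  | .sub e₁ e₂ => e₁.eval s - e₂.eval s

/-- One time unit for each operation, memory access and constant. -/
def IExpr.cost : IExpr → ℕ
  | .const _ => 1
  | .reg _ => 1
  | .arr _ i => i.cost + 1
  | .add e₁ e₂ => e₁.cost + e₂.cost + 1
  | .sub e₁ e₂ => e₁.cost + e₂.cost + 1

/-- Real expressions, with integer constants. Division is a command, see below. -/
inductive RExpr : Type
  | const (k : ℤ)
  | reg (x : ℕ)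
  | arr (a : ℕ) (i : IExpr)
  | add (e₁ e₂ : RExpr)
  | sub (e₁ e₂ : RExpr)
  | mul (e₁ e₂ : RExpr)

noncomputable def RExpr.eval (s : State) : RExpr → ℝ
  | .const k => (k : ℝ)
  | .reg x => s.rreg x
  | .arr a i => s.rarr a (i.eval s)
  | .add e₁ e₂ => e₁.eval s + e₂.eval s
  | .sub e₁ e₂ => e₁.eval s - e₂.eval s
  | .mul e₁ e₂ => e₁.eval s * e₂.eval s

def RExpr.cost : RExpr → ℕ
  | .const _ => 1
  | .reg _ => 1
  | .arr _ i => i.cost + 1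
  | .add e₁ e₂ => e₁.cost + e₂.cost + 1
  | .sub e₁ e₂ => e₁.cost + e₂.cost + 1
  | .mul e₁ e₂ => e₁.cost + e₂.cost + 1

/-- Tests: comparisons of indices, comparisons of reals, and Boolean combinations. -/
inductive Cond : Type
  | ile (e₁ e₂ : IExpr)
  | rle (e₁ e₂ : RExpr)
  | neg (b : Cond)
  | conj (b₁ b₂ : Cond)

def Cond.Holds (s : State) : Cond → Prop
  | .ile e₁ e₂ => e₁.eval s ≤ e₂.eval s
  | .rle e₁ e₂ => e₁.eval s ≤ e₂.eval s
  | .neg b => ¬ b.Holds s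
  | .conj b₁ b₂ => b₁.Holds s ∧ b₂.Holds s

def Cond.cost : Cond → ℕ
  | .ile e₁ e₂ => e₁.cost + e₂.cost + 1
  | .rle e₁ e₂ => e₁.cost + e₂.cost + 1
  | .neg b => b.cost + 1
  | .conj b₁ b₂ => b₁.cost + b₂.cost + 1

/-- Programs. `iset`/`rset` assign a register, `iput a i e`/`rput a i e` assign position `i` of the
array `a`, `rdiv x e₁ e₂` assigns the quotient `e₁ / e₂` to a real register. -/
inductive Cmd : Type
  | skip
  | iset (x : ℕ) (e : IExpr)
  | rset (x : ℕ) (e : RExpr)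
  | rdiv (x : ℕ) (e₁ e₂ : RExpr)
  | iput (a : ℕ) (i e : IExpr)
  | rput (a : ℕ) (i : IExpr) (e : RExpr)
  | seq (c₁ c₂ : Cmd)
  | ite (b : Cond) (c₁ c₂ : Cmd)
  | loop (b : Cond) (c : Cmd)

/-- `Exec c s t s'`: started in `s`, the program `c` halts in `s'` after `t` time units.
A division by zero has no successor state. -/
inductive Exec : Cmd → State → ℕ → State → Prop
  | skip (s : State) : Exec .skip s 1 s
  | iset (s : State) (x : ℕ) (e : IExpr) :
      Exec (.iset x e) s (e.cost + 1) { s with ireg := Function.update s.ireg x (e.eval s) }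
  | rset (s : State) (x : ℕ) (e : RExpr) :
      Exec (.rset x e) s (e.cost + 1) { s with rreg := Function.update s.rreg x (e.eval s) }
  | rdiv (s : State) (x : ℕ) (e₁ e₂ : RExpr) (h : e₂.eval s ≠ 0) :
      Exec (.rdiv x e₁ e₂) s (e₁.cost + e₂.cost + 1)
        { s with rreg := Function.update s.rreg x (e₁.eval s / e₂.eval s) }
  | iput (s : State) (a : ℕ) (i e : IExpr) :
      Exec (.iput a i e) s (i.cost + e.cost + 1)
        { s with
          iarr := Function.update s.iarr a (Function.update (s.iarr a) (i.eval s) (e.eval s)) }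
  | rput (s : State) (a : ℕ) (i : IExpr) (e : RExpr) :
      Exec (.rput a i e) s (i.cost + e.cost + 1)
        { s with
          rarr := Function.update s.rarr a (Function.update (s.rarr a) (i.eval s) (e.eval s)) }
  | seq {c₁ c₂ : Cmd} {s s₁ s₂ : State} {t₁ t₂ : ℕ} (h₁ : Exec c₁ s t₁ s₁)
      (h₂ : Exec c₂ s₁ t₂ s₂) : Exec (.seq c₁ c₂) s (t₁ + t₂) s₂
  | ite_pos {b : Cond} {c₁ c₂ : Cmd} {s s' : State} {t : ℕ} (hb : b.Holds s)
      (h : Exec c₁ s t s') : Exec (.ite b c₁ c₂) s (b.cost + t) s'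
  | ite_neg {b : Cond} {c₁ c₂ : Cmd} {s s' : State} {t : ℕ} (hb : ¬ b.Holds s)
      (h : Exec c₂ s t s') : Exec (.ite b c₁ c₂) s (b.cost + t) s'
  | loop_done {b : Cond} {c : Cmd} {s : State} (hb : ¬ b.Holds s) :
      Exec (.loop b c) s b.cost s
  | loop_step {b : Cond} {c : Cmd} {s s₁ s₂ : State} {t₁ t₂ : ℕ} (hb : b.Holds s)
      (h₁ : Exec c s t₁ s₁) (h₂ : Exec (.loop b c) s₁ t₂ s₂) :
      Exec (.loop b c) s (b.cost + t₁ + t₂) s₂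

end RealRAM

/-! ## Convex polyhedra, facets, and valid pull-out directions -/

namespace Casting

/-- Points and vectors of three-dimensional space. Scalar products are written `⬝ᵥ`, vector
products `⨯₃`; the norm of this type plays no role. -/
abbrev Vec3 : Type := Fin 3 → ℝ

/-- A (bounded, full-dimensional) convex polyhedron. -/
structure IsConvexPolyhedron (P : Set Vec3) : Prop where
  eq_convexHull : ∃ s : Set Vec3, s.Finite ∧ P = convexHull ℝ s
  interior_nonempty : (interior P).Nonempty

/-- The face of `P` on which the linear functional `ν ⬝ᵥ ·` is minimal. -/
def minFace (P : Set Vec3) (ν : Vec3) : Set Vec3 :=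
  {x ∈ P | ∀ y ∈ P, ν ⬝ᵥ x ≤ ν ⬝ᵥ y}

/-- A facet is a two-dimensional face. -/
def IsFacet (P F : Set Vec3) : Prop :=
  (∃ ν, F = minFace P ν) ∧ Module.finrank ℝ (vectorSpan ℝ F) = 2

/-- An edge is a one-dimensional face. -/
def IsEdge (P e : Set Vec3) : Prop :=
  (∃ ν, e = minFace P ν) ∧ Module.finrank ℝ (vectorSpan ℝ e) = 1

/-- `ν` is normal to the facet `F` and points into `P`. (The length is not normalized.) -/
def IsInnerNormal (P F : Set Vec3) (ν : Vec3) : Prop :=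
  ν ≠ 0 ∧ F = minFace P ν

/-- `(F, d)` is a valid mold and pull-out direction: `d` has negative scalar product with the inner
normal of the top facet `F` and nonnegative scalar product with those of all other facets. -/
def ValidPair (P F : Set Vec3) (d : Vec3) : Prop :=
  (∃ ν, IsInnerNormal P F ν ∧ d ⬝ᵥ ν < 0) ∧
    ∀ G, IsFacet P G → G ≠ F → ∀ ν, IsInnerNormal P G ν → 0 ≤ d ⬝ᵥ ν

/-- All valid pull-out directions for the top facet `F`, a union of open rays from the origin. -/
def pullOutDirections (P F : Set Vec3) : Set Vec3 := {d | ValidPair P F d}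

def ValidTopFacet (P F : Set Vec3) : Prop :=
  IsFacet P F ∧ (pullOutDirections P F).Nonempty

/-! ## The input: a doubly connected edge list -/

/-- The records of a doubly connected edge list with `nF` faces, `nH` half-edges and `nV` vertices:
coordinates of the vertices; origin, twin, successor on the same face, and incident face of each
half-edge; one half-edge of each face. -/
structure DCEL where
  nF : ℕ
  nH : ℕ
  nV : ℕ
  pos : Fin nV → Vec3
  origin : Fin nH → Fin nV
  twin : Fin nH → Fin nH
  next : Fin nH → Fin nH
  face : Fin nH → Fin nF
  faceEdge : Fin nF → Fin nH

namespace DCEL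

/-- The starting point of a half-edge. -/
def start (D : DCEL) (h : Fin D.nH) : Vec3 := D.pos (D.origin h)

/-- The polygon spanned by the vertices on the boundary of the face `f`. -/
def facet (D : DCEL) (f : Fin D.nF) : Set Vec3 :=
  convexHull ℝ (D.start '' {h | D.face h = f})

/-- `D` describes the boundary of `P`. Its vertices and faces are those of `P`, each once; the
successor function runs once around every facet along edges of `P`, counterclockwise when seen from
outside; a half-edge and its twin are the two sides of an edge, in opposite directions. -/
structure IsBoundaryOf (D : DCEL) (P : Set Vec3) : Prop where
  pos_injective : Function.Injective D.pos
  range_pos : Set.range D.pos = Set.extremePoints ℝ P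
  facet_injective : Function.Injective D.facet
  range_facet : Set.range D.facet = {F | IsFacet P F}
  face_faceEdge : ∀ f, D.face (D.faceEdge f) = f
  face_next : ∀ h, D.face (D.next h) = D.face h
  next_cycle : ∀ h h', D.face h = D.face h' → ∃ k : ℕ, D.next^[k] h = h'
  origin_injOn : ∀ h h', D.face h = D.face h' → D.origin h = D.origin h' → h = h'
  isEdge : ∀ h, IsEdge P (segment ℝ (D.start h) (D.start (D.next h)))
  counterclockwise : ∀ h ν, IsInnerNormal P (D.facet (D.face h)) ν →
    ν ⬝ᵥ ((D.start (D.next h) - D.start h) ⨯₃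
      (D.start (D.next (D.next h)) - D.start (D.next h))) < 0
  twin_twin : ∀ h, D.twin (D.twin h) = h
  face_twin_ne : ∀ h, D.face (D.twin h) ≠ D.face h
  origin_twin : ∀ h, D.origin (D.twin h) = D.origin (D.next h)
  origin_next_twin : ∀ h, D.origin (D.next (D.twin h)) = D.origin h

/-- A finite sequence as the contents of an array, followed by zeros. -/
def toArray {α : Type} [Zero α] {m : ℕ} (f : Fin m → α) : ℕ → α :=
  fun i => if h : i < m then f ⟨i, h⟩ else 0

/-- The initial memory on input `D`. Index registers 0, 1, 2 hold the numbers of faces, half-edges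
and vertices; index arrays 0 to 4 hold origin, twin, successor and face of the half-edges and one
half-edge of each face; real arrays 0, 1, 2 hold the vertex coordinates. All else is zero. -/
noncomputable def load (D : DCEL) : RealRAM.State where
  ireg := fun x => match x with
    | 0 => D.nF
    | 1 => D.nH
    | 2 => D.nV
    | _ => 0
  rreg := fun _ => 0
  iarr := fun a => match a with
    | 0 => toArray fun h => (D.origin h : ℕ)
    | 1 => toArray fun h => (D.twin h : ℕ)
    | 2 => toArray fun h => (D.next h : ℕ)
    | 3 => toArray fun h => (D.face h : ℕ)
    | 4 => toArray fun f => (D.faceEdge f : ℕ)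
    | _ => fun _ => 0
  rarr := fun a => match a with
    | 0 => toArray fun v => D.pos v 0
    | 1 => toArray fun v => D.pos v 1
    | 2 => toArray fun v => D.pos v 2
    | _ => fun _ => 0

end DCEL

/-! ## The output: all valid top facets with all their pull-out directions -/

/-- The vectors `v 0, …, v (m - 1)` span exactly the extreme rays of the cone `S ∪ {0}`: they
generate it, none is redundant, and they are listed in counterclockwise cyclic order. -/
structure IsRayCycle {m : ℕ} (v : Fin m → Vec3) (S : Set Vec3) : Prop where
  eq_span : S = (Submodule.span NNReal (Set.range v) : Set Vec3) \ {0}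
  irredundant : ∀ k, v k ∉ Submodule.span NNReal (v '' {k}ᶜ)
  cyclic : ∀ i j k, i < j → j < k → 0 < v i ⬝ᵥ (v j ⨯₃ v k)

/-- The memory `s` holds a solution of the problem "all facets, all directions" for `P`, whose
boundary is given by `D`. Index register 3 holds the number of valid top facets; index array 5 lists
them, each once; index array 6 delimits, for each of them, the block of real arrays 3, 4, 5 with the
coordinates of the extreme rays of its cone of valid pull-out directions. -/
structure SolvesAllFAD (P : Set Vec3) (D : DCEL) (s : RealRAM.State) : Prop where
  isFace : ∀ j < s.ireg 3, s.iarr 5 j < D.nF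
  nodup : ∀ i < s.ireg 3, ∀ j < s.ireg 3, s.iarr 5 i = s.iarr 5 j → i = j
  facets : ∀ f : Fin D.nF, (∃ j < s.ireg 3, s.iarr 5 j = f) ↔ ValidTopFacet P (D.facet f)
  block_le : ∀ j < s.ireg 3, s.iarr 6 j ≤ s.iarr 6 (j + 1)
  directions : ∀ j < s.ireg 3, ∀ f : Fin D.nF, s.iarr 5 j = f →
    IsRayCycle
      (fun a : Fin (s.iarr 6 (j + 1) - s.iarr 6 j) =>
        (![s.rarr 3 (s.iarr 6 j + a), s.rarr 4 (s.iarr 6 j + a), s.rarr 5 (s.iarr 6 j + a)] : Vec3))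
      (pullOutDirections P (D.facet f))

end Casting

namespace Casting

/-! ## Vector algebra -/

/-! Fix a facet `F` with inner normal `c`, and let `n i` be inner normals of the facets across its
edges. Only these neighbours restrict the pull-out directions. If `c ⬝ᵥ d < 0` and all `n i ⬝ᵥ d ≥
0`, then a point of `P` moved in direction `d` reaches the plane of `F` without leaving the
half-space of any neighbour. A convex polygon is the intersection of the half-planes of its edges,
so the point reached lies in `F`. Any further facet `G` has a point off the plane of `F`; it moves
to a point of `P`, so `d` has nonnegative product with the inner normal of `G` (`exists_exit`,
`pullOutDirections_eq`).

In the plane `c ⬝ᵥ d = -1` the valid directions thus form an intersection of half-planes. It is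
bounded because `F` is, and the half-planes come sorted by angle because the edges of `F` bound a
convex polygon (`FacetFan.angularCycle`). Hence a cyclic scan in the style of Graham suffices. For
consecutive constraints `p`, `k`, `q` with negative determinant, `k` is redundant if the turn from
`p` to `q` is below `π`, and otherwise there is no solution; both facts follow from the linear
relation between `c`, `p`, `k`, `q`. When no bad corner is left, local convexity becomes global:
along the chain the value of a fixed constraint first rises and then falls, starting and ending at
zero, so all corners are feasible (`ConvexChain.feasible`). They generate the cone
(`exists_combination`), and the ends of the edges of positive length span its extreme rays
(`ConvexChain.isRayCycle`).

A scan over `m` edges takes time linear in `m`, since three times the window size minus the number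
of known good corners drops at every step. The degrees sum to at most the number of half-edges,
which is at most `6 n` (`card_halfEdges_le`). This is shown without Euler's formula, by counting
ascending half-edges with respect to a generic linear functional.

The remainder is an explicit program. Its correctness and running time are derived with a small
program logic (`Runs`), with a frame rule and potential functions for loops. -/

theorem dot3 (u v : Vec3) : u ⬝ᵥ v = u 0 * v 0 + u 1 * v 1 + u 2 * v 2 := by
  simp [dotProduct, Fin.sum_univ_three]

theorem cross_zero (u v : Vec3) : (u ⨯₃ v) 0 = u 1 * v 2 - u 2 * v 1 := by simp [cross_apply]
theorem cross_one (u v : Vec3) : (u ⨯₃ v) 1 = u 2 * v 0 - u 0 * v 2 := by simp [cross_apply]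
theorem cross_two (u v : Vec3) : (u ⨯₃ v) 2 = u 0 * v 1 - u 1 * v 0 := by simp [cross_apply]

theorem triple_rotate (u v w : Vec3) : u ⬝ᵥ (v ⨯₃ w) = v ⬝ᵥ (w ⨯₃ u) :=
  triple_product_permutation u v w

/-- A vector orthogonal to three independent vectors vanishes. -/
theorem eq_zero_of_dot_eq_zero {p q r x : Vec3} (h : p ⬝ᵥ (q ⨯₃ r) ≠ 0)
    (hp : p ⬝ᵥ x = 0) (hq : q ⬝ᵥ x = 0) (hr : r ⬝ᵥ x = 0) : x = 0 := by
  -- Cramer's rule: up to the factor `p ⬝ᵥ (q ⨯₃ r)`, the three cross products are the basis dual to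
  -- `p`, `q`, `r`.
  have key : (p ⬝ᵥ (q ⨯₃ r)) • x =
      (p ⬝ᵥ x) • (q ⨯₃ r) + (q ⬝ᵥ x) • (r ⨯₃ p) + (r ⬝ᵥ x) • (p ⨯₃ q) := by
    ext i
    fin_cases i <;>
    simp only [dot3, cross_zero, cross_one, cross_two, Pi.add_apply, Pi.smul_apply, smul_eq_mul,
      Fin.zero_eta, Fin.mk_one, Fin.reduceFinMk] <;> ring
  rw [hp, hq, hr] at key
  simp only [zero_smul, add_zero] at key
  exact (smul_eq_zero.1 key).resolve_left h

theorem dot_self_pos {w : Vec3} (h : w ≠ 0) : 0 < w ⬝ᵥ w := by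
  have := dotProduct_self_eq_zero (v := w)
  have h2 : 0 ≤ w ⬝ᵥ w := by rw [dot3]; nlinarith [sq_nonneg (w 0), sq_nonneg (w 1), sq_nonneg (w 2)]
  exact lt_of_le_of_ne h2 (fun h3 => h (this.1 h3.symm))

/-! ## Cyclic sequences of half-planes sorted by angle -/

/-- The constraints `0 ≤ a i ⬝ᵥ d`, restricted to a plane `c ⬝ᵥ d = -1`, form a cyclic sequence of
`m` half-planes that is sorted counterclockwise by angle, with consecutive angles below `π`. -/
structure AngularCycle (c : Vec3) (m : ℕ) (a : ℕ → Vec3) : Prop where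
  periodic : ∀ i, a (i + m) = a i
  turn : ∀ i, c ⬝ᵥ (a i ⨯₃ a (i + 1)) < 0
  sorted : ∀ i j k, i < j → j < k → k < i + m →
    0 ≤ c ⬝ᵥ (a i ⨯₃ a j) → 0 < c ⬝ᵥ (a i ⨯₃ a k)

def feasibleCone (c : Vec3) (a : ℕ → Vec3) : Set Vec3 :=
  {d | c ⬝ᵥ d < 0 ∧ ∀ i, 0 ≤ a i ⬝ᵥ d}

/-- The determinant whose sign tells whether edge `i + 1` has positive length. -/
noncomputable def cornerDet (a : ℕ → Vec3) (i : ℕ) : ℝ := a i ⬝ᵥ (a (i + 1) ⨯₃ a (i + 2))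

/-- Cyclic order by angle passes to subsequences; only the turn between new neighbours can reach `π`
and has to be checked. -/
theorem AngularCycle.comp {c : Vec3} {m m' : ℕ} {a : ℕ → Vec3} (H : AngularCycle c m a)
    {φ : ℕ → ℕ} (hφ : StrictMono φ) (hper : ∀ i, φ (i + m') = φ i + m)
    (hturn : ∀ i, c ⬝ᵥ (a (φ i) ⨯₃ a (φ (i + 1))) < 0) :
    AngularCycle c m' (a ∘ φ) where
  periodic i := by simp [hper, H.periodic]
  turn := hturn
  sorted i j k hij hjk hk := H.sorted _ _ _ (hφ hij) (hφ hjk) (by rw [← hper]; exact hφ hk)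

/-- A constraint is redundant if the corner of its two neighbours satisfies it. -/
theorem redundant_of_corner {c p k q d : Vec3} (hpk : c ⬝ᵥ (p ⨯₃ k) < 0)
    (hkq : c ⬝ᵥ (k ⨯₃ q) < 0) (hpq : c ⬝ᵥ (p ⨯₃ q) < 0) (hs : p ⬝ᵥ (k ⨯₃ q) < 0)
    (hc : c ⬝ᵥ d ≤ 0) (hp : 0 ≤ p ⬝ᵥ d) (hq : 0 ≤ q ⬝ᵥ d) : 0 ≤ k ⬝ᵥ d := by
  -- The linear relation between the four vectors `c`, `p`, `k`, `q` of three-space, multiplied by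
  -- `d`.
  have h : (c ⬝ᵥ (p ⨯₃ q)) * (k ⬝ᵥ d) = (c ⬝ᵥ (k ⨯₃ q)) * (p ⬝ᵥ d) + (c ⬝ᵥ (p ⨯₃ k)) * (q ⬝ᵥ d)
      - (p ⬝ᵥ (k ⨯₃ q)) * (c ⬝ᵥ d) := by
    simp only [dot3, cross_zero, cross_one, cross_two]; ring
  have h1 := mul_nonneg_of_nonpos_of_nonpos hs.le hc
  have h2 := mul_nonpos_of_nonpos_of_nonneg hkq.le hp
  have h3 := mul_nonpos_of_nonpos_of_nonneg hpk.le hq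
  by_contra hneg
  push Not at hneg
  have := mul_pos_of_neg_of_neg hpq hneg
  linarith

/-- The same relation, solved for `c`: division by the negative number `p ⬝ᵥ (k ⨯₃ q)` makes `c` a
nonnegative combination of `p`, `k`, `q`, so their half-planes have no common point in the plane `c
⬝ᵥ d = -1`. -/
theorem infeasible_of_corner {c p k q d : Vec3} (hpk : c ⬝ᵥ (p ⨯₃ k) < 0)
    (hkq : c ⬝ᵥ (k ⨯₃ q) < 0) (hpq : 0 ≤ c ⬝ᵥ (p ⨯₃ q)) (hs : p ⬝ᵥ (k ⨯₃ q) < 0)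
    (hp : 0 ≤ p ⬝ᵥ d) (hk : 0 ≤ k ⬝ᵥ d) (hq : 0 ≤ q ⬝ᵥ d) : 0 ≤ c ⬝ᵥ d := by
  have h : (p ⬝ᵥ (k ⨯₃ q)) * (c ⬝ᵥ d) = (c ⬝ᵥ (k ⨯₃ q)) * (p ⬝ᵥ d) + (c ⬝ᵥ (p ⨯₃ k)) * (q ⬝ᵥ d)
      - (c ⬝ᵥ (p ⨯₃ q)) * (k ⬝ᵥ d) := by
    simp only [dot3, cross_zero, cross_one, cross_two]; ring
  have h1 := mul_nonneg hpq hk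
  have h2 := mul_nonpos_of_nonpos_of_nonneg hkq.le hp
  have h3 := mul_nonpos_of_nonpos_of_nonneg hpk.le hq
  by_contra hneg
  push Not at hneg
  have := mul_pos_of_neg_of_neg hs hneg
  linarith

/-! ## A chain without bad corners bounds the cone -/

/-- A sorted cycle of half-planes all of whose edges have nonnegative length. -/
structure ConvexChain (c : Vec3) (m : ℕ) (a : ℕ → Vec3) : Prop extends AngularCycle c m a where
  pos : 0 < m
  corner : ∀ i, 0 ≤ cornerDet a i
  bounded : ∀ w, c ⬝ᵥ w = 0 → (∀ i, 0 ≤ a i ⬝ᵥ w) → w = 0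

namespace ConvexChain

/-- Corner `i` of the chain, normalized to `c ⬝ᵥ x = -1`. -/
noncomputable def vert (c : Vec3) (a : ℕ → Vec3) (i : ℕ) : Vec3 :=
  (-(c ⬝ᵥ (a i ⨯₃ a (i + 1))))⁻¹ • (a i ⨯₃ a (i + 1))

/-- Signed length of the edge from corner `i` to corner `i + 1`, in units of `c ⨯₃ a (i + 1)`. Note
the shift: edge `i` lies on the line of constraint `i + 1`. -/
noncomputable def len (c : Vec3) (a : ℕ → Vec3) (i : ℕ) : ℝ :=
  cornerDet a i / ((c ⬝ᵥ (a i ⨯₃ a (i + 1))) * (c ⬝ᵥ (a (i + 1) ⨯₃ a (i + 2))))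

variable {c : Vec3} {m : ℕ} {a : ℕ → Vec3}

/-- Both corners lie on the line of constraint `i + 1`, which has direction `c ⨯₃ a (i + 1)`. -/
theorem vert_step (H : ConvexChain c m a) (i : ℕ) :
    vert c a (i + 1) = vert c a i + len c a i • (c ⨯₃ a (i + 1)) := by
  have h1 := H.turn i
  have h2 := H.turn (i + 1)
  rw [show i + 1 + 1 = i + 2 from rfl] at h2
  have h1' := h1.ne
  have h2' := h2.ne
  unfold vert len cornerDet
  rw [show i + 1 + 1 = i + 2 from rfl]
  generalize a i = p at *
  generalize a (i + 1) = q at *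
  generalize a (i + 2) = r at *
  have key : (c ⬝ᵥ (p ⨯₃ q)) • (q ⨯₃ r) = (c ⬝ᵥ (q ⨯₃ r)) • (p ⨯₃ q)
      - (p ⬝ᵥ (q ⨯₃ r)) • (c ⨯₃ q) := by
    ext i
    fin_cases i <;>
    simp only [dot3, cross_zero, cross_one, cross_two, Pi.sub_apply, Pi.smul_apply, smul_eq_mul,
      Fin.zero_eta, Fin.mk_one, Fin.reduceFinMk] <;> ring
  have key2 : q ⨯₃ r = (c ⬝ᵥ (p ⨯₃ q))⁻¹ • ((c ⬝ᵥ (q ⨯₃ r)) • (p ⨯₃ q)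
      - (p ⬝ᵥ (q ⨯₃ r)) • (c ⨯₃ q)) := by
    rw [← key, smul_smul, inv_mul_cancel₀ h1', one_smul]
  generalize hS : p ⬝ᵥ (q ⨯₃ r) = S at *
  generalize hA : c ⬝ᵥ (p ⨯₃ q) = A at *
  generalize hB : c ⬝ᵥ (q ⨯₃ r) = B at *
  rw [key2, smul_sub, smul_sub, smul_smul, smul_smul, smul_smul, smul_smul, sub_eq_add_neg,
    ← neg_smul]
  congr 2
  · field_simp
  · field_simp

theorem dot_vert (H : ConvexChain c m a) (i : ℕ) : c ⬝ᵥ vert c a i = -1 := by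
  have h1 := (H.turn i).ne
  unfold vert
  rw [dotProduct_smul, smul_eq_mul]
  field_simp

theorem len_nonneg (H : ConvexChain c m a) (i : ℕ) : 0 ≤ len c a i :=
  div_nonneg (H.corner i) (mul_pos_of_neg_of_neg (H.turn i) (H.turn (i + 1))).le

theorem len_pos_iff (H : ConvexChain c m a) (i : ℕ) : 0 < len c a i ↔ 0 < cornerDet a i := by
  have := mul_pos_of_neg_of_neg (H.turn i) (H.turn (i + 1))
  unfold len
  exact div_pos_iff_of_pos_right this

theorem periodic_mul (H : AngularCycle c m a) (i t : ℕ) : a (i + t * m) = a i := by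
  induction t with
  | zero => simp
  | succ t ih => rw [add_mul, ← add_assoc, one_mul, H.periodic, ih]

theorem vert_periodic (H : ConvexChain c m a) (i : ℕ) : vert c a (i + m) = vert c a i := by
  unfold vert
  rw [show i + m + 1 = i + 1 + m by ring, H.periodic, H.periodic]

theorem len_periodic (H : ConvexChain c m a) (i : ℕ) : len c a (i + m) = len c a i := by
  unfold len cornerDet
  rw [show i + m + 1 = i + 1 + m by ring, show i + m + 2 = i + 2 + m by ring, H.periodic,
    H.periodic, H.periodic]

theorem dot_vert_self (i : ℕ) : a i ⬝ᵥ vert c a i = 0 := by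
  unfold vert; rw [dotProduct_smul, dot_self_cross, smul_zero]

theorem dot_vert_succ (i : ℕ) : a (i + 1) ⬝ᵥ vert c a i = 0 := by
  unfold vert; rw [dotProduct_smul, dot_cross_self, smul_zero]

theorem dot_vert_step (H : ConvexChain c m a) (j k : ℕ) :
    a j ⬝ᵥ vert c a (k + 1) =
      a j ⬝ᵥ vert c a k + len c a k * -(c ⬝ᵥ (a j ⨯₃ a (k + 1))) := by
  rw [H.vert_step, dotProduct_add, dotProduct_smul, smul_eq_mul]
  congr 2
  simp only [dot3, cross_zero, cross_one, cross_two]; ring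

/-- All corners satisfy all constraints. -/
theorem feasible_aux (H : ConvexChain c m a) (j k : ℕ) (hjk : j ≤ k) (hk : k < j + m) :
    0 ≤ a j ⬝ᵥ vert c a k := by
  -- By `dot_vert_step` the value of constraint `j` rises along the chain while the turn from `a j`
  -- is below `π`. By `sorted` it never rises again afterwards. It is zero at corners `j` and `j + m
  -- - 1`, so it is nonnegative in between: induction goes up from `j` on the rising part and down
  -- from the last corner on the falling part.
  by_cases hs : j < k ∧ 0 ≤ c ⬝ᵥ (a j ⨯₃ a k)
  · obtain ⟨hlt, hs⟩ := hs
    -- decreasing part: induct down from the last corner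
    obtain ⟨n, hn⟩ : ∃ n, k + n = j + m - 1 := ⟨j + m - 1 - k, by omega⟩
    have : ∀ n k, j < k → 0 ≤ c ⬝ᵥ (a j ⨯₃ a k) → k + n = j + m - 1 → 0 ≤ a j ⬝ᵥ vert c a k := by
      intro n
      induction n with
      | zero =>
        intro k _ _ hn
        have h1 : a (k + 1) = a j := by
          rw [show k + 1 = j + m by omega, H.periodic]
        rw [← h1, dot_vert_succ]
      | succ n ih =>
        intro k hlt hs hn
        have h1 := H.sorted j k (k + 1) hlt (by omega) (by omega) hs
        have h2 := ih (k + 1) (by omega) h1.le (by omega)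
        rw [H.dot_vert_step] at h2
        nlinarith [H.len_nonneg k]
    exact this n k hlt hs hn
  · induction k, hjk using Nat.le_induction with
    | base => rw [dot_vert_self]
    | succ k hjk ih =>
      have hs' : c ⬝ᵥ (a j ⨯₃ a (k + 1)) < 0 := by
        by_contra h
        exact hs ⟨by omega, not_lt.1 h⟩
      have := ih (by omega) (fun h => by
        have := H.sorted j k (k + 1) h.1 (by omega) (by omega) h.2
        linarith)
      rw [H.dot_vert_step]
      nlinarith [H.len_nonneg k]

theorem exists_window (H : ConvexChain c m a) (j k : ℕ) :
    ∃ k', j ≤ k' ∧ k' < j + m ∧ vert c a k = vert c a k' := by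
  have hm := H.pos
  have hp : ∀ i t, vert c a (i + t * m) = vert c a i := by
    intro i t
    induction t with
    | zero => simp
    | succ t ih => rw [add_mul, ← add_assoc, one_mul, H.vert_periodic, ih]
  -- Modulo `m` the number `j * (m - 1)` is `-j`, so the witness is congruent to `k`.
  refine ⟨j + (k + j * (m - 1)) % m, by omega, by have := Nat.mod_lt (k + j * (m - 1)) hm; omega, ?_⟩
  rw [← hp k j, ← hp (j + _) ((k + j * (m - 1)) / m)]
  congr 1
  have h1 := Nat.mod_add_div' (k + j * (m - 1)) m
  have h2 : j * m = j * (m - 1) + j := by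
    obtain ⟨m, rfl⟩ : ∃ m', m = m' + 1 := ⟨m - 1, by omega⟩
    simp; ring
  omega

theorem feasible (H : ConvexChain c m a) (j k : ℕ) : 0 ≤ a j ⬝ᵥ vert c a k := by
  obtain ⟨k', h1, h2, h3⟩ := H.exists_window j k
  rw [h3]
  exact H.feasible_aux j k' h1 h2

/-- Only the ends of an edge of positive length lie on its line. -/
theorem feasible_strict (H : ConvexChain c m a) {j b b' : ℕ} (hb : 0 < len c a b)
    (hb' : 0 < len c a b') (hj : j ≤ b) (hbb : b < b') (hm : b' + 1 < j + m) :
    0 < a j ⬝ᵥ vert c a (b + 1) := by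
  -- If edge `b` is rising, its positive length makes the value at its end positive. Otherwise
  -- everything later falls, and edge `b'` falls strictly to a value that is still nonnegative.
  by_cases hs : c ⬝ᵥ (a j ⨯₃ a (b + 1)) < 0
  · rw [H.dot_vert_step]
    have := H.feasible j b
    nlinarith
  · push Not at hs
    have hneg : ∀ k, b + 1 < k → k < j + m → 0 < c ⬝ᵥ (a j ⨯₃ a k) := fun k h1 h2 =>
      H.sorted j (b + 1) k (by omega) h1 h2 hs
    have h1 : 0 < a j ⬝ᵥ vert c a b' := by
      have h2 := H.feasible j (b' + 1)
      rw [H.dot_vert_step] at h2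
      have := mul_pos hb' (hneg (b' + 1) (by omega) hm)
      nlinarith
    have : ∀ k, b + 1 ≤ k → k ≤ b' → a j ⬝ᵥ vert c a k ≤ a j ⬝ᵥ vert c a (b + 1) := by
      intro k hk
      induction k, hk using Nat.le_induction with
      | base => intro _; exact le_rfl
      | succ k hk ih =>
        intro hkb
        refine le_trans ?_ (ih (by omega))
        rw [H.dot_vert_step]
        nlinarith [H.len_nonneg k, hneg (k + 1) (by omega) (by omega)]
    exact h1.trans_le (this b' (by omega) le_rfl)

/-- Edges of length zero do not move the corner, so corner `k` is the end of the last edge of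
positive length before it. -/
theorem feasible_strict_between (H : ConvexChain c m a) {j b b' k : ℕ} (hb : 0 < len c a b)
    (hb' : 0 < len c a b') (hj : j ≤ b) (hbk : b < k) (hkb : k ≤ b') (hm : b' + 1 < j + m) :
    0 < a j ⬝ᵥ vert c a k := by
  induction k, hbk using Nat.le_induction with
  | base => exact H.feasible_strict hb hb' hj hkb hm
  | succ k hk ih =>
    rcases (H.len_nonneg k).eq_or_lt with h | h
    · rw [H.vert_step, ← h, zero_smul, add_zero]
      exact ih (by omega)
    · exact H.feasible_strict h hb' (by omega) hkb hm

/-- Both corners are orthogonal to `a (k + 1)`, so their cross product is a multiple of it. The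
factor is exactly the length because corners are normalized to `c ⬝ᵥ x = -1`. -/
theorem vert_cross (H : ConvexChain c m a) (k : ℕ) :
    vert c a k ⨯₃ vert c a (k + 1) = len c a k • a (k + 1) := by
  have h1 := H.dot_vert k
  have h2 := dot_vert_succ (c := c) (a := a) k
  rw [H.vert_step]
  generalize vert c a k = v at *
  generalize a (k + 1) = q at *
  generalize len c a k = l at *
  have : v ⨯₃ (v + l • (c ⨯₃ q)) = l • ((q ⬝ᵥ v) • c - (c ⬝ᵥ v) • q) := by
    ext i
    fin_cases i <;>
    simp only [dot3, cross_zero, cross_one, cross_two, Pi.sub_apply, Pi.add_apply, Pi.smul_apply,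
      smul_eq_mul, Fin.zero_eta, Fin.mk_one, Fin.reduceFinMk] <;> ring
  rw [this, h1, h2]; simp

/-- Induction on the third corner, which starts at the second one with determinant zero. The first
part carries the sign through edges of length zero; the second becomes available once an edge of
positive length beyond `y` has been passed. -/
theorem det_aux (H : ConvexChain c m a) {x y k : ℕ} (hx : 0 < len c a x) (hy : 0 < len c a y)
    (hxy : x < y) (hk : y + 1 ≤ k) (hkm : k ≤ x + m) :
    0 ≤ vert c a (x + 1) ⬝ᵥ (vert c a (y + 1) ⨯₃ vert c a k) ∧
      ∀ z, y < z → z < k → 0 < len c a z →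
        0 < vert c a (x + 1) ⬝ᵥ (vert c a (y + 1) ⨯₃ vert c a k) := by
  induction k, hk using Nat.le_induction with
  | base => exact ⟨by rw [cross_self, dotProduct_zero], fun z h1 h2 => by omega⟩
  | succ k hk ih =>
    obtain ⟨ih1, ih2⟩ := ih (by omega)
    rcases (H.len_nonneg k).eq_or_lt with h | h
    · rw [show vert c a (k + 1) = vert c a k by rw [H.vert_step, ← h, zero_smul, add_zero]]
      refine ⟨ih1, fun z h1 h2 h3 => ih2 z h1 ?_ h3⟩
      rcases Nat.lt_succ_iff_lt_or_eq.1 h2 with h4 | h4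
      · exact h4
      · subst h4; exact absurd h h3.ne
    · have hpk : 0 < a (x + 1) ⬝ᵥ vert c a k :=
        H.feasible_strict_between hy h (by omega) (by omega) le_rfl (by omega)
      have hpy : 0 < a (x + 1) ⬝ᵥ vert c a (y + 1) :=
        H.feasible_strict hy h (by omega) (by omega) (by omega)
      have hpk1 : 0 ≤ a (x + 1) ⬝ᵥ vert c a (k + 1) := H.feasible _ _
      have hD : 0 < vert c a (x + 1) ⬝ᵥ (vert c a k ⨯₃ vert c a (k + 1)) := by
        rw [H.vert_cross, dotProduct_smul, smul_eq_mul, dotProduct_comm]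
        refine mul_pos h ?_
        -- Corner `x + 1` lies before constraint `k + 1`; moved on by one period it comes after it,
        -- so that `feasible_strict` applies with the edges `x + m` and `y + m`.
        rw [← H.vert_periodic, show x + 1 + m = x + m + 1 by ring]
        exact H.feasible_strict (b' := y + m) (by rwa [H.len_periodic]) (by rwa [H.len_periodic])
          (by omega) (by omega) (by omega)
      have h0 : a (x + 1) ⬝ᵥ vert c a (x + 1) = 0 := dot_vert_self _
      have hc := H.dot_vert
      -- A Plücker relation. Its fourth term vanishes because corner `x + 1` lies on the line of
      -- constraint `x + 1`.
      have plucker : (a (x + 1) ⬝ᵥ vert c a k) *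
            (vert c a (x + 1) ⬝ᵥ (vert c a (y + 1) ⨯₃ vert c a (k + 1))) =
          (a (x + 1) ⬝ᵥ vert c a (y + 1)) * (vert c a (x + 1) ⬝ᵥ (vert c a k ⨯₃ vert c a (k + 1)))
          + (a (x + 1) ⬝ᵥ vert c a (k + 1)) *
            (vert c a (x + 1) ⬝ᵥ (vert c a (y + 1) ⨯₃ vert c a k)) := by
        generalize vert c a (x + 1) = X at *
        generalize vert c a (y + 1) = Y at *
        generalize vert c a k = K at *
        generalize vert c a (k + 1) = L at *
        generalize a (x + 1) = p at *
        have : (p ⬝ᵥ K) * (X ⬝ᵥ (Y ⨯₃ L)) = (p ⬝ᵥ Y) * (X ⬝ᵥ (K ⨯₃ L)) +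
            (p ⬝ᵥ L) * (X ⬝ᵥ (Y ⨯₃ K)) - (p ⬝ᵥ X) * (Y ⬝ᵥ (K ⨯₃ L)) := by
          simp only [dot3, cross_zero, cross_one, cross_two]; ring
        rw [this, h0]; ring
      have hpos : 0 < vert c a (x + 1) ⬝ᵥ (vert c a (y + 1) ⨯₃ vert c a (k + 1)) := by
        refine pos_of_mul_pos_right ?_ hpk.le
        rw [plucker]
        exact add_pos_of_pos_of_nonneg (mul_pos hpy hD) (mul_nonneg hpk1 ih1)
      exact ⟨hpos.le, fun _ _ _ _ => hpos⟩

/-- The ends of the edges of positive length are in counterclockwise order. -/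
theorem det_pos (H : ConvexChain c m a) {x y z : ℕ} (hx : 0 < len c a x) (hy : 0 < len c a y)
    (hz : 0 < len c a z) (hxy : x < y) (hyz : y < z) (hzm : z < x + m) :
    0 < vert c a (x + 1) ⬝ᵥ (vert c a (y + 1) ⨯₃ vert c a (z + 1)) :=
  (H.det_aux hx hy hxy (by omega) (by omega)).2 z hyz (by omega) hz

/-- On the line of constraint `j + 1`, constraint `j` bounds the position from below by corner `j`,
and constraint `j + 2` bounds it from above by corner `j + 1`. -/
theorem mem_edge (H : ConvexChain c m a) {y : Vec3} (hc : c ⬝ᵥ y = -1) (j : ℕ)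
    (hy : a (j + 1) ⬝ᵥ y = 0) (h0 : 0 ≤ a j ⬝ᵥ y) (h2 : 0 ≤ a (j + 2) ⬝ᵥ y) :
    ∃ s t : ℝ, 0 ≤ s ∧ 0 ≤ t ∧ y = s • vert c a j + t • vert c a (j + 1) := by
  have hv := H.dot_vert j
  have hv2 := dot_vert_succ (c := c) (a := a) j
  have hv1 := dot_vert_self (c := c) (a := a) j
  have hv3 := dot_vert_succ (c := c) (a := a) (j + 1)
  have t1 := H.turn j
  have t2 := H.turn (j + 1)
  have hL := H.len_nonneg j
  rw [show j + 1 + 1 = j + 2 from rfl] at hv3 t2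
  rw [H.vert_step] at hv3 ⊢
  generalize vert c a j = v at *
  generalize a (j + 1) = k at *
  generalize a (j + 2) = q at *
  generalize a j = p at *
  generalize len c a j = l at *
  set x := (p ⬝ᵥ y) / (p ⬝ᵥ (c ⨯₃ k)) with hx
  have e1 : p ⬝ᵥ (c ⨯₃ k) = -(c ⬝ᵥ (p ⨯₃ k)) := by
    simp only [dot3, cross_zero, cross_one, cross_two]; ring
  have e2 : q ⬝ᵥ (c ⨯₃ k) = c ⬝ᵥ (k ⨯₃ q) := by
    simp only [dot3, cross_zero, cross_one, cross_two]; ring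
  have hp : 0 < p ⬝ᵥ (c ⨯₃ k) := by rw [e1]; linarith
  have hxnn : 0 ≤ x := div_nonneg h0 hp.le
  have hxy : y = v + x • (c ⨯₃ k) := by
    have : y - (v + x • (c ⨯₃ k)) = 0 := by
      refine eq_zero_of_dot_eq_zero (p := c) (q := p) (r := k) t1.ne ?_ ?_ ?_
      · rw [dotProduct_sub, dotProduct_add, dotProduct_smul, dot_self_cross, hc, hv]; simp
      · rw [dotProduct_sub, dotProduct_add, dotProduct_smul, hv1, hx, smul_eq_mul,
          div_mul_cancel₀ _ hp.ne']; simp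
      · rw [dotProduct_sub, dotProduct_add, dotProduct_smul, dot_cross_self, hy, hv2]; simp
    exact sub_eq_zero.1 this
  have hxl : x ≤ l := by
    rw [hxy, dotProduct_add, dotProduct_smul, e2, smul_eq_mul] at h2
    rw [dotProduct_add, dotProduct_smul, e2, smul_eq_mul] at hv3
    nlinarith
  rcases hL.eq_or_lt with h | h
  · refine ⟨1, 0, zero_le_one, le_rfl, ?_⟩
    have : x = 0 := le_antisymm (by rw [h]; exact hxl) hxnn
    rw [hxy, this]; simp
  · refine ⟨1 - x / l, x / l, ?_, div_nonneg hxnn hL, ?_⟩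
    · rw [sub_nonneg, div_le_one h]; exact hxl
    · rw [hxy, smul_add, smul_smul, div_mul_cancel₀ _ h.ne']
      module

/-- The cone is generated by the corners of the chain. -/
theorem exists_combination (H : ConvexChain c m a) {d : Vec3} (hd : d ∈ feasibleCone c a) :
    ∃ (j : ℕ) (r s t : ℝ), 0 ≤ r ∧ 0 ≤ s ∧ 0 ≤ t ∧
      d = r • vert c a 0 + s • vert c a j + t • vert c a (j + 1) := by
  obtain ⟨hdc, hda⟩ := hd
  set δ := -(c ⬝ᵥ d) with hδ
  have hδpos : 0 < δ := by rw [hδ]; linarith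
  -- The ray from corner `0` through the normalized point leaves the polygon, by boundedness. The
  -- exit point lies on an edge, and the given point lies between corner `0` and the exit point.
  set w := δ⁻¹ • d - vert c a 0 with hw
  have hdw : d = δ • (vert c a 0 + w) := by
    rw [hw, add_sub_cancel, smul_smul, mul_inv_cancel₀ hδpos.ne', one_smul]
  have hcw : c ⬝ᵥ w = 0 := by
    rw [hw, dotProduct_sub, dotProduct_smul, H.dot_vert, smul_eq_mul,
      show c ⬝ᵥ d = -δ by rw [hδ]; ring]
    field_simp; ring
  by_cases hw0 : w = 0
  · refine ⟨0, δ, 0, 0, hδpos.le, le_rfl, le_rfl, ?_⟩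
    rw [hdw, hw0]; simp
  have hmod : ∀ j, a j = a (j % m) := fun j => by
    conv_lhs => rw [← Nat.mod_add_div' j m]
    rw [periodic_mul H.toAngularCycle]
  have hneg : ∃ j, a j ⬝ᵥ w < 0 := by
    by_contra h
    push Not at h
    exact hw0 (H.bounded w hcw h)
  obtain ⟨j₀, hj₀⟩ := hneg
  -- Constraint `j` is the first one to become active along the ray, at parameter `t`. Feasibility
  -- of `d` gives `t ≥ 1`.
  obtain ⟨j, hj, hmin⟩ := Finset.exists_min_image ((Finset.range m).filter fun j => a j ⬝ᵥ w < 0)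
    (fun j => (a j ⬝ᵥ vert c a 0) / -(a j ⬝ᵥ w))
    ⟨j₀ % m, by
      simp only [Finset.mem_filter, Finset.mem_range]
      exact ⟨Nat.mod_lt _ H.pos, by rwa [← hmod]⟩⟩
  simp only [Finset.mem_filter, Finset.mem_range] at hj hmin
  set t := (a j ⬝ᵥ vert c a 0) / -(a j ⬝ᵥ w) with ht
  have hjneg : 0 < -(a j ⬝ᵥ w) := by linarith [hj.2]
  have ht1 : 1 ≤ t := by
    rw [ht, le_div_iff₀ hjneg]
    have := hda j
    rw [hdw, dotProduct_smul, smul_eq_mul, dotProduct_add] at this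
    have := nonneg_of_mul_nonneg_right this hδpos
    linarith
  have hfeas : ∀ i, 0 ≤ a i ⬝ᵥ (vert c a 0 + t • w) := by
    intro i
    rw [hmod i, dotProduct_add, dotProduct_smul, smul_eq_mul]
    have hi := Nat.mod_lt i H.pos
    by_cases h : a (i % m) ⬝ᵥ w < 0
    · have h1 := hmin _ ⟨hi, h⟩
      rw [le_div_iff₀ (by linarith)] at h1
      linarith
    · push Not at h
      have := H.feasible (i % m) 0
      nlinarith
  have hj0 : a (j + m - 1 + 1) ⬝ᵥ (vert c a 0 + t • w) = 0 := by
    rw [show j + m - 1 + 1 = j + m by have := H.pos; omega, H.periodic, dotProduct_add,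
      dotProduct_smul, smul_eq_mul, ht]
    field_simp [hjneg.ne', hj.2.ne]; ring
  -- The line of constraint `j` carries edge `j - 1`; adding `m` keeps the index a natural number.
  obtain ⟨s, u, hs, hu, hsu⟩ := H.mem_edge (y := vert c a 0 + t • w)
    (by rw [dotProduct_add, dotProduct_smul, hcw, H.dot_vert]; simp) (j + m - 1) hj0
    (hfeas _) (hfeas _)
  have htpos : 0 < t := by linarith
  refine ⟨j + m - 1, δ * (1 - 1 / t), δ * (1 / t) * s, δ * (1 / t) * u, ?_, by positivity,
    by positivity, ?_⟩
  · refine mul_nonneg hδpos.le ?_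
    rw [sub_nonneg, div_le_one htpos]; exact ht1
  · have : w = (1 / t) • (s • vert c a (j + m - 1) + u • vert c a (j + m - 1 + 1) - vert c a 0) := by
      rw [← hsu, add_sub_cancel_left, smul_smul, one_div_mul_cancel htpos.ne', one_smul]
    rw [hdw, this]
    module

end ConvexChain

/-! ## The ray cycle -/

/-- A vector is not a nonnegative combination of others that lie strictly on one side of a plane
through it. -/
theorem notMem_span_of_dot {m : ℕ} {v : Fin m → Vec3} {k : Fin m} {g : Vec3} (h0 : v k ≠ 0)
    (hg : g ⬝ᵥ v k ≤ 0) (hpos : ∀ l, l ≠ k → 0 < g ⬝ᵥ v l) :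
    v k ∉ Submodule.span NNReal (v '' {k}ᶜ) := by
  have key : ∀ x ∈ Submodule.span NNReal (v '' {k}ᶜ), x = 0 ∨ 0 < g ⬝ᵥ x := by
    intro x hx
    induction hx using Submodule.span_induction with
    | mem x hx =>
      obtain ⟨l, hl, rfl⟩ := hx
      exact Or.inr (hpos l hl)
    | zero => exact Or.inl rfl
    | add x y _ _ hx hy =>
      rcases hx with rfl | hx
      · simpa using hy
      · rcases hy with rfl | hy
        · right; simpa using hx
        · right; rw [dotProduct_add]; exact add_pos hx hy
    | smul r x _ hx =>
      rcases hx with rfl | hx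
      · left; simp
      · rcases eq_or_ne r 0 with rfl | hr
        · left; simp
        · right
          rw [NNReal.smul_def, dotProduct_smul, smul_eq_mul]
          exact mul_pos (NNReal.coe_pos.2 (pos_iff_ne_zero.2 hr)) hx
  intro h
  rcases key _ h with h | h
  · exact h0 h
  · linarith

/-- With `p` and `q` the cyclic neighbours of `k`, the functional `v p ⨯₃ v k + v k ⨯₃ v q` supports
the cone exactly along `v k`. Its first summand vanishes only at `p` and `k`, its second only at `k`
and `q`, and `p ≠ q` because `3 ≤ r`. -/
theorem irredundant_of_cyclic {r : ℕ} {v : Fin r → Vec3} (hr : 3 ≤ r)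
    (hv : ∀ i j k, i < j → j < k → 0 < v i ⬝ᵥ (v j ⨯₃ v k)) (k : Fin r) :
    v k ∉ Submodule.span NNReal (v '' {k}ᶜ) := by
  have h3 : ∀ i j k, i < j → j < k → 0 < v j ⬝ᵥ (v k ⨯₃ v i) := fun i j k h1 h2 => by
    rw [← triple_rotate]; exact hv i j k h1 h2
  have h4 : ∀ i j k, i < j → j < k → 0 < v k ⬝ᵥ (v i ⨯₃ v j) := fun i j k h1 h2 => by
    rw [← triple_rotate]; exact h3 i j k h1 h2
  have hz : v k ≠ 0 := by
    intro h
    obtain ⟨k, hk⟩ := k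
    rcases Nat.lt_or_ge k 1 with h1 | h1
    · have := hv ⟨k, hk⟩ ⟨k + 1, by omega⟩ ⟨k + 2, by omega⟩ (by simp) (by simp)
      rw [h] at this; simp at this
    · rcases Nat.lt_or_ge (k + 1) r with h2 | h2
      · have := h3 ⟨k - 1, by omega⟩ ⟨k, hk⟩ ⟨k + 1, by omega⟩ (by simp; omega) (by simp)
        rw [h] at this; simp at this
      · have := h4 ⟨k - 2, by omega⟩ ⟨k - 1, by omega⟩ ⟨k, hk⟩ (by simp; omega) (by simp; omega)
        rw [h] at this; simp at this
  -- Three cases: `k` is the first, the last, or an inner index. They differ only in how the cyclic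
  -- rotation of the determinant restores increasing order.
  have main : ∃ p q : Fin r, (∀ l, l ≠ k → 0 ≤ v p ⬝ᵥ (v k ⨯₃ v l)) ∧
      (∀ l, l ≠ k → 0 ≤ v k ⬝ᵥ (v q ⨯₃ v l)) ∧
      ∀ l, l ≠ k → 0 < v p ⬝ᵥ (v k ⨯₃ v l) ∨ 0 < v k ⬝ᵥ (v q ⨯₃ v l) := by
    have hself : ∀ x y : Vec3, x ⬝ᵥ (y ⨯₃ x) = 0 := fun x y => dot_cross_self _ _
    rcases Nat.lt_or_ge k.1 1 with h1 | h1
    · have hp : ∀ l, l ≠ k → l ≠ ⟨r - 1, by omega⟩ → 0 < v ⟨r - 1, by omega⟩ ⬝ᵥ (v k ⨯₃ v l) :=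
        fun l h5 h6 => h4 k l ⟨r - 1, by omega⟩ (by grind) (by grind)
      have hq : ∀ l, l ≠ k → l ≠ ⟨1, by omega⟩ → 0 < v k ⬝ᵥ (v ⟨1, by omega⟩ ⨯₃ v l) :=
        fun l h5 h6 => hv k ⟨1, by omega⟩ l (by grind) (by grind)
      refine ⟨⟨r - 1, by omega⟩, ⟨1, by omega⟩, fun l hl => ?_, fun l hl => ?_, fun l hl => ?_⟩
      · by_cases h : l = ⟨r - 1, by omega⟩
        · subst h; rw [hself]
        · exact (hp l hl h).le
      · by_cases h : l = ⟨1, by omega⟩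
        · subst h; rw [cross_self, dotProduct_zero]
        · exact (hq l hl h).le
      · by_cases h : l = ⟨1, by omega⟩
        · exact Or.inl (hp l hl (by rw [h]; simp; omega))
        · exact Or.inr (hq l hl h)
    · rcases Nat.lt_or_ge (k.1 + 1) r with h2 | h2
      · have hp : ∀ l, l ≠ k → l ≠ ⟨k - 1, by omega⟩ → 0 < v ⟨k - 1, by omega⟩ ⬝ᵥ (v k ⨯₃ v l) := by
          intro l h5 h6
          rcases lt_or_gt_of_ne h5 with h | h
          · exact h3 l ⟨k - 1, by omega⟩ k (by grind) (by grind)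
          · exact hv ⟨k - 1, by omega⟩ k l (by grind) h
        have hq : ∀ l, l ≠ k → l ≠ ⟨k + 1, by omega⟩ → 0 < v k ⬝ᵥ (v ⟨k + 1, by omega⟩ ⨯₃ v l) := by
          intro l h5 h6
          rcases lt_or_gt_of_ne h5 with h | h
          · exact h3 l k ⟨k + 1, by omega⟩ h (by grind)
          · exact hv k ⟨k + 1, by omega⟩ l (by grind) (by grind)
        refine ⟨⟨k - 1, by omega⟩, ⟨k + 1, by omega⟩, fun l hl => ?_, fun l hl => ?_, fun l hl => ?_⟩
        · by_cases h : l = ⟨k - 1, by omega⟩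
          · subst h; rw [hself]
          · exact (hp l hl h).le
        · by_cases h : l = ⟨k + 1, by omega⟩
          · subst h; rw [cross_self, dotProduct_zero]
          · exact (hq l hl h).le
        · by_cases h : l = ⟨k + 1, by omega⟩
          · exact Or.inl (hp l hl (by rw [h]; simp; omega))
          · exact Or.inr (hq l hl h)
      · have hp : ∀ l, l ≠ k → l ≠ ⟨k - 1, by omega⟩ → 0 < v ⟨k - 1, by omega⟩ ⬝ᵥ (v k ⨯₃ v l) :=
          fun l h5 h6 => h3 l ⟨k - 1, by omega⟩ k (by grind) (by grind)
        have hq : ∀ l, l ≠ k → l ≠ ⟨0, by omega⟩ → 0 < v k ⬝ᵥ (v ⟨0, by omega⟩ ⨯₃ v l) :=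
          fun l h5 h6 => h4 ⟨0, by omega⟩ l k (by grind) (by grind)
        refine ⟨⟨k - 1, by omega⟩, ⟨0, by omega⟩, fun l hl => ?_, fun l hl => ?_, fun l hl => ?_⟩
        · by_cases h : l = ⟨k - 1, by omega⟩
          · subst h; rw [hself]
          · exact (hp l hl h).le
        · by_cases h : l = ⟨0, by omega⟩
          · subst h; rw [cross_self, dotProduct_zero]
          · exact (hq l hl h).le
        · by_cases h : l = ⟨0, by omega⟩
          · exact Or.inl (hp l hl (by rw [h]; simp; omega))
          · exact Or.inr (hq l hl h)
  obtain ⟨p, q, hp, hq, hpq⟩ := main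
  have e : ∀ l, (v p ⨯₃ v k + v k ⨯₃ v q) ⬝ᵥ v l =
      v p ⬝ᵥ (v k ⨯₃ v l) + v k ⬝ᵥ (v q ⨯₃ v l) := fun l => by
    simp only [dot3, cross_zero, cross_one, cross_two, Pi.add_apply]; ring
  refine notMem_span_of_dot (g := v p ⨯₃ v k + v k ⨯₃ v q) hz ?_ fun l hl => ?_
  · rw [e, cross_self, dotProduct_zero, dot_cross_self, add_zero]
  · rw [e]
    rcases hpq l hl with h | h
    · exact add_pos_of_pos_of_nonneg h (hq l hl)
    · exact add_pos_of_nonneg_of_pos (hp l hl) h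

end Casting

/-! ### Extreme rays of the cone of a convex chain -/

namespace Casting

theorem feasibleCone_add {c : Vec3} {a : ℕ → Vec3} {x y : Vec3} (hx : x ∈ feasibleCone c a)
    (hy : y ∈ feasibleCone c a) : x + y ∈ feasibleCone c a :=
  ⟨by rw [dotProduct_add]; linarith [hx.1, hy.1],
    fun i => by rw [dotProduct_add]; linarith [hx.2 i, hy.2 i]⟩

theorem feasibleCone_smul {c : Vec3} {a : ℕ → Vec3} {x : Vec3} {r : ℝ} (hr : 0 < r)
    (hx : x ∈ feasibleCone c a) : r • x ∈ feasibleCone c a :=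
  ⟨by rw [dotProduct_smul, smul_eq_mul]; exact mul_neg_of_pos_of_neg hr hx.1,
    fun i => by rw [dotProduct_smul, smul_eq_mul]; exact mul_nonneg hr.le (hx.2 i)⟩

theorem mem_feasibleCone_of_mem_span {c : Vec3} {a : ℕ → Vec3} {S : Set Vec3}
    (hS : S ⊆ feasibleCone c a) {x : Vec3} (hx : x ∈ Submodule.span NNReal S) :
    x = 0 ∨ x ∈ feasibleCone c a := by
  induction hx using Submodule.span_induction with
  | mem x hx => exact Or.inr (hS hx)
  | zero => exact Or.inl rfl
  | add x y _ _ hx hy =>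
    rcases hx with rfl | hx
    · simpa using hy
    · rcases hy with rfl | hy
      · right; simpa using hx
      · exact Or.inr (feasibleCone_add hx hy)
  | smul r x _ hx =>
    rcases hx with rfl | hx
    · left; simp
    · rcases eq_or_ne r 0 with rfl | hr
      · left; simp
      · exact Or.inr (feasibleCone_smul (NNReal.coe_pos.2 (pos_iff_ne_zero.2 hr)) hx)

theorem smul_mem_nnspan {S : Set Vec3} {x : Vec3} {r : ℝ} (hr : 0 ≤ r)
    (hx : x ∈ Submodule.span NNReal S) : r • x ∈ Submodule.span NNReal S :=
  (Submodule.span NNReal S).smul_mem ⟨r, hr⟩ hx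

namespace ConvexChain

variable {c : Vec3} {m : ℕ} {a : ℕ → Vec3}

theorem vert_mem (H : ConvexChain c m a) (i : ℕ) : vert c a i ∈ feasibleCone c a :=
  ⟨by rw [H.dot_vert]; norm_num, fun j => H.feasible j i⟩

theorem cross_eq_smul_vert (H : ConvexChain c m a) (i : ℕ) :
    a i ⨯₃ a (i + 1) = (-(c ⬝ᵥ (a i ⨯₃ a (i + 1)))) • vert c a i := by
  have := (H.turn i).ne
  rw [vert, smul_smul, mul_inv_cancel₀ (by simpa using this), one_smul]

theorem cross_mem (H : ConvexChain c m a) (i : ℕ) : a i ⨯₃ a (i + 1) ∈ feasibleCone c a := by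
  rw [H.cross_eq_smul_vert]
  exact feasibleCone_smul (by linarith [H.turn i]) (H.vert_mem i)

/-- The cone is generated by the corners, so it suffices that the chosen vectors are feasible and
generate the corners. Zero has to be removed since it violates `c ⬝ᵥ d < 0`. -/
theorem eq_span_of_vert_mem (H : ConvexChain c m a) {r : ℕ} {v : Fin r → Vec3}
    (hv : ∀ t, v t ∈ feasibleCone c a)
    (h : ∀ i, vert c a i ∈ Submodule.span NNReal (Set.range v)) :
    feasibleCone c a = (Submodule.span NNReal (Set.range v) : Set Vec3) \ {0} := by
  ext d
  constructor
  · intro hd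
    refine ⟨?_, ?_⟩
    · obtain ⟨j, p, q, s, hp, hq, hs, rfl⟩ := H.exists_combination hd
      exact add_mem (add_mem (smul_mem_nnspan hp (h _)) (smul_mem_nnspan hq (h _)))
        (smul_mem_nnspan hs (h _))
    · rintro rfl
      simpa using hd.1
  · rintro ⟨h1, h2⟩
    refine (mem_feasibleCone_of_mem_span ?_ h1).resolve_left h2
    rintro _ ⟨t, rfl⟩
    exact hv t

theorem vert_eq_of_len_eq_zero (H : ConvexChain c m a) {i k : ℕ} (hik : i ≤ k)
    (h : ∀ b, i ≤ b → b < k → ¬ 0 < len c a b) : vert c a k = vert c a i := by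
  induction k, hik using Nat.le_induction with
  | base => rfl
  | succ k hk ih =>
    have := le_antisymm (not_lt.1 (h k hk (by omega))) (H.len_nonneg k)
    rw [H.vert_step, this, zero_smul, add_zero]
    exact ih fun b h1 h2 => h b h1 (by omega)

/-- If all edges have length zero then the cone is a single ray. -/
theorem isRayCycle_single (H : ConvexChain c m a) (h : ∀ i < m, ¬ 0 < cornerDet a i) :
    IsRayCycle (fun _ : Fin 1 => a 0 ⨯₃ a 1) (feasibleCone c a) where
  eq_span := by
    refine H.eq_span_of_vert_mem (fun _ => H.cross_mem 0) fun i => ?_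
    obtain ⟨k, _, hk, e⟩ := H.exists_window 0 i
    rw [e, H.vert_eq_of_len_eq_zero (Nat.zero_le k) fun b _ hb => by
      rw [H.len_pos_iff]; exact h b (by omega), vert]
    refine smul_mem_nnspan (inv_nonneg.2 ?_) (Submodule.subset_span ⟨0, rfl⟩)
    linarith [H.turn 0]
  irredundant k := by
    refine notMem_span_of_dot (g := 0) ?_ (by simp) fun l hl => absurd (Subsingleton.elim l k) hl
    intro h0
    have := H.turn 0
    simp only [zero_add] at this
    rw [h0] at this; simp at this
  cyclic i j k hij := absurd hij (by simp [Subsingleton.elim i j])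

/-- The sequence `idx` lists the edges of positive length. The vector for edge `idx t` is a positive
multiple of its end, and every corner is the end of the last such edge before it. -/
theorem isRayCycle (H : ConvexChain c m a) {r : ℕ} (hr : r ≠ 0) (idx : ℕ → ℕ)
    (hmono : ∀ i j, i < j → j < r → idx i < idx j) (hlt : ∀ i < r, idx i < m)
    (hpos : ∀ i < r, 0 < cornerDet a (idx i))
    (hall : ∀ i < m, 0 < cornerDet a i → ∃ t < r, idx t = i) :
    IsRayCycle (fun t : Fin r => a (idx t + 1) ⨯₃ a (idx t + 2)) (feasibleCone c a) := by
  have hposl : ∀ i < r, 0 < len c a (idx i) := fun i hi => (H.len_pos_iff _).2 (hpos i hi)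
  have hcyc : ∀ i j k : Fin r, i < j → j < k →
      0 < (a (idx i + 1) ⨯₃ a (idx i + 2)) ⬝ᵥ
        ((a (idx j + 1) ⨯₃ a (idx j + 2)) ⨯₃ (a (idx k + 1) ⨯₃ a (idx k + 2))) := by
    intro i j k hij hjk
    have h := H.det_pos (hposl i i.2) (hposl j j.2) (hposl k k.2) (hmono i j hij j.2)
      (hmono j k hjk k.2) (lt_of_lt_of_le (hlt k k.2) (Nat.le_add_left _ _))
    rw [H.cross_eq_smul_vert (idx i + 1), H.cross_eq_smul_vert (idx j + 1),
      H.cross_eq_smul_vert (idx k + 1)]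
    have h1 := H.turn (idx i + 1)
    have h2 := H.turn (idx j + 1)
    have h3 := H.turn (idx k + 1)
    simp only [map_smul, LinearMap.smul_apply, dotProduct_smul, smul_dotProduct, smul_eq_mul]
    exact mul_pos (by linarith) (mul_pos (by linarith) (mul_pos (by linarith) h))
  refine ⟨H.eq_span_of_vert_mem (fun t => H.cross_mem _) fun i => ?_, fun k => ?_, hcyc⟩
  · have hmem : ∀ t < r, vert c a (idx t + 1) ∈ Submodule.span NNReal
        (Set.range fun t : Fin r => a (idx t + 1) ⨯₃ a (idx t + 2)) := by
      intro t ht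
      rw [vert]
      refine smul_mem_nnspan (inv_nonneg.2 ?_) (Submodule.subset_span ⟨⟨t, ht⟩, rfl⟩)
      linarith [H.turn (idx t + 1)]
    -- The window starts at the end of the first edge of positive length, so each of its corners has
    -- such an edge before it. It may run into the second period, hence the cases `k < m` and `m ≤
    -- k` below.
    obtain ⟨k, hk1, hk2, e⟩ := H.exists_window (idx 0 + 1) i
    rw [e]
    clear e
    induction k, hk1 using Nat.le_induction with
    | base => exact hmem 0 (by omega)
    | succ k hk ih =>
      by_cases h : 0 < len c a k
      · rcases Nat.lt_or_ge k m with hkm | hkm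
        · obtain ⟨t, ht, rfl⟩ := hall k hkm ((H.len_pos_iff _).1 h)
          exact hmem t ht
        · have h0 := hlt 0 (by omega)
          obtain ⟨k, rfl⟩ := Nat.exists_eq_add_of_le' hkm
          rw [H.len_periodic] at h
          obtain ⟨t, ht, rfl⟩ := hall k (by omega) ((H.len_pos_iff _).1 h)
          rw [show idx t + m + 1 = idx t + 1 + m by ring, H.vert_periodic]
          exact hmem t ht
      · rw [H.vert_eq_of_len_eq_zero (i := k) (by omega) fun b h1 h2 => by
          rwa [show b = k by omega]]
        exact ih (by omega)
  · rcases Nat.lt_or_ge r 3 with h3 | h3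
    · have hz : ∀ t : Fin r, a (idx t + 1) ⨯₃ a (idx t + 2) ≠ 0 := fun t h0 => by
        have := H.turn (idx t + 1)
        rw [show idx t + 1 + 1 = idx t + 2 from rfl, h0] at this; simp at this
      rcases (show r = 1 ∨ r = 2 by omega) with rfl | rfl
      · exact notMem_span_of_dot (g := 0) (hz k) (by simp)
          fun l hl => absurd (Subsingleton.elim l k) hl
      -- With two such edges the chain runs back and forth along a segment. No other edge moves the
      -- corner, so edge `idx 1` starts at the end of edge `idx 0`; its positive length keeps the
      -- two vectors from being parallel.
      · have h01 := hmono 0 1 (by omega) (by omega)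
        have e : vert c a (idx 1) = vert c a (idx 0 + 1) := by
          refine H.vert_eq_of_len_eq_zero (by omega) fun b h1 h2 hb => ?_
          obtain ⟨t, ht, rfl⟩ := hall b (by have := hlt 1 (by omega); omega) ((H.len_pos_iff _).1 hb)
          rcases (show t = 0 ∨ t = 1 by omega) with rfl | rfl <;> omega
        have hcr := H.vert_cross (idx 1)
        rw [e] at hcr
        have hne : (a (idx 0 + 1) ⨯₃ a (idx 0 + 2)) ⨯₃ (a (idx 1 + 1) ⨯₃ a (idx 1 + 2)) ≠ 0 := by
          rw [H.cross_eq_smul_vert (idx 0 + 1), H.cross_eq_smul_vert (idx 1 + 1)]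
          simp only [map_smul, LinearMap.smul_apply, hcr]
          have ha : a (idx 1 + 1) ≠ 0 := fun h0 => by
            have := H.turn (idx 1 + 1)
            rw [h0] at this; simp at this
          have t0 := (H.turn (idx 0 + 1)).ne
          have t1 := (H.turn (idx 1 + 1)).ne
          exact smul_ne_zero (neg_ne_zero.2 t1)
            (smul_ne_zero (neg_ne_zero.2 t0) (smul_ne_zero (hposl 1 (by omega)).ne' ha))
        -- For independent `x` and `y`, the functional `(x ⨯₃ y) ⨯₃ x` separates the two rays: it
        -- vanishes on `x` and is positive on `y`.
        have hq : ∀ x y : Vec3, x ⨯₃ y ≠ 0 → ((x ⨯₃ y) ⨯₃ x) ⬝ᵥ x ≤ 0 ∧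
            0 < ((x ⨯₃ y) ⨯₃ x) ⬝ᵥ y := fun x y h => by
          have := dot_self_pos h
          constructor
          · rw [dotProduct_comm, dot_cross_self]
          · rw [show ((x ⨯₃ y) ⨯₃ x) ⬝ᵥ y = (x ⨯₃ y) ⬝ᵥ (x ⨯₃ y) by
              simp only [dot3, cross_zero, cross_one, cross_two]; ring]
            exact this
        have hne' := hne
        rw [← cross_anticomm, neg_ne_zero] at hne'
        have hall2 : ∀ l : Fin 2, l ≠ k → (k = 0 ∧ l = 1) ∨ (k = 1 ∧ l = 0) := by
          intro l hl; omega
        rcases (show k = 0 ∨ k = 1 by omega) with rfl | rfl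
        · refine notMem_span_of_dot (hz 0) (hq _ _ hne).1 fun l hl => ?_
          rcases hall2 l hl with ⟨_, rfl⟩ | ⟨h, _⟩
          · exact (hq _ _ hne).2
          · exact absurd h (by decide)
        · refine notMem_span_of_dot (hz 1) (hq _ _ hne').1 fun l hl => ?_
          rcases hall2 l hl with ⟨h, _⟩ | ⟨_, rfl⟩
          · exact absurd h (by decide)
          · exact (hq _ _ hne').2
    · exact irredundant_of_cyclic (v := fun t : Fin r => a (idx t + 1) ⨯₃ a (idx t + 2)) h3 hcyc k

end ConvexChain

/-! ## Elimination of redundant half-planes -/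

/-- The state of the elimination: a sorted cycle with the same cone as the given one, in which `g`
corners just before the last constraint have been found good. -/
structure Elimination (c : Vec3) (S : Set Vec3) (m g : ℕ) (a : ℕ → Vec3) : Prop
    extends AngularCycle c m a where
  two_le : 2 ≤ m
  le : g ≤ m
  cone : ∀ d, c ⬝ᵥ d ≤ 0 → ((∀ i, 0 ≤ a i ⬝ᵥ d) ↔ ∀ n ∈ S, 0 ≤ n ⬝ᵥ d)
  good : ∀ t, 1 ≤ t → t ≤ g → 0 ≤ cornerDet a (2 * m - 2 - t)

namespace Elimination

variable {c : Vec3} {S : Set Vec3} {m g : ℕ} {a : ℕ → Vec3}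

/-- The tested corner `m - 2` recurs at `2 * m - 2`, which the shift moves to `2 * m - 3`: it
becomes the entry `t = 1` of `good`, and the others move up by one. Positions in the second period
avoid negative indices for `t` up to `m`. -/
theorem rotate (H : Elimination c S m g a) (hg : g < m) (h : 0 ≤ cornerDet a (m - 2)) :
    Elimination c S m (g + 1) (fun i => a (i + 1)) where
  periodic i := by rw [show i + m + 1 = i + 1 + m by ring, H.periodic]
  turn i := H.turn (i + 1)
  sorted i j k hij hjk hk := H.sorted _ _ _ (by omega) (by omega) (by omega)
  two_le := H.two_le
  le := hg
  cone d hd := by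
    rw [← H.cone d hd]
    refine ⟨fun h i => ?_, fun h i => h _⟩
    have := h (i + m - 1)
    rwa [show i + m - 1 + 1 = i + m by have := H.two_le; omega, H.periodic] at this
  good t h1 h2 := by
    have h2m := H.two_le
    have e : cornerDet (fun i => a (i + 1)) (2 * m - 2 - t) = cornerDet a (2 * m - 2 - (t - 1)) := by
      unfold cornerDet
      rw [show 2 * m - 2 - (t - 1) = 2 * m - 2 - t + 1 by omega]
    rw [e]
    rcases Nat.eq_or_lt_of_le h1 with rfl | h3
    · have e2 : cornerDet a (m - 2 + m) = cornerDet a (m - 2) := by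
        unfold cornerDet
        rw [show m - 2 + m + 1 = m - 2 + 1 + m by ring, show m - 2 + m + 2 = m - 2 + 2 + m by ring,
          H.periodic, H.periodic, H.periodic]
      rw [show 2 * m - 2 - (1 - 1) = m - 2 + m by omega, e2]
      exact h
    · exact H.good (t - 1) (by omega) (by omega)

/-- The positions of a period of length `m' + 1` whose last element is skipped. -/
theorem skip_strictMono (m' : ℕ) : StrictMono fun i : ℕ => i + i / m' :=
  strictMono_nat_of_lt_succ fun i => by
    have : i / m' ≤ (i + 1) / m' := Nat.div_le_div_right (by omega)
    show i + i / m' < i + 1 + (i + 1) / m'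
    omega

/-- With period two, the turns from `a 0` to `a 1` and back would have opposite signs. -/
theorem three_le (H : AngularCycle c m a) (hm : 2 ≤ m) : 3 ≤ m := by
  by_contra h
  have : m = 2 := by omega
  subst this
  have h1 := H.turn 0
  have h2 := H.turn 1
  rw [show 1 + 1 = 0 + 2 from rfl, H.periodic, ← cross_anticomm, dotProduct_neg] at h2
  simp only [zero_add] at h1
  linarith

/-- The middle constraint `m - 1` of the bad corner is dropped. Modulo `m`, the counted corners that
can contain it are `m - 3`, the first one, and, if `g = m - 1`, also `m - 1`, the last one.
Forgetting the first and the last covers both, hence `g - 2`. -/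
theorem delete (H : Elimination c S m g a) (hg : g < m) (h : cornerDet a (m - 2) < 0)
    (hpq : c ⬝ᵥ (a (m - 2) ⨯₃ a m) < 0) :
    Elimination c S (m - 1) (g - 2) (fun i => a (i + i / (m - 1))) := by
  have h3 := three_le H.toAngularCycle H.two_le
  obtain ⟨n, rfl⟩ : ∃ n, m = n + 1 := ⟨m - 1, by omega⟩
  simp only [Nat.add_sub_cancel]
  have hn : 0 < n := by omega
  have hper : ∀ i, (i + n) + (i + n) / n = i + i / n + (n + 1) := by
    intro i; rw [Nat.add_div_right _ hn]; omega
  have hturn : ∀ i, c ⬝ᵥ (a (i + i / n) ⨯₃ a ((i + 1) + (i + 1) / n)) < 0 := by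
    intro i
    -- Exactly at these indices the reindexing jumps over a deleted constraint, and the new turn is
    -- `hpq`.
    by_cases hd : n ∣ i + 1
    · obtain ⟨q, hq⟩ := hd
      obtain ⟨q, rfl⟩ : ∃ q', q = q' + 1 := ⟨q - 1, by
        rcases q with _ | q
        · simp at hq
        · simp⟩
      have e1 : i / n = q := by
        rw [show i = n - 1 + n * q by rw [mul_add] at hq; omega, Nat.add_mul_div_left _ _ hn,
          Nat.div_eq_of_lt (by omega)]; simp
      have e2 : (i + 1) / n = q + 1 := by rw [hq, Nat.mul_div_cancel_left _ hn]
      have e3 : i + i / n = n + 1 - 2 + q * (n + 1) := by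
        rw [e1, show q * (n + 1) = n * q + q by ring]; rw [mul_add] at hq; omega
      have e4 : i + 1 + (i + 1) / n = n + 1 + q * (n + 1) := by
        rw [e2, hq]; ring
      rw [e3, e4, ConvexChain.periodic_mul H.toAngularCycle,
        ConvexChain.periodic_mul H.toAngularCycle]
      exact hpq
    · rw [Nat.succ_div_of_not_dvd hd, show i + 1 + i / n = i + i / n + 1 by ring]
      exact H.turn _
  have A := H.toAngularCycle.comp (skip_strictMono n) hper hturn
  refine ⟨A, by omega, by have := H.le; omega, fun d hd => ?_, fun t h1 h2 => ?_⟩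
  · rw [← H.cone d hd]
    refine ⟨fun hi => ?_, fun hi i => hi _⟩
    have hlow : ∀ i < n, 0 ≤ a i ⬝ᵥ d := fun i hi' => by
      have := hi i
      rwa [Nat.div_eq_of_lt hi', add_zero] at this
    have hlast : 0 ≤ a n ⬝ᵥ d := by
      have hp := hlow (n - 1) (by omega)
      have hq := hlow 0 hn
      have ha : a (n + 1) = a 0 := by rw [← H.periodic 0, zero_add]
      have t1 := H.turn (n - 1)
      have t2 := H.turn n
      rw [cornerDet, show n + 1 - 2 = n - 1 by omega, show n - 1 + 2 = n + 1 by omega] at h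
      rw [show n + 1 - 2 = n - 1 by omega] at hpq
      rw [show n - 1 + 1 = n by omega] at t1 h
      exact redundant_of_corner t1 t2 hpq h hd hp (by rwa [ha])
    intro i
    have : a i = a (i % (n + 1)) := by
      conv_lhs => rw [← Nat.mod_add_div' i (n + 1)]
      rw [ConvexChain.periodic_mul H.toAngularCycle]
    rw [this]
    have := Nat.mod_lt i (show 0 < n + 1 by omega)
    rcases Nat.lt_or_ge (i % (n + 1)) n with h5 | h5
    · exact hlow _ h5
    · rw [show i % (n + 1) = n by omega]; exact hlast
  · have hgood := H.good (t + 1) (by omega) (by omega)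
    have e : ∀ s, s ≤ 2 → (2 * n - 2 - t + s) / n = 1 := by
      intro s hs
      rw [Nat.div_eq_iff hn]; omega
    have e0 := e 0 (by omega)
    rw [add_zero] at e0
    unfold cornerDet at hgood ⊢
    simp only [e0, e 1 (by omega), e 2 (by omega)]
    rwa [show 2 * (n + 1) - 2 - (t + 1) = 2 * n - 2 - t + 1 by omega,
      show 2 * n - 2 - t + 1 + 2 = 2 * n - 2 - t + 2 + 1 by omega] at hgood

theorem infeasible (H : Elimination c S m g a) (h : cornerDet a (m - 2) < 0)
    (hpq : ¬ c ⬝ᵥ (a (m - 2) ⨯₃ a m) < 0) (d : Vec3) (hd : c ⬝ᵥ d < 0) :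
    ¬ ∀ n ∈ S, 0 ≤ n ⬝ᵥ d := by
  intro hS
  have h2 := H.two_le
  have hi := (H.cone d hd.le).2 hS
  have t1 := H.turn (m - 2)
  have t2 := H.turn (m - 1)
  rw [show m - 2 + 1 = m - 1 by omega] at t1
  rw [show m - 1 + 1 = m by omega] at t2
  rw [cornerDet, show m - 2 + 1 = m - 1 by omega, show m - 2 + 2 = m by omega] at h
  have := infeasible_of_corner t1 t2 (not_lt.1 hpq) h (hi _) (hi _) (hi _)
  linarith

/-- With `g` at least `m`, the values `t = 1, …, m` cover every residue modulo `m`, so all corners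
are good. -/
theorem convexChain (H : Elimination c S m g a) (hg : m ≤ g)
    (hS : ∀ w, c ⬝ᵥ w = 0 → (∀ n ∈ S, 0 ≤ n ⬝ᵥ w) → w = 0) : ConvexChain c m a where
  toAngularCycle := H.toAngularCycle
  pos := by have := H.two_le; omega
  corner i := by
    have h2 := H.two_le
    have hper : ∀ i t, cornerDet a (i + t * m) = cornerDet a i := fun i t => by
      unfold cornerDet
      rw [show i + t * m + 1 = i + 1 + t * m by ring, show i + t * m + 2 = i + 2 + t * m by ring]
      simp only [ConvexChain.periodic_mul H.toAngularCycle]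
    have hlt := Nat.mod_lt (i + 2) (show 0 < m by omega)
    have h1 := H.good (m - (i + 2) % m) (by omega) (by omega)
    have h3 := Nat.mod_add_div' (i + 2) m
    rw [← hper _ ((i + 2) / m), show 2 * m - 2 - (m - (i + 2) % m) + (i + 2) / m * m =
      i + 1 * m by omega, hper] at h1
    exact h1
  bounded w hw h := hS w hw ((H.cone w hw.le).1 h)

theorem feasibleCone_eq (H : Elimination c S m g a) :
    feasibleCone c a = {d | c ⬝ᵥ d < 0 ∧ ∀ n ∈ S, 0 ≤ n ⬝ᵥ d} := by
  ext d
  exact and_congr_right fun hd => H.cone d hd.le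

end Elimination

end Casting

namespace Casting

/-! ## The polygon of a facet and the facets around it -/

theorem eq_smul_cross {c n u : Vec3} (h : c ⨯₃ n ≠ 0) (hc : c ⬝ᵥ u = 0) (hn : n ⬝ᵥ u = 0) :
    ∃ t : ℝ, u = t • (c ⨯₃ n) := by
  have hpos := dot_self_pos h
  refine ⟨(u ⬝ᵥ (c ⨯₃ n)) / ((c ⨯₃ n) ⬝ᵥ (c ⨯₃ n)), ?_⟩
  rw [← sub_eq_zero]
  refine eq_zero_of_dot_eq_zero (p := c) (q := n) (r := c ⨯₃ n) ?_ ?_ ?_ ?_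
  · rw [show c ⬝ᵥ (n ⨯₃ (c ⨯₃ n)) = (c ⨯₃ n) ⬝ᵥ (c ⨯₃ n) by
      simp only [dot3, cross_zero, cross_one, cross_two]; ring]
    exact hpos.ne'
  · rw [dotProduct_sub, dotProduct_smul, dot_self_cross, hc]; simp
  · rw [dotProduct_sub, dotProduct_smul, dot_cross_self, hn]; simp
  · rw [dotProduct_sub, dotProduct_smul, smul_eq_mul, div_mul_cancel₀ _ hpos.ne',
      dotProduct_comm, sub_self]

/-- The vertices `x i` of a facet with inner normal `c`, in counterclockwise order, and inner
normals `n i` of the facets at the other sides of its edges. -/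
structure FacetFan (P : Set Vec3) (c : Vec3) (m : ℕ) (x n : ℕ → Vec3) : Prop where
  pos : 0 < m
  x_periodic : ∀ i, x (i + m) = x i
  n_periodic : ∀ i, n (i + m) = n i
  x_extreme : ∀ i, x i ∈ Set.extremePoints ℝ P
  x_ne : ∀ i j, i < j → j < i + m → x i ≠ x j
  c_dot : ∀ i j, c ⬝ᵥ x i = c ⬝ᵥ x j
  c_le : ∀ i, ∀ y ∈ P, c ⬝ᵥ x i ≤ c ⬝ᵥ y
  n_dot : ∀ i, n i ⬝ᵥ x (i + 1) = n i ⬝ᵥ x i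
  n_le : ∀ i, ∀ y ∈ P, n i ⬝ᵥ x i ≤ n i ⬝ᵥ y
  cross_ne : ∀ i, c ⨯₃ n i ≠ 0
  ccw : ∀ i, c ⬝ᵥ ((x (i + 1) - x i) ⨯₃ (x (i + 2) - x (i + 1))) < 0

namespace FacetFan

variable {P : Set Vec3} {c : Vec3} {m : ℕ} {x n : ℕ → Vec3}

theorem x_mem (H : FacetFan P c m x n) (i : ℕ) : x i ∈ P := (H.x_extreme i).1

theorem c_edge (H : FacetFan P c m x n) (i j : ℕ) : c ⬝ᵥ (x i - x j) = 0 := by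
  rw [dotProduct_sub, H.c_dot i j, sub_self]

theorem n_edge (H : FacetFan P c m x n) (i : ℕ) : n i ⬝ᵥ (x (i + 1) - x i) = 0 := by
  rw [dotProduct_sub, H.n_dot, sub_self]

theorem n_sub_nonneg (H : FacetFan P c m x n) (i : ℕ) {y : Vec3} (hy : y ∈ P) :
    0 ≤ n i ⬝ᵥ (y - x i) := by
  rw [dotProduct_sub]; linarith [H.n_le i y hy]

theorem n_sub_nonneg' (H : FacetFan P c m x n) (i : ℕ) {y : Vec3} (hy : y ∈ P) :
    0 ≤ n i ⬝ᵥ (y - x (i + 1)) := by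
  rw [dotProduct_sub, H.n_dot]; linarith [H.n_le i y hy]

/-- The edge is orthogonal to `c` and `n i`, hence a multiple of `c ⨯₃ n i`. The sign comes from
orientation: the counterclockwise condition makes the product of the factor with `n i ⬝ᵥ (x (i + 2)
- x (i + 1))` positive, and the latter is nonnegative since `n i` points inwards. -/
theorem edge_eq (H : FacetFan P c m x n) (i : ℕ) :
    (∃ μ : ℝ, 0 < μ ∧ x (i + 1) - x i = μ • (c ⨯₃ n i)) ∧ 0 < n i ⬝ᵥ (x (i + 2) - x (i + 1)) := by
  obtain ⟨μ, hμ⟩ := eq_smul_cross (H.cross_ne i) (H.c_edge (i + 1) i) (H.n_edge i)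
  have h1 := H.ccw i
  have h2 := H.n_sub_nonneg' i (H.x_mem (i + 2))
  have h3 := H.c_edge (i + 2) (i + 1)
  rw [hμ] at h1
  generalize x (i + 2) - x (i + 1) = e at *
  have h4 : c ⬝ᵥ ((μ • (c ⨯₃ n i)) ⨯₃ e) = -(μ * (n i ⬝ᵥ e) * (c ⬝ᵥ c)) := by
    have : c ⬝ᵥ ((μ • (c ⨯₃ n i)) ⨯₃ e) =
        μ * ((c ⬝ᵥ n i) * (c ⬝ᵥ e)) - μ * (n i ⬝ᵥ e) * (c ⬝ᵥ c) := by
      simp only [dot3, cross_zero, cross_one, cross_two, Pi.smul_apply, smul_eq_mul]; ring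
    rw [this, h3]; ring
  rw [h4] at h1
  have hc : 0 < c ⬝ᵥ c := dot_self_pos fun h => H.cross_ne i (by rw [h]; simp)
  have h5 : 0 < μ * (n i ⬝ᵥ e) := pos_of_mul_pos_left (by linarith) hc.le
  have h6 : 0 < μ := pos_of_mul_pos_left h5 h2
  exact ⟨⟨μ, h6, hμ⟩, pos_of_mul_pos_right h5 h6.le⟩

theorem n_dot_edge (H : FacetFan P c m x n) (a : ℕ) :
    ∃ μ : ℝ, 0 < μ ∧ ∀ j, n j ⬝ᵥ (x (a + 1) - x a) = -(μ * (c ⬝ᵥ (n j ⨯₃ n a))) := by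
  obtain ⟨⟨μ, hμ, e⟩, -⟩ := H.edge_eq a
  refine ⟨μ, hμ, fun j => ?_⟩
  rw [e]
  simp only [dot3, cross_zero, cross_one, cross_two, Pi.smul_apply, smul_eq_mul]; ring

theorem turn (H : FacetFan P c m x n) (i : ℕ) : c ⬝ᵥ (n i ⨯₃ n (i + 1)) < 0 := by
  obtain ⟨μ, hμ, e⟩ := H.n_dot_edge (i + 1)
  have h := (H.edge_eq i).2
  rw [show i + 2 = i + 1 + 1 from rfl, e] at h
  by_contra hn
  nlinarith [mul_nonneg hμ.le (not_lt.1 hn)]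

theorem n_succ_edge (H : FacetFan P c m x n) (i : ℕ) : n (i + 1) ⬝ᵥ (x (i + 1) - x i) < 0 := by
  obtain ⟨μ, hμ, e⟩ := H.n_dot_edge i
  rw [e, ← cross_anticomm, dotProduct_neg]
  nlinarith [H.turn i]

/-- The angle at a vertex is spanned by the two edges. -/
theorem corner_cone (H : FacetFan P c m x n) (i : ℕ) {y : Vec3} (hc : c ⬝ᵥ y = 0)
    (h0 : 0 ≤ n i ⬝ᵥ y) (h1 : 0 ≤ n (i + 1) ⬝ᵥ y) :
    ∃ α β : ℝ, 0 ≤ α ∧ 0 ≤ β ∧ y = α • (x (i + 2) - x (i + 1)) - β • (x (i + 1) - x i) := by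
  have e1 := (H.edge_eq i).2
  have e2 := H.n_succ_edge i
  have e3 := H.n_edge (i + 1)
  have e4 := H.n_edge i
  have e5 := H.c_edge (i + 2) (i + 1)
  have e6 := H.c_edge (i + 1) i
  rw [show i + 1 + 1 = i + 2 from rfl] at e3
  generalize x (i + 2) - x (i + 1) = f at *
  generalize x (i + 1) - x i = e at *
  refine ⟨(n i ⬝ᵥ y) / (n i ⬝ᵥ f), (n (i + 1) ⬝ᵥ y) / -(n (i + 1) ⬝ᵥ e),
    div_nonneg h0 e1.le, div_nonneg h1 (by linarith), ?_⟩
  rw [← sub_eq_zero]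
  refine eq_zero_of_dot_eq_zero (H.turn i).ne ?_ ?_ ?_
  · simp only [dotProduct_sub, dotProduct_smul, hc, e5, e6]; simp
  · simp only [dotProduct_sub, dotProduct_smul, e4, smul_eq_mul]
    rw [div_mul_cancel₀ _ e1.ne']; simp
  · simp only [dotProduct_sub, dotProduct_smul, e3, smul_eq_mul]
    have := e2.ne
    field_simp; ring

/-- Only the ends of an edge lie on its line. -/
theorem n_sub_pos (H : FacetFan P c m x n) {j l : ℕ} (h1 : j + 1 < l) (h2 : l < j + m) :
    0 < n j ⬝ᵥ (x l - x j) := by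
  refine (H.n_sub_nonneg j (H.x_mem l)).lt_of_ne' fun h0 => ?_
  -- A vertex on the line of edge `j` is `x j + τ • (x (j + 1) - x j)`. The two adjacent edges force
  -- `0 ≤ τ ≤ 1`; the ends are excluded by distinctness, the interior by extremality.
  obtain ⟨⟨μ, hμ, hμe⟩, -⟩ := H.edge_eq j
  obtain ⟨t, ht⟩ := eq_smul_cross (H.cross_ne j) (H.c_edge l j) h0
  obtain ⟨τ, hτ⟩ : ∃ τ : ℝ, x l - x j = τ • (x (j + 1) - x j) :=
    ⟨t / μ, by rw [hμe, ht, smul_smul, div_mul_cancel₀ _ hμ.ne']⟩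
  have hle : τ ≤ 1 := by
    have a1 := H.n_sub_nonneg (j + 1) (H.x_mem l)
    have a2 := H.n_succ_edge j
    rw [show x l - x (j + 1) = (τ - 1) • (x (j + 1) - x j) by
      rw [sub_smul, ← hτ]; module, dotProduct_smul, smul_eq_mul] at a1
    nlinarith
  have hge : 0 ≤ τ := by
    have hm := H.pos
    have a1 := H.n_sub_nonneg' (j + m - 1) (H.x_mem l)
    have a2 := (H.edge_eq (j + m - 1)).2
    rw [show j + m - 1 + 2 = j + 1 + m by omega, H.x_periodic,
      show j + m - 1 + 1 = j + m by omega, H.x_periodic] at a2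
    rw [show j + m - 1 + 1 = j + m by omega, H.x_periodic, hτ, dotProduct_smul, smul_eq_mul] at a1
    exact nonneg_of_mul_nonneg_left a1 a2
  have hxl : x l = x j + τ • (x (j + 1) - x j) := by rw [← hτ]; module
  rcases hge.eq_or_lt with h | h
  · rw [← h, zero_smul, add_zero] at hxl
    exact H.x_ne j l (by omega) h2 hxl.symm
  · rcases hle.eq_or_lt with h' | h'
    · rw [h', one_smul, add_sub_cancel] at hxl
      exact H.x_ne (j + 1) l h1 (by omega) hxl.symm
    · have := (H.x_extreme l).2 (H.x_mem j) (H.x_mem (j + 1))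
        ⟨1 - τ, τ, by linarith, h, by ring, by rw [hxl]; module⟩
      exact H.x_ne j l (by omega) h2 this

theorem angularCycle (H : FacetFan P c m x n) : AngularCycle c m n where
  periodic := H.n_periodic
  turn := H.turn
  sorted i j k hij hjk hk h := by
    -- If edge `a` does not rise and edge `a + 1` does not fall with respect to `n i`, then `x (a +
    -- 1)` is a local minimum of `n i` on the polygon. By convexity it is a global one, yet `x i`
    -- has a smaller value by `n_sub_pos`.
    have key : ∀ a, i < a → 0 ≤ c ⬝ᵥ (n i ⨯₃ n a) → a + 1 < i + m →
        0 < c ⬝ᵥ (n i ⨯₃ n (a + 1)) := by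
      intro a hia ha ham
      obtain ⟨μ, hμ, e⟩ := H.n_dot_edge a
      obtain ⟨ν, hν, e'⟩ := H.n_dot_edge (a + 1)
      by_contra hneg
      have h1 := e i
      have h2 := e' i
      have h3 := H.n_sub_pos (j := i) (l := a + 1) (by omega) ham
      obtain ⟨α, β, hα, hβ, hy⟩ := H.corner_cone a (H.c_edge i (a + 1))
        (H.n_sub_nonneg' a (H.x_mem i)) (H.n_sub_nonneg (a + 1) (H.x_mem i))
      have h4 : n i ⬝ᵥ (x i - x (a + 1)) = - (n i ⬝ᵥ (x (a + 1) - x i)) := by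
        simp only [dotProduct_sub]; ring
      rw [hy, dotProduct_sub, dotProduct_smul, dotProduct_smul, h1,
        show a + 2 = a + 1 + 1 from rfl, h2, smul_eq_mul, smul_eq_mul] at h4
      have := mul_nonneg hβ (mul_nonneg hμ.le ha)
      have := mul_nonpos_of_nonneg_of_nonpos hα
        (mul_nonpos_of_nonneg_of_nonpos hν.le (not_lt.1 hneg))
      linarith
    have hjk' : j + 1 ≤ k := hjk
    clear hjk
    induction k, hjk' using Nat.le_induction with
    | base => exact key j hij h hk
    | succ k hjk ih => exact key k (by omega) (ih (by omega)).le hk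

theorem finite_range (H : FacetFan P c m x n) : (Set.range x).Finite := by
  refine ((Set.finite_lt_nat m).image x).subset ?_
  rintro _ ⟨i, rfl⟩
  refine ⟨i % m, Nat.mod_lt i H.pos, ?_⟩
  have : ∀ i t, x (i + t * m) = x i := fun i t => by
    induction t with
    | zero => simp
    | succ t ih => rw [add_mul, ← add_assoc, one_mul, H.x_periodic, ih]
  conv_rhs => rw [← Nat.mod_add_div' i m, this]

/-- A polygon is the intersection of the half-planes of its edges. -/
theorem mem_convexHull (H : FacetFan P c m x n) {y : Vec3} (hc : c ⬝ᵥ y = c ⬝ᵥ x 0)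
    (hy : ∀ i, 0 ≤ n i ⬝ᵥ (y - x i)) : y ∈ convexHull ℝ (Set.range x) := by
  by_contra hmem
  -- A separating functional attains its minimum over the polygon at a vertex. The point `y` lies in
  -- the angle at that vertex, along whose two edges the functional does not decrease.
  obtain ⟨f, u, hf1, hf2⟩ := geometric_hahn_banach_point_closed (convex_convexHull ℝ (Set.range x))
    (H.finite_range.isCompact_convexHull ℝ).isClosed hmem
  obtain ⟨_, ⟨k, rfl⟩, hk⟩ := Set.exists_min_image (Set.range x) f H.finite_range ⟨_, 0, rfl⟩
  have hm := H.pos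
  rw [← H.x_periodic k, show k + m = k + m - 1 + 1 by omega] at hk
  generalize k + m - 1 = i at hk
  have hyi : 0 ≤ n i ⬝ᵥ (y - x (i + 1)) := by
    have := hy i
    rw [dotProduct_sub] at this ⊢
    rwa [H.n_dot]
  obtain ⟨α, β, hα, hβ, e⟩ := H.corner_cone i (y := y - x (i + 1))
    (by rw [dotProduct_sub, hc, H.c_dot 0 (i + 1), sub_self]) hyi (hy (i + 1))
  have h1 := hk _ ⟨i + 2, rfl⟩
  have h2 := hk _ ⟨i, rfl⟩
  have h3 := congrArg f e
  simp only [map_sub, map_smul, smul_eq_mul] at h3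
  have h4 := hf2 _ (subset_convexHull ℝ _ ⟨i + 1, rfl⟩)
  have := mul_nonneg hα (sub_nonneg.2 h1)
  have := mul_nonneg hβ (sub_nonneg.2 h2)
  linarith

theorem mem_of_dot (H : FacetFan P c m x n) (hP : Convex ℝ P) {y : Vec3}
    (hc : c ⬝ᵥ y = c ⬝ᵥ x 0) (hy : ∀ i, 0 ≤ n i ⬝ᵥ (y - x i)) : y ∈ P :=
  convexHull_min (Set.range_subset_iff.2 H.x_mem) hP (H.mem_convexHull hc hy)

/-- A nonzero such `w` would be a direction of recession of the facet, contrary to compactness. -/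
theorem bounded (H : FacetFan P c m x n) (hP : Convex ℝ P) (hK : IsCompact P) {w : Vec3}
    (hc : c ⬝ᵥ w = 0) (hw : ∀ i, 0 ≤ n i ⬝ᵥ w) : w = 0 := by
  by_contra h0
  have hpos := dot_self_pos h0
  have hcont : Continuous fun y : Vec3 => w ⬝ᵥ y := by
    simp only [dot3]; fun_prop
  obtain ⟨M, hM⟩ := hK.bddAbove_image hcont.continuousOn
  have key : ∀ t : ℝ, 0 ≤ t → w ⬝ᵥ x 0 + t * (w ⬝ᵥ w) ≤ M := by
    intro t ht
    have : x 0 + t • w ∈ P := H.mem_of_dot hP (by rw [dotProduct_add, dotProduct_smul, hc]; simp)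
      fun i => by
        rw [show x 0 + t • w - x i = (x 0 - x i) + t • w by module, dotProduct_add,
          dotProduct_smul, smul_eq_mul]
        exact add_nonneg (H.n_sub_nonneg i (H.x_mem 0)) (mul_nonneg ht (hw i))
    have := hM ⟨_, this, rfl⟩
    simpa [dotProduct_add, dotProduct_smul] using this
  have h1 := key 0 le_rfl
  have h2 := key ((M - w ⬝ᵥ x 0 + 1) / (w ⬝ᵥ w)) (div_nonneg (by linarith) hpos.le)
  rw [div_mul_cancel₀ _ hpos.ne'] at h2
  linarith

/-- If the facets next to the top facet do not obstruct the direction `d`, then every point of the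
polyhedron leaves it through the top facet when moved in direction `d`. -/
theorem exists_exit (H : FacetFan P c m x n) (hP : Convex ℝ P) {d y : Vec3} (hd : c ⬝ᵥ d < 0)
    (hn : ∀ i, 0 ≤ n i ⬝ᵥ d) (hy : y ∈ P) :
    ∃ t : ℝ, 0 ≤ t ∧ y + t • d ∈ P ∧ c ⬝ᵥ (y + t • d) = c ⬝ᵥ x 0 := by
  have ht : 0 ≤ (c ⬝ᵥ y - c ⬝ᵥ x 0) / -(c ⬝ᵥ d) :=
    div_nonneg (by linarith [H.c_le 0 y hy]) (by linarith)
  have hc : c ⬝ᵥ (y + ((c ⬝ᵥ y - c ⬝ᵥ x 0) / -(c ⬝ᵥ d)) • d) = c ⬝ᵥ x 0 := by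
    rw [dotProduct_add, dotProduct_smul, smul_eq_mul]
    have := hd.ne
    field_simp; ring
  refine ⟨_, ht, H.mem_of_dot hP hc fun i => ?_, hc⟩
  rw [add_sub_right_comm, dotProduct_add, dotProduct_smul, smul_eq_mul]
  exact add_nonneg (H.n_sub_nonneg i hy) (mul_nonneg ht (hn i))

end FacetFan

end Casting

namespace Casting

/-! ## Normals of a convex polyhedron -/

namespace IsConvexPolyhedron

variable {P : Set Vec3}

theorem convex (hP : IsConvexPolyhedron P) : Convex ℝ P := by
  obtain ⟨s, _, rfl⟩ := hP.eq_convexHull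
  exact convex_convexHull ℝ s

theorem isCompact (hP : IsConvexPolyhedron P) : IsCompact P := by
  obtain ⟨s, hs, rfl⟩ := hP.eq_convexHull
  exact hs.isCompact_convexHull ℝ

theorem exists_add_smul_mem {z : Vec3} (hz : z ∈ interior P) (w : Vec3) :
    ∃ t : ℝ, 0 < t ∧ z + t • w ∈ P := by
  have hc : Filter.Tendsto (fun t : ℝ => z + t • w) (nhdsWithin 0 (Set.Ioi 0)) (nhds z) := by
    have : Continuous fun t : ℝ => z + t • w := by fun_prop
    have h := this.tendsto 0
    simp only [zero_smul, add_zero] at h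
    exact h.mono_left nhdsWithin_le_nhds
  have h1 := hc.eventually (mem_interior_iff_mem_nhds.1 hz)
  obtain ⟨t, ht1, ht2⟩ := (h1.and self_mem_nhdsWithin).exists
  exact ⟨t, ht2, ht1⟩

/-- A polyhedron with interior points does not lie in a plane. -/
theorem not_flat (hP : IsConvexPolyhedron P) {ν : Vec3} (hν : ν ≠ 0) {b : ℝ}
    (h : ∀ x ∈ P, ν ⬝ᵥ x = b) : False := by
  obtain ⟨z, hz⟩ := hP.interior_nonempty
  obtain ⟨t, ht, hm⟩ := exists_add_smul_mem hz ν
  have h1 := h _ hm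
  have h2 := h z (interior_subset hz)
  rw [dotProduct_add, h2, dotProduct_smul, smul_eq_mul] at h1
  have := mul_pos ht (dot_self_pos hν)
  linarith

/-- The definition of a facet admits `ν = 0`, whose minimal face is all of `P`; this is excluded
because a set of dimension two lies in a plane. -/
theorem exists_innerNormal (hP : IsConvexPolyhedron P) {F : Set Vec3} (hF : IsFacet P F) :
    ∃ ν, IsInnerNormal P F ν := by
  obtain ⟨⟨ν, hν⟩, hd⟩ := hF
  refine ⟨ν, ?_, hν⟩
  rintro rfl
  have hPF : F = P := by rw [hν]; ext x; simp [minFace]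
  have hlt : vectorSpan ℝ F < ⊤ := by
    refine lt_top_iff_ne_top.2 fun h => ?_
    rw [h, finrank_top] at hd
    simp at hd
  obtain ⟨f, hf0, hf⟩ := Submodule.exists_le_ker_of_lt_top _ hlt
  obtain ⟨w, rfl⟩ := (dotProductEquiv ℝ (Fin 3)).surjective f
  obtain ⟨z, hz⟩ := hP.interior_nonempty
  refine hP.not_flat (ν := w) (fun h => hf0 (by rw [h, map_zero])) (b := w ⬝ᵥ z) fun x hx => ?_
  have := hf (vsub_mem_vectorSpan ℝ (hPF ▸ hx) (hPF ▸ interior_subset hz))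
  simp only [LinearMap.mem_ker, dotProductEquiv_apply_apply, vsub_eq_sub, dotProduct_sub] at this
  linarith

end IsConvexPolyhedron

theorem minFace_smul (P : Set Vec3) {r : ℝ} (hr : 0 < r) (ν : Vec3) :
    minFace P (r • ν) = minFace P ν := by
  ext x
  simp only [minFace, Set.mem_ofPred_eq, smul_dotProduct, smul_eq_mul]
  exact and_congr_right fun _ => forall₂_congr fun y _ => mul_le_mul_iff_right₀ hr

theorem IsInnerNormal.smul {P F : Set Vec3} {ν : Vec3} (h : IsInnerNormal P F ν) {r : ℝ}
    (hr : 0 < r) : IsInnerNormal P F (r • ν) :=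
  ⟨smul_ne_zero hr.ne' h.1, by rw [minFace_smul P hr]; exact h.2⟩

theorem IsInnerNormal.le {P F : Set Vec3} {ν : Vec3} (h : IsInnerNormal P F ν) {x y : Vec3}
    (hx : x ∈ F) (hy : y ∈ P) : ν ⬝ᵥ x ≤ ν ⬝ᵥ y := by
  rw [h.2] at hx; exact hx.2 y hy

theorem IsInnerNormal.subset {P F : Set Vec3} {ν : Vec3} (h : IsInnerNormal P F ν) : F ⊆ P := by
  rw [h.2]; exact fun x hx => hx.1

theorem IsInnerNormal.eq {P F : Set Vec3} {ν : Vec3} (h : IsInnerNormal P F ν) {x y : Vec3}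
    (hx : x ∈ F) (hy : y ∈ F) : ν ⬝ᵥ x = ν ⬝ᵥ y :=
  le_antisymm (h.le hx (h.subset hy)) (h.le hy (h.subset hx))

/-! ## Walking around a facet -/

namespace DCEL

variable (D : DCEL)

/-- The vector along a half-edge. -/
def edge (h : Fin D.nH) : Vec3 := D.start (D.next h) - D.start h

/-- The inner normal of a facet computed at the corner after the half-edge `h`. -/
noncomputable def cornerNormal (h : Fin D.nH) : Vec3 := D.edge (D.next h) ⨯₃ D.edge h

noncomputable def faceNormal (f : Fin D.nF) : Vec3 := D.cornerNormal (D.faceEdge f)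

/-- The half-edge reached from the first one of the facet `f` in `i` steps. -/
def walk (f : Fin D.nF) (i : ℕ) : Fin D.nH := D.next^[i] (D.faceEdge f)

/-- The number of edges of the facet `f`. -/
noncomputable def deg (f : Fin D.nF) : ℕ := Function.minimalPeriod D.next (D.faceEdge f)

/-- The facet on the other side of the `i`-th edge of `f`. -/
def neighbour (f : Fin D.nF) (i : ℕ) : Fin D.nF := D.face (D.twin (D.walk f i))

namespace IsBoundaryOf

variable {D} {P : Set Vec3}

theorem start_mem (_ : D.IsBoundaryOf P) (h : Fin D.nH) : D.start h ∈ D.facet (D.face h) :=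
  subset_convexHull ℝ _ ⟨h, rfl, rfl⟩

theorem start_next_mem (hD : D.IsBoundaryOf P) (h : Fin D.nH) :
    D.start (D.next h) ∈ D.facet (D.face h) := by
  rw [← hD.face_next h]; exact hD.start_mem _

theorem start_extreme (hD : D.IsBoundaryOf P) (h : Fin D.nH) :
    D.start h ∈ Set.extremePoints ℝ P := by
  rw [← hD.range_pos]; exact ⟨_, rfl⟩

theorem isFacet (hD : D.IsBoundaryOf P) (f : Fin D.nF) : IsFacet P (D.facet f) := by
  have : D.facet f ∈ Set.range D.facet := ⟨f, rfl⟩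
  rw [hD.range_facet] at this
  exact this

theorem edge_dot (hD : D.IsBoundaryOf P) {h : Fin D.nH} {ν : Vec3}
    (hν : IsInnerNormal P (D.facet (D.face h)) ν) : ν ⬝ᵥ D.edge h = 0 := by
  rw [edge, dotProduct_sub, hν.eq (hD.start_next_mem h) (hD.start_mem h), sub_self]

theorem edge_next_dot (hD : D.IsBoundaryOf P) {h : Fin D.nH} {ν : Vec3}
    (hν : IsInnerNormal P (D.facet (D.face h)) ν) : ν ⬝ᵥ D.edge (D.next h) = 0 :=
  hD.edge_dot (by rwa [hD.face_next])

theorem dot_cornerNormal (hD : D.IsBoundaryOf P) {h : Fin D.nH} {ν : Vec3}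
    (hν : IsInnerNormal P (D.facet (D.face h)) ν) : 0 < ν ⬝ᵥ D.cornerNormal h := by
  have := hD.counterclockwise h ν hν
  rw [cornerNormal, ← cross_anticomm, dotProduct_neg]
  exact neg_pos.2 this

/-- Inner normals of a facet are positive multiples of the one computed at any of its corners. -/
theorem exists_smul_cornerNormal (hD : D.IsBoundaryOf P) {h : Fin D.nH} {ν : Vec3}
    (hν : IsInnerNormal P (D.facet (D.face h)) ν) :
    ∃ r : ℝ, 0 < r ∧ ν = r • D.cornerNormal h := by
  have hpos := hD.dot_cornerNormal hν
  have hne : D.edge (D.next h) ⨯₃ D.edge h ≠ 0 := fun h0 => by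
    rw [cornerNormal, h0] at hpos; simp at hpos
  obtain ⟨r, hr⟩ := eq_smul_cross (u := ν) hne (by rw [dotProduct_comm]; exact hD.edge_next_dot hν)
    (by rw [dotProduct_comm]; exact hD.edge_dot hν)
  refine ⟨r, ?_, hr⟩
  rw [hr, cornerNormal, smul_dotProduct, smul_eq_mul] at hpos
  exact pos_of_mul_pos_left hpos (dot_self_pos hne).le

theorem cornerNormal_inner (hP : IsConvexPolyhedron P) (hD : D.IsBoundaryOf P) (h : Fin D.nH) :
    IsInnerNormal P (D.facet (D.face h)) (D.cornerNormal h) := by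
  obtain ⟨ν, hν⟩ := hP.exists_innerNormal (hD.isFacet (D.face h))
  obtain ⟨r, hr, e⟩ := hD.exists_smul_cornerNormal hν
  have := hν.smul (inv_pos.2 hr)
  rwa [e, smul_smul, inv_mul_cancel₀ hr.ne', one_smul] at this

theorem faceNormal_inner (hP : IsConvexPolyhedron P) (hD : D.IsBoundaryOf P) (f : Fin D.nF) :
    IsInnerNormal P (D.facet f) (D.faceNormal f) := by
  have := hD.cornerNormal_inner hP (D.faceEdge f)
  rwa [hD.face_faceEdge] at this

theorem exists_smul_faceNormal (hD : D.IsBoundaryOf P) {f : Fin D.nF} {ν : Vec3}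
    (hν : IsInnerNormal P (D.facet f) ν) : ∃ r : ℝ, 0 < r ∧ ν = r • D.faceNormal f := by
  rw [← hD.face_faceEdge f] at hν
  exact hD.exists_smul_cornerNormal hν

/-- Normals of distinct facets with a common point are not parallel. -/
theorem cross_ne_zero (hP : IsConvexPolyhedron P) (hD : D.IsBoundaryOf P) {f g : Fin D.nF}
    (hfg : f ≠ g) {x : Vec3} (hxf : x ∈ D.facet f) (hxg : x ∈ D.facet g) :
    D.faceNormal f ⨯₃ D.faceNormal g ≠ 0 := by
  intro h0
  have hf := hD.faceNormal_inner hP f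
  have hg := hD.faceNormal_inner hP g
  have hpos := dot_self_pos hf.1
  have e : (D.faceNormal f ⬝ᵥ D.faceNormal f) • D.faceNormal g =
      (D.faceNormal f ⬝ᵥ D.faceNormal g) • D.faceNormal f := by
    have := cross_cross_eq_smul_sub_smul (D.faceNormal f) (D.faceNormal g) (D.faceNormal f)
    rw [h0] at this
    simp only [map_zero, LinearMap.zero_apply] at this
    rw [eq_comm, sub_eq_zero] at this
    rw [this, dotProduct_comm]
  obtain ⟨r, hr⟩ : ∃ r : ℝ, D.faceNormal g = r • D.faceNormal f := by
    refine ⟨(D.faceNormal f ⬝ᵥ D.faceNormal f)⁻¹ * (D.faceNormal f ⬝ᵥ D.faceNormal g), ?_⟩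
    rw [mul_smul, ← e, smul_smul, inv_mul_cancel₀ hpos.ne', one_smul]
  -- Opposite normals at a common point would squeeze `P` into a plane; equally directed ones have
  -- the same minimal face.
  rcases lt_trichotomy r 0 with h | h | h
  · refine hP.not_flat hf.1 (b := D.faceNormal f ⬝ᵥ x) fun y hy => le_antisymm ?_ (hf.le hxf hy)
    have := hg.le hxg hy
    rw [hr, smul_dotProduct, smul_dotProduct, smul_eq_mul, smul_eq_mul] at this
    exact (mul_le_mul_left_of_neg h).1 this
  · exact hg.1 (by rw [hr, h, zero_smul])
  · apply hfg
    apply hD.facet_injective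
    rw [hf.2, hg.2, hr, minFace_smul P h]

theorem isPeriodicPt (hD : D.IsBoundaryOf P) (h : Fin D.nH) :
    h ∈ Function.periodicPts D.next := by
  obtain ⟨k, hk⟩ := hD.next_cycle (D.next h) h (hD.face_next h)
  exact Function.mk_mem_periodicPts (n := k + 1) (by omega) hk

theorem deg_pos (hD : D.IsBoundaryOf P) (f : Fin D.nF) : 0 < D.deg f :=
  Function.minimalPeriod_pos_of_mem_periodicPts (hD.isPeriodicPt _)

theorem walk_succ (f : Fin D.nF) (i : ℕ) : D.walk f (i + 1) = D.next (D.walk f i) :=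
  Function.iterate_succ_apply' _ _ _

theorem walk_periodic (f : Fin D.nF) (i : ℕ) : D.walk f (i + D.deg f) = D.walk f i :=
  Function.iterate_add_minimalPeriod_eq

theorem face_walk (hD : D.IsBoundaryOf P) (f : Fin D.nF) (i : ℕ) : D.face (D.walk f i) = f := by
  induction i with
  | zero => exact hD.face_faceEdge f
  | succ i ih => rw [walk_succ, hD.face_next, ih]

theorem walk_ne (f : Fin D.nF) {i j : ℕ} (hij : i < j) (hj : j < i + D.deg f) :
    D.walk f i ≠ D.walk f j := by
  intro h
  have h1 : Function.minimalPeriod D.next (D.faceEdge f) = D.deg f := rfl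
  have hpos : 0 < D.deg f := by omega
  unfold walk at h
  rw [← Function.iterate_mod_minimalPeriod_eq (n := i),
    ← Function.iterate_mod_minimalPeriod_eq (n := j),
    Function.iterate_eq_iterate_iff_of_lt_minimalPeriod (Nat.mod_lt _ hpos)
      (Nat.mod_lt _ hpos), h1] at h
  have := Nat.sub_mod_eq_zero_of_mod_eq h.symm
  rw [Nat.mod_eq_of_lt (by omega)] at this
  omega

theorem start_twin (hD : D.IsBoundaryOf P) (h : Fin D.nH) :
    D.start (D.twin h) = D.start (D.next h) := by
  rw [start, hD.origin_twin]; rfl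

theorem start_next_twin (hD : D.IsBoundaryOf P) (h : Fin D.nH) :
    D.start (D.next (D.twin h)) = D.start h := by
  rw [start, hD.origin_next_twin]; rfl

theorem start_mem_twin (hD : D.IsBoundaryOf P) (h : Fin D.nH) :
    D.start h ∈ D.facet (D.face (D.twin h)) := by
  rw [← hD.start_next_twin]; exact hD.start_next_mem _

theorem start_next_mem_twin (hD : D.IsBoundaryOf P) (h : Fin D.nH) :
    D.start (D.next h) ∈ D.facet (D.face (D.twin h)) := by
  rw [← hD.start_twin]; exact hD.start_mem _

theorem facetFan (hP : IsConvexPolyhedron P) (hD : D.IsBoundaryOf P) (f : Fin D.nF) :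
    FacetFan P (D.faceNormal f) (D.deg f) (fun i => D.start (D.walk f i))
      (fun i => D.faceNormal (D.neighbour f i)) := by
  have hf := hD.faceNormal_inner hP f
  have hmem : ∀ i, D.start (D.walk f i) ∈ D.facet f := fun i => by
    have := hD.start_mem (D.walk f i)
    rwa [hD.face_walk] at this
  have hn : ∀ i, IsInnerNormal P (D.facet (D.neighbour f i)) (D.faceNormal (D.neighbour f i)) :=
    fun i => hD.faceNormal_inner hP _
  exact
  { pos := hD.deg_pos f
    x_periodic := fun i => by simp only [walk_periodic]
    n_periodic := fun i => by simp only [neighbour, walk_periodic]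
    x_extreme := fun i => hD.start_extreme _
    x_ne := fun i j hij hj h => walk_ne f hij hj (hD.origin_injOn _ _ (by simp only [hD.face_walk])
      (hD.pos_injective h))
    c_dot := fun i j => hf.eq (hmem i) (hmem j)
    c_le := fun i y hy => hf.le (hmem i) hy
    n_dot := fun i => by
      rw [walk_succ]
      exact (hn i).eq (hD.start_next_mem_twin _) (hD.start_mem_twin _)
    n_le := fun i y hy => (hn i).le (hD.start_mem_twin _) hy
    cross_ne := fun i => by
      refine hD.cross_ne_zero hP ?_ (hmem i) (hD.start_mem_twin _)
      have := hD.face_twin_ne (D.walk f i)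
      rw [hD.face_walk] at this
      exact this.symm
    ccw := fun i => by
      have := hD.counterclockwise (D.walk f i) (D.faceNormal f) (by rwa [hD.face_walk])
      simpa only [walk_succ] using this }

/-- The valid pull-out directions are determined by the facets next to the top facet. -/
theorem pullOutDirections_eq (hP : IsConvexPolyhedron P) (hD : D.IsBoundaryOf P)
    (f : Fin D.nF) : pullOutDirections P (D.facet f) =
      {d | D.faceNormal f ⬝ᵥ d < 0 ∧ ∀ i, 0 ≤ D.faceNormal (D.neighbour f i) ⬝ᵥ d} := by
  have H := hD.facetFan hP f
  have hf := hD.faceNormal_inner hP f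
  ext d
  constructor
  · rintro ⟨⟨ν, hν, hd⟩, hall⟩
    refine ⟨?_, fun i => ?_⟩
    · obtain ⟨r, hr, rfl⟩ := hD.exists_smul_faceNormal hν
      rw [dotProduct_smul, smul_eq_mul, dotProduct_comm] at hd
      by_contra hneg
      nlinarith [mul_nonneg hr.le (not_lt.1 hneg)]
    · rw [dotProduct_comm]
      refine hall _ (hD.isFacet _) (fun h => ?_) _ (hD.faceNormal_inner hP _)
      have := hD.face_twin_ne (D.walk f i)
      rw [hD.face_walk] at this
      exact this (hD.facet_injective h)
  · rintro ⟨hd, hn⟩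
    refine ⟨⟨_, hf, by rwa [dotProduct_comm]⟩, fun G hG hGF ν hν => ?_⟩
    obtain ⟨g, rfl⟩ : G ∈ Set.range D.facet := by rw [hD.range_facet]; exact hG
    have hx0 : D.start (D.walk f 0) ∈ D.facet f := by
      have := hD.start_mem (D.walk f 0)
      rwa [hD.face_walk] at this
    -- If all of `g` lay in the plane of `f`, the normals would be parallel at a common point of the
    -- two facets.
    obtain ⟨y, hy, hlt⟩ : ∃ y ∈ D.facet g,
        D.faceNormal f ⬝ᵥ D.start (D.walk f 0) < D.faceNormal f ⬝ᵥ y := by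
      by_contra hcon
      push Not at hcon
      have hgP := hν.subset
      have heq : ∀ y ∈ D.facet g, D.faceNormal f ⬝ᵥ y = D.faceNormal f ⬝ᵥ D.start (D.walk f 0) :=
        fun y hy => le_antisymm (hcon y hy) (hf.le hx0 (hgP hy))
      have hm0 := hD.start_mem (D.faceEdge g)
      have hm1 := hD.start_next_mem (D.faceEdge g)
      have hm2 := hD.start_next_mem (D.next (D.faceEdge g))
      rw [hD.face_next] at hm2
      rw [hD.face_faceEdge] at hm0 hm1 hm2
      have hgn := (hD.faceNormal_inner hP g).1
      obtain ⟨r, hr⟩ := eq_smul_cross (u := D.faceNormal f) hgn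
        (by rw [dotProduct_comm, edge, dotProduct_sub, heq _ hm2, heq _ hm1, sub_self])
        (by rw [dotProduct_comm, edge, dotProduct_sub, heq _ hm1, heq _ hm0, sub_self])
      refine hD.cross_ne_zero hP (f := f) (g := g) (fun h => hGF (by rw [h])) (x := D.start (D.faceEdge g))
        ?_ hm0 ?_
      · rw [hf.2]
        exact ⟨hgP hm0, fun z hz => by rw [heq _ hm0]; exact hf.le hx0 hz⟩
      · have : D.faceNormal f = r • D.faceNormal g := hr
        rw [this, map_smul, LinearMap.smul_apply, cross_self, smul_zero]
    -- The exit point is in `P`, and `ν` is minimal at `y`, so `ν` does not decrease along `t • d`;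
    -- moreover `t > 0` because `y` is off the plane of `f`.
    obtain ⟨t, ht, hmem, hc⟩ := H.exists_exit hP.convex hd hn (hν.subset hy)
    have hle := hν.le hy hmem
    rw [dotProduct_add, dotProduct_smul, smul_eq_mul] at hle
    have htpos : 0 < t := by
      refine ht.lt_of_ne fun h0 => ?_
      rw [← h0, zero_smul, add_zero] at hc
      linarith
    rw [dotProduct_comm]
    exact nonneg_of_mul_nonneg_right (by linarith) htpos

end IsBoundaryOf
end DCEL

/-! ## Existence of facets -/

/-- Needed for `n > 0`, so that additive constants fit into `C * n`. The normal is an extreme point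
of the polar body `K` about an interior point `z`: its active points must span the space, as
otherwise it could be moved both ways inside `K`. -/
theorem exists_isFacet {P : Set Vec3} (hP : IsConvexPolyhedron P) : ∃ F, IsFacet P F := by
  obtain ⟨s, hs, rfl⟩ := hP.eq_convexHull
  obtain ⟨z, hz⟩ := hP.interior_nonempty
  set K : Set Vec3 := {ν | ∀ x ∈ s, -1 ≤ ν ⬝ᵥ (x - z)} with hKdef
  have hKP : ∀ ν ∈ K, ∀ x ∈ convexHull ℝ s, -1 ≤ ν ⬝ᵥ (x - z) := by
    intro ν hν x hx
    have hconv : Convex ℝ {x : Vec3 | -1 ≤ ν ⬝ᵥ (x - z)} := by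
      have : {x : Vec3 | -1 ≤ ν ⬝ᵥ (x - z)} =
          {x : Vec3 | ν ⬝ᵥ z - 1 ≤ dotProductEquiv ℝ (Fin 3) ν x} := by
        ext x
        simp only [Set.mem_ofPred_eq, dotProduct_sub, dotProductEquiv_apply_apply]
        constructor <;> intro h <;> linarith
      rw [this]
      exact convex_halfSpace_ge (LinearMap.isLinear _) _
    exact convexHull_min (fun x hx => hν x hx) hconv hx
  have hclosed : IsClosed K := by
    rw [hKdef, Set.ofPred_forall]
    refine isClosed_iInter fun x => ?_
    rw [Set.ofPred_forall]
    refine isClosed_iInter fun _ => isClosed_le continuous_const ?_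
    simp only [dot3]; fun_prop
  -- Since `z` is interior, some `z + t • w` with `t > 0` lies in `P`, which bounds `ν ⬝ᵥ w` from
  -- below; the unit vectors and their negatives bound all coordinates.
  have hbdd : ∃ R, ∀ ν ∈ K, ‖ν‖ ≤ R := by
    have key : ∀ w : Vec3, ∃ R, ∀ ν ∈ K, -R ≤ ν ⬝ᵥ w := by
      intro w
      obtain ⟨t, ht, hm⟩ := IsConvexPolyhedron.exists_add_smul_mem hz w
      refine ⟨1 / t, fun ν hν => ?_⟩
      have := hKP ν hν _ hm
      rw [add_sub_cancel_left, dotProduct_smul, smul_eq_mul] at this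
      rw [neg_le, div_eq_mul_inv, one_mul, ← mul_one t⁻¹, ← div_eq_inv_mul, le_div_iff₀ ht]
      linarith
    have hR : ∀ i : Fin 3, ∃ R, ∀ ν ∈ K, |ν i| ≤ R := by
      intro i
      obtain ⟨R₁, h1⟩ := key (Pi.single i 1)
      obtain ⟨R₂, h2⟩ := key (-Pi.single i 1)
      refine ⟨max R₁ R₂, fun ν hν => abs_le.2 ⟨?_, ?_⟩⟩
      · have := h1 ν hν
        simp only [dotProduct_single, mul_one] at this
        linarith [le_max_left R₁ R₂]
      · have := h2 ν hν
        simp only [dotProduct_neg, dotProduct_single, mul_one] at this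
        linarith [le_max_right R₁ R₂]
    choose R hR using hR
    refine ⟨∑ i, |R i|, fun ν hν => (pi_norm_le_iff_of_nonneg (by positivity)).2 fun i => ?_⟩
    exact (hR i ν hν).trans ((le_abs_self _).trans
      (Finset.single_le_sum (f := fun i => |R i|) (fun i _ => abs_nonneg _) (Finset.mem_univ i)))
  obtain ⟨R, hR⟩ := hbdd
  have hcompact : IsCompact K := Metric.isCompact_of_isClosed_isBounded hclosed
    ((Metric.isBounded_iff_subset_closedBall 0).2 ⟨R, fun ν hν => by simpa using hR ν hν⟩)
  obtain ⟨ν, hνK, hext⟩ := hcompact.extremePoints_nonempty (E := Vec3) ⟨0, fun x _ => by simp⟩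
  set A : Set Vec3 := {x ∈ s | ν ⬝ᵥ (x - z) = -1} with hA
  have hspan : Submodule.span ℝ ((fun x => x - z) '' A) = ⊤ := by
    by_contra hne
    obtain ⟨g, hg0, hg⟩ := Submodule.exists_le_ker_of_lt_top _ (lt_top_iff_ne_top.2 hne)
    obtain ⟨w, rfl⟩ := (dotProductEquiv ℝ (Fin 3)).surjective g
    have hw0 : w ≠ 0 := fun h => hg0 (by rw [h, map_zero])
    have hact : ∀ x ∈ A, w ⬝ᵥ (x - z) = 0 := fun x hx => by
      have := hg (Submodule.subset_span ⟨x, hx, rfl⟩)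
      simpa using this
    have hev : ∀ᶠ t : ℝ in nhds 0, ∀ x ∈ s, -1 ≤ (ν + t • w) ⬝ᵥ (x - z) := by
      rw [Filter.eventually_all_finite hs]
      intro x hx
      by_cases hxA : ν ⬝ᵥ (x - z) = -1
      · refine Filter.Eventually.of_forall fun t => ?_
        rw [add_dotProduct, smul_dotProduct, hact x ⟨hx, hxA⟩, hxA]; simp
      · have hlt : -1 < (ν + (0 : ℝ) • w) ⬝ᵥ (x - z) := by
          rw [zero_smul, add_zero]; exact lt_of_le_of_ne (hνK x hx) (Ne.symm hxA)
        have hcont : Continuous fun t : ℝ => (ν + t • w) ⬝ᵥ (x - z) := by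
          simp only [dot3, Pi.add_apply, Pi.smul_apply, smul_eq_mul]; fun_prop
        exact (hcont.tendsto 0).eventually (lt_mem_nhds hlt) |>.mono fun t ht => ht.le
    obtain ⟨ε, hε, hball⟩ := Metric.eventually_nhds_iff.1 hev
    have h1 : ν + (ε / 2) • w ∈ K := hball (by simp [abs_of_pos hε]; linarith)
    have h2 : ν + (-(ε / 2)) • w ∈ K := hball (by simp [abs_of_pos hε]; linarith)
    have := hext h1 h2 ⟨1 / 2, 1 / 2, by norm_num, by norm_num, by norm_num, by module⟩
    rw [add_eq_left, smul_eq_zero] at this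
    rcases this with h | h
    · linarith
    · exact hw0 h
  have hAne : A.Nonempty := by
    by_contra h
    rw [Set.not_nonempty_iff_eq_empty] at h
    rw [h] at hspan
    simp at hspan
  obtain ⟨x₀, hx₀s, hx₀⟩ := hAne
  have hν0 : ν ≠ 0 := by rintro rfl; simp at hx₀
  have hAF : A ⊆ minFace (convexHull ℝ s) ν := fun x hx =>
    ⟨subset_convexHull ℝ s hx.1, fun y hy => by
      have h1 := hKP ν hνK y hy
      have h2 := hx.2
      rw [dotProduct_sub] at h1 h2
      linarith⟩
  refine ⟨minFace (convexHull ℝ s) ν, ⟨ν, rfl⟩, le_antisymm ?_ ?_⟩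
  · have hker : vectorSpan ℝ (minFace (convexHull ℝ s) ν) ≤
        LinearMap.ker (dotProductEquiv ℝ (Fin 3) ν) := by
      refine Submodule.span_le.2 ?_
      rintro _ ⟨x, hx, y, hy, rfl⟩
      simp only [SetLike.mem_coe, LinearMap.mem_ker, dotProductEquiv_apply_apply, vsub_eq_sub,
        dotProduct_sub]
      linarith [hx.2 y hy.1, hy.2 x hx.1]
    have hlt : vectorSpan ℝ (minFace (convexHull ℝ s) ν) < ⊤ := by
      refine lt_top_iff_ne_top.2 fun h => ?_
      have := hker (h ▸ Submodule.mem_top : ν ∈ _)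
      simp only [LinearMap.mem_ker, dotProductEquiv_apply_apply] at this
      exact (dot_self_pos hν0).ne' this
    have := Submodule.finrank_lt hlt.ne
    simp at this
    omega
  -- All active points lie in the face, so its direction space together with the single vector `x₀ -
  -- z` fills the space, and its dimension is at least two.
  · have hle : (⊤ : Submodule ℝ Vec3) ≤
        vectorSpan ℝ (minFace (convexHull ℝ s) ν) ⊔ Submodule.span ℝ {x₀ - z} := by
      rw [← hspan, Submodule.span_le]
      rintro _ ⟨x, hx, rfl⟩
      refine Submodule.mem_sup.2 ⟨x - x₀, vsub_mem_vectorSpan ℝ (hAF hx) (hAF ⟨hx₀s, hx₀⟩), x₀ - z,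
        Submodule.subset_span rfl, by simp⟩
    have h1 := Submodule.finrank_mono hle
    have h2 := Submodule.finrank_add_le_finrank_add_finrank
      (vectorSpan ℝ (minFace (convexHull ℝ s) ν)) (Submodule.span ℝ {x₀ - z})
    have h3 := finrank_span_le_card (R := ℝ) ({x₀ - z} : Set Vec3)
    have h4 := (h1.trans h2).trans (Nat.add_le_add_left h3 _)
    rw [finrank_top, Module.finrank_fin_fun, Set.toFinset_singleton, Finset.card_singleton] at h4
    exact Nat.le_of_succ_le_succ h4

end Casting

namespace Casting
namespace DCEL
namespace IsBoundaryOf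

variable {D : DCEL} {P : Set Vec3}

/-! ## The number of half-edges is linear in the number of facets -/

theorem next_injective (hD : D.IsBoundaryOf P) : Function.Injective D.next := by
  refine Finite.injective_iff_surjective.2 fun h => ?_
  obtain ⟨k, hk⟩ := hD.next_cycle (D.next h) h (hD.face_next h)
  exact ⟨D.next^[k] h, (Function.iterate_succ_apply' D.next k h).symm.trans
    ((Function.iterate_succ_apply D.next k h).trans hk)⟩

theorem exists_walk (hD : D.IsBoundaryOf P) (h : Fin D.nH) : ∃ i, D.walk (D.face h) i = h :=
  hD.next_cycle _ _ (hD.face_faceEdge _)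

theorem edge_twin (hD : D.IsBoundaryOf P) (h : Fin D.nH) : D.edge (D.twin h) = -D.edge h := by
  rw [edge, edge, hD.start_next_twin, hD.start_twin, neg_sub]

theorem cornerNormal_ne_zero (hP : IsConvexPolyhedron P) (hD : D.IsBoundaryOf P)
    (h : Fin D.nH) : D.cornerNormal h ≠ 0 := (hD.cornerNormal_inner hP h).1

theorem edge_ne_zero (hP : IsConvexPolyhedron P) (hD : D.IsBoundaryOf P) (h : Fin D.nH) :
    D.edge h ≠ 0 := fun h0 => hD.cornerNormal_ne_zero hP h (by rw [cornerNormal, h0, map_zero])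

theorem exists_corner_cone (hP : IsConvexPolyhedron P) (hD : D.IsBoundaryOf P)
    {h : Fin D.nH} {y : Vec3} (hy : y ∈ D.facet (D.face h)) :
    ∃ α β : ℝ, 0 ≤ α ∧ 0 ≤ β ∧
      y - D.start (D.next h) = α • D.edge (D.next h) - β • D.edge h := by
  obtain ⟨i, hi⟩ := hD.exists_walk h
  have H := hD.facetFan hP (D.face h)
  have hf := hD.faceNormal_inner hP (D.face h)
  have hyP := hf.subset hy
  have hi1 : D.walk (D.face h) (i + 1) = D.next h := by rw [walk_succ, hi]
  have hi2 : D.walk (D.face h) (i + 2) = D.next (D.next h) := by rw [walk_succ, hi1]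
  have e := H.corner_cone i (y := y - D.start (D.next h))
    (by rw [dotProduct_sub, hf.eq hy (hD.start_next_mem h), sub_self])
    (by have := H.n_sub_nonneg' i hyP; rwa [hi1] at this)
    (by have := H.n_sub_nonneg (i + 1) hyP; rwa [hi1] at this)
  rwa [hi, hi1, hi2] at e

/-- Orthogonality to both edges at the corner of `k` would make the two facet normals parallel. -/
theorem not_parallel (hP : IsConvexPolyhedron P) (hD : D.IsBoundaryOf P) {h k : Fin D.nH}
    (hne : D.face h ≠ D.face k) {x : Vec3} (hxh : x ∈ D.facet (D.face h))
    (hxk : x ∈ D.facet (D.face k)) (h1 : D.cornerNormal h ⬝ᵥ D.edge k = 0)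
    (h2 : D.cornerNormal h ⬝ᵥ D.edge (D.next k) = 0) : False := by
  obtain ⟨r, _, hr⟩ := hD.exists_smul_cornerNormal (hD.faceNormal_inner hP (D.face h))
  obtain ⟨s, _, hs⟩ := hD.exists_smul_cornerNormal (hD.faceNormal_inner hP (D.face k))
  obtain ⟨t, ht⟩ := eq_smul_cross (u := D.cornerNormal h) (hD.cornerNormal_ne_zero hP k)
    (by rw [dotProduct_comm, h2]) (by rw [dotProduct_comm, h1])
  have ht' : D.cornerNormal h = t • D.cornerNormal k := ht
  refine hD.cross_ne_zero hP hne hxh hxk ?_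
  rw [hr, hs, ht']
  simp [cross_self]

theorem exists_generic (hP : IsConvexPolyhedron P) (hD : D.IsBoundaryOf P) :
    ∃ g : Vec3, ∀ h, g ⬝ᵥ D.edge h ≠ 0 := by
  obtain ⟨f, hf⟩ := Module.exists_dual_forall_apply_ne_zero (K := ℝ)
    (fun h : Fin D.nH => D.edge h) (hD.edge_ne_zero hP)
  obtain ⟨g, rfl⟩ := (dotProductEquiv ℝ (Fin 3)).surjective f
  exact ⟨g, fun h => by simpa using hf h⟩

/-- A facet has only one highest corner. -/
theorem eq_of_highest (hP : IsConvexPolyhedron P) (hD : D.IsBoundaryOf P) {g : Vec3}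
    {h k : Fin D.nH} (hf : D.face h = D.face k) (h1 : 0 < g ⬝ᵥ D.edge h)
    (h2 : g ⬝ᵥ D.edge (D.next h) < 0) (k1 : 0 < g ⬝ᵥ D.edge k)
    (k2 : g ⬝ᵥ D.edge (D.next k) < 0) : h = k := by
  have key : ∀ h k : Fin D.nH, D.face h = D.face k → 0 < g ⬝ᵥ D.edge h →
      g ⬝ᵥ D.edge (D.next h) < 0 →
      g ⬝ᵥ D.start (D.next k) ≤ g ⬝ᵥ D.start (D.next h) ∧
        (g ⬝ᵥ D.start (D.next k) = g ⬝ᵥ D.start (D.next h) →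
          D.start (D.next k) = D.start (D.next h)) := by
    intro h k hf h1 h2
    obtain ⟨α, β, hα, hβ, e⟩ := hD.exists_corner_cone hP (h := h) (y := D.start (D.next k))
      (by rw [hf]; exact hD.start_next_mem k)
    have eg := congrArg (g ⬝ᵥ ·) e
    simp only [dotProduct_sub, dotProduct_smul, smul_eq_mul] at eg
    have m1 := mul_nonpos_of_nonneg_of_nonpos hα h2.le
    have m2 := mul_nonneg hβ h1.le
    refine ⟨by linarith, fun heq => ?_⟩
    have z1 : α * (g ⬝ᵥ D.edge (D.next h)) = 0 := by linarith
    have z2 : β * (g ⬝ᵥ D.edge h) = 0 := by linarith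
    rw [(mul_eq_zero.1 z1).resolve_right h2.ne, (mul_eq_zero.1 z2).resolve_right h1.ne'] at e
    simp only [zero_smul, sub_zero] at e
    exact sub_eq_zero.1 e
  have a := key h k hf h1 h2
  have b := key k h hf.symm k1 k2
  have e := a.2 (le_antisymm a.1 b.1)
  apply hD.next_injective
  exact (hD.origin_injOn _ _ (by rw [hD.face_next, hD.face_next, hf]) (hD.pos_injective e.symm))

/-- A vertex has only one ascending corner. -/
theorem eq_of_ascending (hP : IsConvexPolyhedron P) (hD : D.IsBoundaryOf P) {g : Vec3}
    {h k : Fin D.nH} (hv : D.origin (D.next h) = D.origin (D.next k)) (h1 : 0 < g ⬝ᵥ D.edge h)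
    (h2 : 0 < g ⬝ᵥ D.edge (D.next h)) (k1 : 0 < g ⬝ᵥ D.edge k)
    (k2 : 0 < g ⬝ᵥ D.edge (D.next k)) : h = k := by
  by_cases hf : D.face h = D.face k
  · apply hD.next_injective
    exact hD.origin_injOn _ _ (by rw [hD.face_next, hD.face_next, hf]) hv
  exfalso
  have hv' : D.start (D.next h) = D.start (D.next k) := congrArg D.pos hv
  -- The outer ends of the edges at corner `k` are points of `P`, hence on the inner side of the
  -- facet of `h`.
  have key : ∀ h k : Fin D.nH, D.start (D.next h) = D.start (D.next k) →
      D.cornerNormal h ⬝ᵥ D.edge k ≤ 0 ∧ 0 ≤ D.cornerNormal h ⬝ᵥ D.edge (D.next k) := by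
    intro h k hv
    have hn := hD.cornerNormal_inner hP h
    have a := hn.le (hD.start_next_mem h) (hD.start_extreme k).1
    have b := hn.le (hD.start_next_mem h) (hD.start_extreme (D.next (D.next k))).1
    simp only [edge, dotProduct_sub]
    rw [← hv]
    exact ⟨by linarith, by linarith⟩
  obtain ⟨a1, a2⟩ := key h k hv'
  obtain ⟨b1, b2⟩ := key k h hv'.symm
  -- The left side is the determinant of `g`, `D.cornerNormal h`, `D.cornerNormal k`, which changes
  -- sign when `h` and `k` are exchanged. The signs found above make it both nonpositive and
  -- nonnegative, so every term vanishes.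
  have ident : (g ⬝ᵥ D.edge (D.next k)) * (D.cornerNormal h ⬝ᵥ D.edge k)
        - (g ⬝ᵥ D.edge k) * (D.cornerNormal h ⬝ᵥ D.edge (D.next k))
      = - ((g ⬝ᵥ D.edge (D.next h)) * (D.cornerNormal k ⬝ᵥ D.edge h)
        - (g ⬝ᵥ D.edge h) * (D.cornerNormal k ⬝ᵥ D.edge (D.next h))) := by
    unfold cornerNormal
    simp only [dot3, cross_zero, cross_one, cross_two]; ring
  have p1 := mul_nonpos_of_nonneg_of_nonpos k2.le a1
  have p2 := mul_nonneg k1.le a2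
  have p3 := mul_nonpos_of_nonneg_of_nonpos h2.le b1
  have p4 := mul_nonneg h1.le b2
  have z1 : (g ⬝ᵥ D.edge (D.next k)) * (D.cornerNormal h ⬝ᵥ D.edge k) = 0 := by linarith
  have z2 : (g ⬝ᵥ D.edge k) * (D.cornerNormal h ⬝ᵥ D.edge (D.next k)) = 0 := by linarith
  exact hD.not_parallel hP hf (hD.start_next_mem h) (hv' ▸ hD.start_next_mem k)
    ((mul_eq_zero.1 z1).resolve_left k2.ne') ((mul_eq_zero.1 z2).resolve_left k1.ne')

/-- The map `ρ` rotates half-edges about their origin. A cycle of length two would give two facets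
with two common edges at a vertex, hence parallel normals. -/
theorem three_le_card_fiber (hP : IsConvexPolyhedron P) (hD : D.IsBoundaryOf P)
    (h : Fin D.nH) : 3 ≤ (Finset.univ.filter fun k => D.origin k = D.origin h).card := by
  set ρ : Fin D.nH → Fin D.nH := fun h => D.next (D.twin h) with hρ
  have hor : ∀ h, D.origin (ρ h) = D.origin h := fun h => hD.origin_next_twin h
  have hne : ∀ h, ρ h ≠ h := fun h e => hD.face_twin_ne h (by
    have := hD.face_next (D.twin h)
    rw [← this]; exact congrArg D.face e)
  have hne2 : ρ (ρ h) ≠ h := by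
    intro e
    have hface : D.face (D.twin (ρ h)) = D.face h := by
      rw [← hD.face_next (D.twin (ρ h))]; exact congrArg D.face e
    have hn := hD.cornerNormal_inner hP h
    refine hD.not_parallel hP (h := h) (k := D.twin h) (hD.face_twin_ne h).symm
      (hD.start_mem h) (hD.start_mem_twin h) ?_ ?_
    · rw [hD.edge_twin, dotProduct_neg, hD.edge_dot hn, neg_zero]
    · have := hD.edge_dot (h := D.twin (ρ h)) (by rwa [hface])
      rw [hD.edge_twin, dotProduct_neg, neg_eq_zero] at this
      exact this
  have hsub : ({h, ρ h, ρ (ρ h)} : Finset (Fin D.nH)) ⊆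
      Finset.univ.filter fun k => D.origin k = D.origin h := by
    intro k hk
    simp only [Finset.mem_insert, Finset.mem_singleton] at hk
    rcases hk with rfl | rfl | rfl <;> simp [hor]
  calc 3 = ({h, ρ h, ρ (ρ h)} : Finset (Fin D.nH)).card := by
        rw [Finset.card_insert_of_notMem, Finset.card_insert_of_notMem, Finset.card_singleton]
        · simpa using (hne (ρ h)).symm
        · simp only [Finset.mem_insert, Finset.mem_singleton, not_or]
          exact ⟨(hne h).symm, hne2.symm⟩
    _ ≤ _ := Finset.card_le_card hsub

/-- Twins pair ascending with descending half-edges, so half of them ascend. An ascending half-edge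
whose successor descends determines the unique highest corner of its facet; one whose successor
ascends determines the unique ascending corner of a vertex. With `V` vertices of degree at least
three, `nH / 2 ≤ nF + V` and `3 V ≤ nH`, whence `nH ≤ 6 nF`. -/
theorem card_halfEdges_le (hP : IsConvexPolyhedron P) (hD : D.IsBoundaryOf P) :
    D.nH ≤ 6 * D.nF := by
  classical
  obtain ⟨g, hg⟩ := hD.exists_generic hP
  set U : Finset (Fin D.nH) := Finset.univ.filter fun h => 0 < g ⬝ᵥ D.edge h with hU
  have hpos : ∀ {h}, h ∈ U → 0 < g ⬝ᵥ D.edge h := fun hh => (Finset.mem_filter.1 hh).2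
  have hcompl : Uᶜ.card = U.card := by
    refine Finset.card_bij' (fun h _ => D.twin h) (fun h _ => D.twin h) ?_ ?_
      (fun h _ => hD.twin_twin h) (fun h _ => hD.twin_twin h)
    · intro h hh
      have : ¬ 0 < g ⬝ᵥ D.edge h := by simpa [hU] using hh
      simp only [hU, Finset.mem_filter, Finset.mem_univ, true_and, hD.edge_twin, dotProduct_neg]
      exact neg_pos.2 (lt_of_le_of_ne (not_lt.1 this) (hg h))
    · intro h hh
      have := hpos hh
      simp only [hU, Finset.mem_compl, Finset.mem_filter, Finset.mem_univ, true_and,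
        hD.edge_twin, dotProduct_neg]
      linarith
  have htotal : D.nH = 2 * U.card := by
    have := Finset.card_add_card_compl U
    rw [hcompl, Fintype.card_fin] at this
    omega
  have hsplit := Finset.card_filter_add_card_filter_not (s := U) (fun h => D.next h ∈ U)
  have hUD : (U.filter fun h => D.next h ∉ U).card ≤ D.nF := by
    rw [← Fintype.card_fin D.nF, ← Finset.card_univ]
    refine Finset.card_le_card_of_injOn D.face (fun _ _ => Finset.mem_univ _) ?_
    intro h hh k hk hf
    rw [Finset.mem_coe, Finset.mem_filter] at hh hk
    have hneg : ∀ {h}, D.next h ∉ U → g ⬝ᵥ D.edge (D.next h) < 0 := fun {h} hh => by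
      have : ¬ 0 < g ⬝ᵥ D.edge (D.next h) := by simpa [hU] using hh
      exact lt_of_le_of_ne (not_lt.1 this) (hg _)
    exact hD.eq_of_highest hP hf (hpos hh.1) (hneg hh.2) (hpos hk.1) (hneg hk.2)
  have hUU : (U.filter fun h => D.next h ∈ U).card ≤ (Finset.univ.image D.origin).card := by
    refine Finset.card_le_card_of_injOn (fun h => D.origin (D.next h))
      (fun h _ => Finset.mem_coe.2 (Finset.mem_image_of_mem _ (Finset.mem_univ _))) ?_
    intro h hh k hk hv
    rw [Finset.mem_coe, Finset.mem_filter] at hh hk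
    exact hD.eq_of_ascending hP hv (hpos hh.1) (hpos hh.2) (hpos hk.1) (hpos hk.2)
  have hV : 3 * (Finset.univ.image D.origin).card ≤ D.nH := by
    have h1 := Finset.card_eq_sum_card_image D.origin Finset.univ
    rw [Finset.card_univ, Fintype.card_fin] at h1
    refine le_trans ?_ h1.ge
    rw [mul_comm, ← smul_eq_mul]
    refine Finset.card_nsmul_le_sum _ _ _ fun v hv => ?_
    obtain ⟨h, _, rfl⟩ := Finset.mem_image.1 hv
    exact hD.three_le_card_fiber hP h
  omega

theorem ncard_facets (hD : D.IsBoundaryOf P) : {F | IsFacet P F}.ncard = D.nF := by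
  rw [← hD.range_facet, Set.ncard_range_of_injective hD.facet_injective, Nat.card_eq_fintype_card,
    Fintype.card_fin]

theorem nF_pos (hP : IsConvexPolyhedron P) (hD : D.IsBoundaryOf P) : 0 < D.nF := by
  obtain ⟨F, hF⟩ := exists_isFacet hP
  obtain ⟨f, _⟩ : F ∈ Set.range D.facet := by rw [hD.range_facet]; exact hF
  exact f.pos

theorem sum_deg_le (hD : D.IsBoundaryOf P) : ∑ f, D.deg f ≤ D.nH := by
  have : ∀ f, D.deg f = (Finset.univ : Finset (Fin (D.deg f))).card := fun f => by simp
  calc ∑ f, D.deg f = Fintype.card (Σ f : Fin D.nF, Fin (D.deg f)) := by simp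
    _ ≤ Fintype.card (Fin D.nH) := by
        refine Fintype.card_le_of_injective (fun p => D.walk p.1 p.2) ?_
        rintro ⟨f, i⟩ ⟨g, j⟩ h
        simp only at h
        obtain rfl : f = g := by rw [← hD.face_walk f i, h, hD.face_walk]
        rcases lt_trichotomy i.1 j.1 with hij | hij | hij
        · exact absurd h (walk_ne f hij (by omega))
        · rw [Fin.ext hij]
        · exact absurd h.symm (walk_ne f hij (by omega))
    _ = D.nH := Fintype.card_fin _

end IsBoundaryOf
end DCEL
end Casting

namespace RealRAM

/-! ## Total correctness with time bounds -/

/-- Started in `s`, the program `c` halts within `T` time units in a state satisfying `Q`. -/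
def Runs (c : Cmd) (s : State) (T : ℕ) (Q : State → Prop) : Prop :=
  ∃ (t : ℕ) (s' : State), Exec c s t s' ∧ t ≤ T ∧ Q s'

theorem Runs.mono {c : Cmd} {s : State} {T T' : ℕ} {Q Q' : State → Prop} (h : Runs c s T Q)
    (hT : T ≤ T') (hQ : ∀ s', Q s' → Q' s') : Runs c s T' Q' := by
  obtain ⟨t, s', he, ht, hq⟩ := h
  exact ⟨t, s', he, ht.trans hT, hQ s' hq⟩

theorem Runs.seq {c₁ c₂ : Cmd} {s : State} {T₁ T₂ : ℕ} {Q₁ Q : State → Prop}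
    (h₁ : Runs c₁ s T₁ Q₁) (h₂ : ∀ s', Q₁ s' → Runs c₂ s' T₂ Q) :
    Runs (.seq c₁ c₂) s (T₁ + T₂) Q := by
  obtain ⟨t₁, s₁, e₁, ht₁, q₁⟩ := h₁
  obtain ⟨t₂, s₂, e₂, ht₂, q₂⟩ := h₂ s₁ q₁
  exact ⟨_, s₂, .seq e₁ e₂, Nat.add_le_add ht₁ ht₂, q₂⟩

theorem Cond.cost_pos : ∀ b : Cond, 0 < b.cost
  | .ile _ _ => Nat.succ_pos _
  | .rle _ _ => Nat.succ_pos _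
  | .neg _ => Nat.succ_pos _
  | .conj _ _ => Nat.succ_pos _

/-- Registers and arrays that a program may change. -/
def Cmd.wI : Cmd → List ℕ
  | .iset x _ => [x]
  | .seq c₁ c₂ => c₁.wI ++ c₂.wI
  | .ite _ c₁ c₂ => c₁.wI ++ c₂.wI
  | .loop _ c => c.wI
  | _ => []

def Cmd.wIA : Cmd → List ℕ
  | .iput a _ _ => [a]
  | .seq c₁ c₂ => c₁.wIA ++ c₂.wIA
  | .ite _ c₁ c₂ => c₁.wIA ++ c₂.wIA
  | .loop _ c => c.wIA
  | _ => []

def Cmd.wRA : Cmd → List ℕ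
  | .rput a _ _ => [a]
  | .seq c₁ c₂ => c₁.wRA ++ c₂.wRA
  | .ite _ c₁ c₂ => c₁.wRA ++ c₂.wRA
  | .loop _ c => c.wRA
  | _ => []

/-- `s'` differs from `s` only in what the program `c` may change. -/
structure Frame (c : Cmd) (s s' : State) : Prop where
  ireg : ∀ x, x ∉ c.wI → s'.ireg x = s.ireg x
  iarr : ∀ a, a ∉ c.wIA → s'.iarr a = s.iarr a
  rarr : ∀ a, a ∉ c.wRA → s'.rarr a = s.rarr a

theorem Frame.refl (c : Cmd) (s : State) : Frame c s s :=
  ⟨fun _ _ => rfl, fun _ _ => rfl, fun _ _ => rfl⟩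

theorem Frame.trans {c : Cmd} {s s' s'' : State} (h : Frame c s s') (h' : Frame c s' s'') :
    Frame c s s'' :=
  ⟨fun x hx => (h'.ireg x hx).trans (h.ireg x hx), fun x hx => (h'.iarr x hx).trans (h.iarr x hx),
    fun x hx => (h'.rarr x hx).trans (h.rarr x hx)⟩

theorem Exec.frame {c : Cmd} {s s' : State} {t : ℕ} (h : Exec c s t s') : Frame c s s' := by
  induction h with
  | skip s => exact Frame.refl _ _
  | iset s x e =>
    refine ⟨fun y hy => ?_, fun _ _ => rfl, fun _ _ => rfl⟩
    have : y ≠ x := by simpa [Cmd.wI] using hy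
    simp [Function.update_of_ne this]
  -- `Frame` does not track real registers, so there is nothing to verify.
  | rset s x e => exact ⟨fun _ _ => rfl, fun _ _ => rfl, fun _ _ => rfl⟩
  | rdiv s x e₁ e₂ h => exact ⟨fun _ _ => rfl, fun _ _ => rfl, fun _ _ => rfl⟩
  | iput s a i e =>
    refine ⟨fun _ _ => rfl, fun y hy => ?_, fun _ _ => rfl⟩
    have : y ≠ a := by simpa [Cmd.wIA] using hy
    simp [Function.update_of_ne this]
  | rput s a i e =>
    refine ⟨fun _ _ => rfl, fun _ _ => rfl, fun y hy => ?_⟩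
    have : y ≠ a := by simpa [Cmd.wRA] using hy
    simp [Function.update_of_ne this]
  | seq _ _ ih₁ ih₂ =>
    exact ⟨fun x hx => by
        simp only [Cmd.wI, List.mem_append, not_or] at hx
        rw [ih₂.ireg x hx.2, ih₁.ireg x hx.1],
      fun x hx => by
        simp only [Cmd.wIA, List.mem_append, not_or] at hx
        rw [ih₂.iarr x hx.2, ih₁.iarr x hx.1],
      fun x hx => by
        simp only [Cmd.wRA, List.mem_append, not_or] at hx
        rw [ih₂.rarr x hx.2, ih₁.rarr x hx.1]⟩
  | ite_pos _ _ ih =>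
    exact ⟨fun x hx => ih.ireg x fun h => hx (List.mem_append_left _ h),
      fun x hx => ih.iarr x fun h => hx (List.mem_append_left _ h),
      fun x hx => ih.rarr x fun h => hx (List.mem_append_left _ h)⟩
  | ite_neg _ _ ih =>
    exact ⟨fun x hx => ih.ireg x fun h => hx (List.mem_append_right _ h),
      fun x hx => ih.iarr x fun h => hx (List.mem_append_right _ h),
      fun x hx => ih.rarr x fun h => hx (List.mem_append_right _ h)⟩
  | loop_done _ => exact Frame.refl _ _
  | loop_step _ _ _ ih₁ ih₂ =>
    exact ⟨fun x hx => by rw [ih₂.ireg x hx, ih₁.ireg x hx],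
      fun x hx => by rw [ih₂.iarr x hx, ih₁.iarr x hx],
      fun x hx => by rw [ih₂.rarr x hx, ih₁.rarr x hx]⟩

theorem Runs.frame {c : Cmd} {s : State} {T : ℕ} {Q : State → Prop} (h : Runs c s T Q) :
    Runs c s T (fun s' => Q s' ∧ Frame c s s') := by
  obtain ⟨t, s', he, ht, hq⟩ := h
  exact ⟨t, s', he, ht, hq, he.frame⟩

/-- A loop runs within its potential if each iteration pays for itself out of the potential. -/
theorem Runs.loop {b : Cond} {c : Cmd} (I : State → Prop) (Φ : State → ℕ) {s₀ : State}
    (hbody : ∀ s, Frame c s₀ s → I s → b.Holds s →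
      ∃ T, Runs c s T (fun s' => I s' ∧ b.cost + T + Φ s' ≤ Φ s)) (h₀ : I s₀) :
    Runs (.loop b c) s₀ (Φ s₀ + b.cost) (fun s' => I s' ∧ ¬ b.Holds s' ∧ Frame c s₀ s') := by
  have key : ∀ n s, Φ s = n → Frame c s₀ s → I s →
      Runs (.loop b c) s (n + b.cost) (fun s' => I s' ∧ ¬ b.Holds s' ∧ Frame c s₀ s') := by
    intro n
    induction n using Nat.strong_induction_on with
    | _ n ih =>
      intro s hn hf hI
      by_cases hb : b.Holds s
      · obtain ⟨T, t, s₁, he, ht, hI₁, hΦ⟩ := hbody s hf hI hb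
        -- A positive test cost makes the potential drop strictly, which drives the induction.
        have := b.cost_pos
        obtain ⟨t₂, s₂, he₂, ht₂, hq⟩ :=
          ih (Φ s₁) (by omega) s₁ rfl (hf.trans he.frame) hI₁
        exact ⟨_, s₂, .loop_step hb he he₂, by omega, hq⟩
      · exact ⟨_, s, .loop_done hb, Nat.le_add_left _ _, hI, hb, hf⟩
  exact key _ s₀ rfl (Frame.refl _ _) h₀

/-- Programs without loops and divisions. -/
def Cmd.Straight : Cmd → Prop
  | .rdiv _ _ _ => False
  | .loop _ _ => False
  | .seq c₁ c₂ => c₁.Straight ∧ c₂.Straight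
  | .ite _ c₁ c₂ => c₁.Straight ∧ c₂.Straight
  | _ => True

open Classical in
/-- The effect of a straight-line program. -/
noncomputable def Cmd.run : Cmd → State → State
  | .iset x e, s => { s with ireg := Function.update s.ireg x (e.eval s) }
  | .rset x e, s => { s with rreg := Function.update s.rreg x (e.eval s) }
  | .iput a i e, s =>
    { s with iarr := Function.update s.iarr a (Function.update (s.iarr a) (i.eval s) (e.eval s)) }
  | .rput a i e, s =>
    { s with rarr := Function.update s.rarr a (Function.update (s.rarr a) (i.eval s) (e.eval s)) }
  | .seq c₁ c₂, s => c₂.run (c₁.run s)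
  | .ite b c₁ c₂, s => if b.Holds s then c₁.run s else c₂.run s
  | _, s => s

/-- Adding both branches of a conditional avoids a maximum. The value at `loop` is not a time bound;
`Straight` excludes it. -/
def Cmd.bound : Cmd → ℕ
  | .skip => 1
  | .iset _ e => e.cost + 1
  | .rset _ e => e.cost + 1
  | .rdiv _ e₁ e₂ => e₁.cost + e₂.cost + 1
  | .iput _ i e => i.cost + e.cost + 1
  | .rput _ i e => i.cost + e.cost + 1
  | .seq c₁ c₂ => c₁.bound + c₂.bound
  | .ite b c₁ c₂ => b.cost + (c₁.bound + c₂.bound)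
  | .loop b _ => b.cost

theorem Cmd.Straight.exec {c : Cmd} (hc : c.Straight) (s : State) :
    ∃ t, Exec c s t (c.run s) ∧ t ≤ c.bound := by
  induction c generalizing s with
  | skip => exact ⟨_, .skip s, le_rfl⟩
  | iset x e => exact ⟨_, .iset s x e, le_rfl⟩
  | rset x e => exact ⟨_, .rset s x e, le_rfl⟩
  | rdiv x e₁ e₂ => exact hc.elim
  | iput a i e => exact ⟨_, .iput s a i e, le_rfl⟩
  | rput a i e => exact ⟨_, .rput s a i e, le_rfl⟩
  | seq c₁ c₂ ih₁ ih₂ =>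
    obtain ⟨t₁, e₁, h₁⟩ := ih₁ hc.1 s
    obtain ⟨t₂, e₂, h₂⟩ := ih₂ hc.2 (c₁.run s)
    exact ⟨_, .seq e₁ e₂, Nat.add_le_add h₁ h₂⟩
  | ite b c₁ c₂ ih₁ ih₂ =>
    by_cases hb : b.Holds s
    · obtain ⟨t, e, h⟩ := ih₁ hc.1 s
      refine ⟨_, ?_, Nat.add_le_add_left (h.trans (Nat.le_add_right _ _)) _⟩
      rw [Cmd.run, if_pos hb]
      exact .ite_pos hb e
    · obtain ⟨t, e, h⟩ := ih₂ hc.2 s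
      refine ⟨_, ?_, Nat.add_le_add_left (h.trans (Nat.le_add_left _ _)) _⟩
      rw [Cmd.run, if_neg hb]
      exact .ite_neg hb e
  | loop b c => exact hc.elim

theorem Cmd.Straight.runs {c : Cmd} (hc : c.Straight) {s : State} {Q : State → Prop}
    (hQ : Q (c.run s)) : Runs c s c.bound Q := by
  obtain ⟨t, e, h⟩ := hc.exec s
  exact ⟨t, _, e, h, hQ⟩

theorem Runs.ite {b : Cond} {c₁ c₂ : Cmd} {s : State} {T : ℕ} {Q : State → Prop}
    (h₁ : b.Holds s → Runs c₁ s T Q) (h₂ : ¬ b.Holds s → Runs c₂ s T Q) :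
    Runs (.ite b c₁ c₂) s (b.cost + T) Q := by
  by_cases hb : b.Holds s
  · obtain ⟨t, s', e, h, q⟩ := h₁ hb
    exact ⟨_, s', .ite_pos hb e, Nat.add_le_add_left h _, q⟩
  · obtain ⟨t, s', e, h, q⟩ := h₂ hb
    exact ⟨_, s', .ite_neg hb e, Nat.add_le_add_left h _, q⟩

/-! ## Vectors of expressions -/

/-- Triples of real expressions. -/
abbrev VExpr : Type := Fin 3 → RExpr

namespace VExpr

noncomputable def eval (s : State) (u : VExpr) : Casting.Vec3 := fun i => (u i).eval s

def sub (u v : VExpr) : VExpr := fun i => .sub (u i) (v i)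

def cross (u v : VExpr) : VExpr :=
  ![.sub (.mul (u 1) (v 2)) (.mul (u 2) (v 1)), .sub (.mul (u 2) (v 0)) (.mul (u 0) (v 2)),
    .sub (.mul (u 0) (v 1)) (.mul (u 1) (v 0))]

def dot (u v : VExpr) : RExpr :=
  .add (.add (.mul (u 0) (v 0)) (.mul (u 1) (v 1))) (.mul (u 2) (v 2))

/-- Position `i` of three arrays. -/
def arr (a b c : ℕ) (i : IExpr) : VExpr := ![.arr a i, .arr b i, .arr c i]

theorem eval_sub (s : State) (u v : VExpr) : (u.sub v).eval s = u.eval s - v.eval s := rfl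

theorem eval_cross (s : State) (u v : VExpr) : (u.cross v).eval s = u.eval s ⨯₃ v.eval s := by
  ext i
  fin_cases i <;> simp [eval, cross, cross_apply, RExpr.eval]

theorem eval_dot (s : State) (u v : VExpr) : (u.dot v).eval s = u.eval s ⬝ᵥ v.eval s := by
  rw [Casting.dot3]; rfl

theorem eval_arr (s : State) (a b c : ℕ) (i : IExpr) :
    (arr a b c i).eval s = ![s.rarr a (i.eval s), s.rarr b (i.eval s), s.rarr c (i.eval s)] := by
  ext j
  fin_cases j <;> rfl

end VExpr

/-- Store a vector at position `i` of three arrays. -/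
def Cmd.vput (a b c : ℕ) (i : IExpr) (u : VExpr) : Cmd :=
  .seq (.rput a i (u 0)) (.seq (.rput b i (u 1)) (.rput c i (u 2)))

end RealRAM

namespace Casting
namespace AllFAD

open RealRAM

/-! ## The program

Index registers: 3 number of valid top facets, 4 current facet, 5 current half-edge, 7 and 8 ends of
the window of array 7 that lists the facets around the current one, 9 number of good corners, 10 flag
that the cone may be nonempty, 11 number of output vectors, 12 output position. Real arrays 6, 7, 8
hold inner normals of the facets. -/

def vertexE (h : IExpr) : VExpr := .arr 0 1 2 (.arr 0 h)

def normalE (f : IExpr) : VExpr := .arr 6 7 8 f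

/-- The normal of the facet at position `i` of the window array. -/
def windowE (i : IExpr) : VExpr := normalE (.arr 7 i)

def firstE : IExpr := .arr 4 (.reg 4)

def succE (i : IExpr) : IExpr := .add i (.const 1)

def facetCond : Cond := .ile (succE (.reg 4)) (.reg 0)

def nextFacet : Cmd := .iset 4 (succE (.reg 4))

def cornerNormalE (h : IExpr) : VExpr :=
  .cross (.sub (vertexE (.arr 2 (.arr 2 h))) (vertexE (.arr 2 h)))
    (.sub (vertexE (.arr 2 h)) (vertexE h))

def normalBody : Cmd := .seq (.vput 6 7 8 (.reg 4) (cornerNormalE firstE)) nextFacet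

def normals : Cmd := .seq (.loop facetCond normalBody) (.iset 4 (.const 0))

/-- The first neighbour is listed before the loop, because the loop test recognizes the end by the
return to the first half-edge. -/
def listInit : Cmd :=
  .seq (.iput 7 (.const 0) (.arr 3 (.arr 1 firstE)))
    (.seq (.iset 5 (.arr 2 firstE)) (.iset 8 (.const 1)))

def listCond : Cond := .neg (.conj (.ile (.reg 5) firstE) (.ile firstE (.reg 5)))

def listBody : Cmd :=
  .seq (.iput 7 (.reg 8) (.arr 3 (.arr 1 (.reg 5))))
    (.seq (.iset 5 (.arr 2 (.reg 5))) (.iset 8 (succE (.reg 8))))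

/-- List the facets around the current one. -/
def listNeighbours : Cmd := .seq listInit (.loop listCond listBody)

def elimInit : Cmd :=
  .seq (.iset 7 (.const 0)) (.seq (.iset 9 (.const 0)) (.iset 10 (.const 1)))

def elimCond : Cond :=
  .conj (.ile (.const 1) (.reg 10)) (.ile (succE (.reg 9)) (.sub (.reg 8) (.reg 7)))

/-- The corner tested is formed by the last two constraints of the window and the first one. -/
def goodCond : Cond :=
  .rle (.const 0) ((windowE (.sub (.reg 8) (.const 2))).dot
    ((windowE (.sub (.reg 8) (.const 1))).cross (windowE (.reg 7))))

def turnCond : Cond :=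
  .neg (.rle (.const 0) ((normalE (.reg 4)).dot
    ((windowE (.sub (.reg 8) (.const 2))).cross (windowE (.reg 7)))))

/-- The window is a queue in array 7: its first entry is copied behind its last one and both ends
advance. -/
def rotateCmd : Cmd :=
  .seq (.iput 7 (.reg 8) (.arr 7 (.reg 7))) (.seq (.iset 7 (succE (.reg 7)))
    (.seq (.iset 8 (succE (.reg 8))) (.iset 9 (succE (.reg 9)))))

/-- The middle constraint of the tested corner is the last entry of the window. Truncated
subtraction stops the count of good corners at zero. -/
def deleteCmd : Cmd :=
  .seq (.iset 8 (.sub (.reg 8) (.const 1))) (.iset 9 (.sub (.reg 9) (.const 2)))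

def elimBody : Cmd := .ite goodCond rotateCmd (.ite turnCond deleteCmd (.iset 10 (.const 0)))

/-- Eliminate redundant facets from the window. -/
def eliminate : Cmd := .seq elimInit (.loop elimCond elimBody)

/-- Output the intersection of the planes at positions `i` and `i + 1` of the window array. -/
def outPut (i : IExpr) : Cmd :=
  .seq (.vput 3 4 5 (.reg 11) ((windowE i).cross (windowE (succE i))))
    (.iset 11 (succE (.reg 11)))

/-- Copies of the first two entries behind the window let the corners wrap around without modular
arithmetic. -/
def outInit : Cmd :=
  .seq (.iput 7 (.reg 8) (.arr 7 (.reg 7)))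
    (.seq (.iput 7 (succE (.reg 8)) (.arr 7 (succE (.reg 7))))
      (.seq (.iset 12 (.reg 7)) (.iput 5 (.reg 3) (.reg 4))))

def outCond : Cond := .ile (succE (.reg 12)) (.reg 8)

def edgeCond : Cond :=
  .neg (.rle ((windowE (.reg 12)).dot
    ((windowE (succE (.reg 12))).cross (windowE (succE (succE (.reg 12)))))) (.const 0))

def outBody : Cmd :=
  .seq (.ite edgeCond (outPut (succE (.reg 12))) .skip) (.iset 12 (succE (.reg 12)))

/-- The test detects that nothing was written since the start of the current block: all edges have
length zero and the cone is one ray. -/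
def outSingle : Cmd := .ite (.ile (.reg 11) (.arr 6 (.reg 3))) (outPut (.reg 7)) .skip

def outEnd : Cmd := .seq (.iset 3 (succE (.reg 3))) (.iput 6 (.reg 3) (.reg 11))

/-- Output the extreme rays of the cone of the current facet. -/
def output : Cmd := .seq outInit (.seq (.loop outCond outBody) (.seq outSingle outEnd))

def facetBody : Cmd :=
  .seq listNeighbours (.seq eliminate
    (.seq (.ite (.ile (.const 1) (.reg 10)) output .skip) nextFacet))

def program : Cmd := .seq normals (.loop facetCond facetBody)

/-! ## Reading the memory -/

def normalAt (s : State) (f : ℕ) : Vec3 := ![s.rarr 6 f, s.rarr 7 f, s.rarr 8 f]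

def windowAt (s : State) (i : ℕ) : Vec3 := normalAt s (s.iarr 7 i)

def outAt (s : State) (i : ℕ) : Vec3 := ![s.rarr 3 i, s.rarr 4 i, s.rarr 5 i]

theorem eval_normalE (s : State) (i : IExpr) : (normalE i).eval s = normalAt s (i.eval s) :=
  VExpr.eval_arr _ _ _ _ _

theorem eval_windowE (s : State) (i : IExpr) : (windowE i).eval s = windowAt s (i.eval s) :=
  VExpr.eval_arr _ _ _ _ _

theorem eval_succE (s : State) (i : IExpr) : (succE i).eval s = i.eval s + 1 := rfl

variable {D : DCEL}

theorem load_origin (h : Fin D.nH) : D.load.iarr 0 h = D.origin h := by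
  simp [DCEL.load, DCEL.toArray]

theorem load_twin (h : Fin D.nH) : D.load.iarr 1 h = D.twin h := by
  simp [DCEL.load, DCEL.toArray]

theorem load_next (h : Fin D.nH) : D.load.iarr 2 h = D.next h := by
  simp [DCEL.load, DCEL.toArray]

theorem load_face (h : Fin D.nH) : D.load.iarr 3 h = D.face h := by
  simp [DCEL.load, DCEL.toArray]

theorem load_faceEdge (f : Fin D.nF) : D.load.iarr 4 f = D.faceEdge f := by
  simp [DCEL.load, DCEL.toArray]

theorem load_pos (v : Fin D.nV) :
    ![D.load.rarr 0 v, D.load.rarr 1 v, D.load.rarr 2 v] = D.pos v := by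
  ext i
  fin_cases i <;> simp [DCEL.load, DCEL.toArray]

/-- The memory holds the input and the normals of all facets. -/
structure Ready (D : DCEL) (s : State) : Prop where
  nF : s.ireg 0 = D.nF
  iarr : ∀ a < 5, s.iarr a = D.load.iarr a
  normal : ∀ f : Fin D.nF, normalAt s f = D.faceNormal f

theorem Ready.twin {s : State} (h : Ready D s) (e : Fin D.nH) : s.iarr 1 e = D.twin e := by
  rw [h.iarr 1 (by norm_num), load_twin]

theorem Ready.next {s : State} (h : Ready D s) (e : Fin D.nH) : s.iarr 2 e = D.next e := by
  rw [h.iarr 2 (by norm_num), load_next]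

theorem Ready.face {s : State} (h : Ready D s) (e : Fin D.nH) : s.iarr 3 e = D.face e := by
  rw [h.iarr 3 (by norm_num), load_face]

theorem Ready.faceEdge {s : State} (h : Ready D s) (f : Fin D.nF) : s.iarr 4 f = D.faceEdge f := by
  rw [h.iarr 4 (by norm_num), load_faceEdge]

theorem normalAt_congr {s s' : State} (h6 : s'.rarr 6 = s.rarr 6) (h7 : s'.rarr 7 = s.rarr 7)
    (h8 : s'.rarr 8 = s.rarr 8) (f : ℕ) : normalAt s' f = normalAt s f := by
  simp only [normalAt, h6, h7, h8]

/-- A program that writes neither the input nor the normals keeps them. -/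
theorem Ready.frame {s s' : State} {c : Cmd} (h : Ready D s) (hf : Frame c s s') (h0 : 0 ∉ c.wI)
    (ha : ∀ a < 5, a ∉ c.wIA) (hr : ∀ a, 6 ≤ a → a < 9 → a ∉ c.wRA) : Ready D s' where
  nF := by rw [hf.ireg 0 h0, h.nF]
  iarr a h5 := by rw [hf.iarr a (ha a h5), h.iarr a h5]
  normal f := by
    rw [normalAt_congr (hf.rarr 6 (hr 6 (by norm_num) (by norm_num)))
      (hf.rarr 7 (hr 7 (by norm_num) (by norm_num)))
      (hf.rarr 8 (hr 8 (by norm_num) (by norm_num))), h.normal]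

/-! ## The normals -/

theorem eval_vertexE (s : State) (e : IExpr) (h : Fin D.nH) (he : e.eval s = h)
    (ho : s.iarr 0 = D.load.iarr 0) (hr : ∀ a < 3, s.rarr a = D.load.rarr a) :
    (vertexE e).eval s = D.start h := by
  have : (IExpr.arr 0 e).eval s = D.origin h := by
    show s.iarr 0 (e.eval s) = _
    rw [he, ho, load_origin]
  rw [vertexE, VExpr.eval_arr, this, hr 0 (by norm_num), hr 1 (by norm_num), hr 2 (by norm_num),
    load_pos]
  rfl

theorem eval_rarr (s : State) (i : IExpr) (r : ℕ → ℕ → ℝ) :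
    i.eval { s with rarr := r } = i.eval s := by
  induction i with
  | const k => rfl
  | reg x => rfl
  | arr a i ih => simp only [IExpr.eval, ih]
  | add e₁ e₂ h₁ h₂ => simp only [IExpr.eval, h₁, h₂]
  | sub e₁ e₂ h₁ h₂ => simp only [IExpr.eval, h₁, h₂]

/-- By `hu` the components do not depend on the arrays being written, so the three successive writes
act as a simultaneous one. -/
theorem run_vput (s : State) (i : IExpr) (u : VExpr) {a b c : ℕ} (hab : a ≠ b) (hac : a ≠ c)
    (hbc : b ≠ c)
    (hu : ∀ (r : ℕ → ℕ → ℝ) j, (∀ d, d ≠ a → d ≠ b → d ≠ c → r d = s.rarr d) →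
      (u j).eval { s with rarr := r } = u.eval s j) :
    (Cmd.vput a b c i u).run s =
      { s with rarr := fun d => if d = a then Function.update (s.rarr a) (i.eval s) (u.eval s 0)
          else if d = b then Function.update (s.rarr b) (i.eval s) (u.eval s 1)
          else if d = c then Function.update (s.rarr c) (i.eval s) (u.eval s 2) else s.rarr d } := by
  simp only [Cmd.vput, Cmd.run, eval_rarr]
  rw [hu _ 1, hu _ 2]
  · congr 1
    funext d
    by_cases h1 : d = a
    · subst h1; simp [hab, hac, VExpr.eval]
    · by_cases h2 : d = b
      · subst h2; simp [hab.symm, hbc]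
      · by_cases h3 : d = c
        · subst h3; simp [hac.symm, hbc.symm]
        · simp [h1, h2, h3]
  · intro d h1 h2 h3; simp [Function.update_of_ne h1, Function.update_of_ne h2]
  · intro d h1 h2 h3; simp [Function.update_of_ne h1]

theorem normals_spec :
    Runs normals D.load ((facetCond.cost + normalBody.bound) * D.nF + facetCond.cost + 2)
      fun s => Ready D s ∧ s.ireg 4 = 0 ∧ Frame normals D.load s := by
  have hstr : normalBody.Straight := by simp [normalBody, Cmd.vput, Cmd.Straight, nextFacet]
  have hloop := Runs.loop (b := facetCond) (c := normalBody) (s₀ := D.load)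
    (fun s => s.ireg 4 ≤ D.nF ∧ ∀ f : Fin D.nF, f.1 < s.ireg 4 → normalAt s f = D.faceNormal f)
    (fun s => (facetCond.cost + normalBody.bound) * (D.nF - s.ireg 4)) ?_ ?_
  · refine (Runs.seq hloop (T₂ := 2) (Q := fun s => Ready D s ∧ s.ireg 4 = 0)
      fun s hs => ?_).frame.mono (by simp [DCEL.load]) ?_
    · obtain ⟨⟨hle, hn⟩, hb, hf⟩ := hs
      refine Cmd.Straight.runs (c := .iset 4 (.const 0)) trivial ?_
      have h0 : s.ireg 0 = D.nF := hf.ireg 0 (by decide)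
      have h4 : s.ireg 4 = D.nF := by
        simp only [facetCond, Cond.Holds, succE, IExpr.eval, h0] at hb
        omega
      refine ⟨⟨?_, fun a ha => ?_, fun f => ?_⟩, ?_⟩
      · simpa [Cmd.run, Function.update] using h0
      · exact hf.iarr a (by simp [normalBody, Cmd.vput, nextFacet, Cmd.wIA])
      · exact hn f (by rw [h4]; exact f.2)
      · simp [Cmd.run, IExpr.eval]
    · rintro s ⟨⟨h1, h2⟩, h3⟩
      exact ⟨h1, h2, h3⟩
  · rintro s hf ⟨hle, hn⟩ hb
    have h0 : s.ireg 0 = D.nF := hf.ireg 0 (by decide)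
    have hia : ∀ a, s.iarr a = D.load.iarr a := fun a =>
      hf.iarr a (by simp [normalBody, Cmd.vput, nextFacet, Cmd.wIA])
    have hra : ∀ a < 3, s.rarr a = D.load.rarr a := fun a ha =>
      hf.rarr a (by simp [normalBody, Cmd.vput, nextFacet, Cmd.wRA]; omega)
    have hlt : s.ireg 4 < D.nF := by
      simpa [facetCond, Cond.Holds, succE, IExpr.eval, h0, Nat.succ_le_iff] using hb
    refine ⟨normalBody.bound, hstr.runs ?_⟩
    have e0 : firstE.eval s = D.faceEdge ⟨s.ireg 4, hlt⟩ := by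
      rw [← load_faceEdge, ← hia]; rfl
    have e1 : (IExpr.arr 2 firstE).eval s = D.next (D.faceEdge ⟨s.ireg 4, hlt⟩) := by
      rw [← load_next, ← hia, ← e0]; rfl
    have e2 : (IExpr.arr 2 (.arr 2 firstE)).eval s =
        D.next (D.next (D.faceEdge ⟨s.ireg 4, hlt⟩)) := by
      rw [← load_next, ← hia, ← e1]; rfl
    have hev : (cornerNormalE firstE).eval s = D.faceNormal ⟨s.ireg 4, hlt⟩ := by
      rw [cornerNormalE, VExpr.eval_cross, VExpr.eval_sub, VExpr.eval_sub,
        eval_vertexE s _ _ e0 (hia 0) hra, eval_vertexE s _ _ e1 (hia 0) hra,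
        eval_vertexE s _ _ e2 (hia 0) hra]
      rfl
    rw [normalBody, Cmd.run, run_vput s (.reg 4) (cornerNormalE firstE) (by norm_num) (by norm_num)
      (by norm_num), hev]
    · refine ⟨⟨?_, fun f hf4 => ?_⟩, ?_⟩
      · simpa [nextFacet, Cmd.run, succE, IExpr.eval] using hlt
      · simp only [nextFacet, Cmd.run, succE, IExpr.eval, Function.update_self] at hf4
        rcases Nat.lt_succ_iff_lt_or_eq.1 hf4 with h | h
        · have := hn f h
          simp only [normalAt, nextFacet, Cmd.run, IExpr.eval] at this ⊢
          simp [Function.update_of_ne h.ne, this]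
        · obtain rfl : f = ⟨s.ireg 4, hlt⟩ := Fin.ext h
          ext i
          fin_cases i <;> simp [normalAt, nextFacet, Cmd.run, IExpr.eval]
      · simp only [nextFacet, Cmd.run, succE, IExpr.eval, Function.update_self]
        rw [show D.nF - s.ireg 4 = D.nF - (s.ireg 4 + 1) + 1 by omega, Nat.mul_succ]
        exact (Nat.add_comm _ _).le
    · intro r j hr
      have hj : ∀ (a : ℕ) (x : ℕ), a < 3 → r a x = s.rarr a x := fun a x ha => by
        rw [hr a (by omega) (by omega) (by omega)]
      fin_cases j <;>
      simp [VExpr.eval, cornerNormalE, VExpr.cross, VExpr.sub, vertexE, VExpr.arr, RExpr.eval,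
        IExpr.eval, firstE, hj]
  · exact ⟨Nat.zero_le _, fun f hf => absurd hf (Nat.not_lt_zero _)⟩

end AllFAD
end Casting

namespace Casting
namespace AllFAD

open RealRAM DCEL.IsBoundaryOf

variable {D : DCEL} {P : Set Vec3}

/-! ## Listing the neighbours of a facet -/

/-- The loop test compares with the first half-edge; the walk returns to it for the first time after
a full period. -/
theorem walk_eq_zero_iff (f : Fin D.nF) {k : ℕ} (h1 : 0 < k) (h2 : k ≤ D.deg f) :
    D.walk f k = D.walk f 0 ↔ k = D.deg f := by
  refine ⟨fun h => ?_, fun h => ?_⟩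
  · by_contra hne
    exact walk_ne f h1 (by omega) h.symm
  · have := walk_periodic f 0
    rwa [zero_add, ← h] at this

theorem listNeighbours_spec (hD : D.IsBoundaryOf P) {s : State} (hs : Ready D s) (f : Fin D.nF)
    (hf : s.ireg 4 = f) :
    Runs listNeighbours s
      (listInit.bound + ((listCond.cost + listBody.bound) * D.deg f + listCond.cost))
      fun s' => s'.ireg 8 = D.deg f ∧ ∀ i < D.deg f, s'.iarr 7 i = D.neighbour f i := by
  have hdeg := hD.deg_pos f
  have e0 : s.iarr 4 (s.ireg 4) = D.walk f 0 := by rw [hf, hs.faceEdge]; rfl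
  have hinit : listInit.Straight := ⟨trivial, trivial, trivial⟩
  refine Runs.seq (hinit.runs (Q := fun s' => Ready D s' ∧ s'.ireg 4 = f ∧ s'.ireg 8 = 1 ∧
    s'.ireg 5 = D.walk f 1 ∧ s'.iarr 7 0 = D.neighbour f 0) ?_) fun s₀ hs₀ => ?_
  · refine ⟨⟨?_, fun a ha => ?_, fun g => ?_⟩, ?_, ?_, ?_, ?_⟩
    · simpa [listInit, Cmd.run] using hs.nF
    · simpa [listInit, Cmd.run, Function.update, show a ≠ 7 by omega] using hs.iarr a ha
    · simpa [listInit, Cmd.run, normalAt] using hs.normal g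
    · simpa [listInit, Cmd.run] using hf
    · simp [listInit, Cmd.run, IExpr.eval]
    · simp [listInit, Cmd.run, IExpr.eval, firstE, Function.update, e0, hs.next, walk_succ]
    · simp [listInit, Cmd.run, IExpr.eval, firstE, e0, hs.twin, hs.face, DCEL.neighbour]
  · obtain ⟨hr₀, hf₀, h8, h5, h7⟩ := hs₀
    refine (Runs.loop (b := listCond) (c := listBody) (s₀ := s₀)
      (fun s => 1 ≤ s.ireg 8 ∧ s.ireg 8 ≤ D.deg f ∧ s.ireg 5 = D.walk f (s.ireg 8) ∧
        ∀ i < s.ireg 8, s.iarr 7 i = D.neighbour f i)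
      (fun s => (listCond.cost + listBody.bound) * (D.deg f - s.ireg 8)) ?_ ?_).mono ?_ ?_
    · rintro s hfr ⟨h1, h2, h5, hl⟩ hb
      have hr : Ready D s := hr₀.frame hfr (by decide) (by decide) (by decide)
      have hf4 : s.ireg 4 = f := (hfr.ireg 4 (by decide)).trans hf₀
      have hlt : s.ireg 8 < D.deg f := by
        refine lt_of_le_of_ne h2 fun h => ?_
        have := (walk_eq_zero_iff f h1 h2).2 h
        rw [this] at h5
        have e0 : s.iarr 4 (s.ireg 4) = D.walk f 0 := by rw [hf4, hr.faceEdge]; rfl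
        simp [listCond, Cond.Holds, IExpr.eval, firstE, e0, h5] at hb
      have hstr : listBody.Straight := ⟨trivial, trivial, trivial⟩
      refine ⟨_, hstr.runs ⟨⟨?_, ?_, ?_, ?_⟩, ?_⟩⟩
      · simp [listBody, Cmd.run, IExpr.eval, succE]
      · simpa [listBody, Cmd.run, IExpr.eval, succE] using hlt
      · simp [listBody, Cmd.run, IExpr.eval, succE, h5, hr.next, walk_succ]
      · intro i hi
        simp only [listBody, Cmd.run, IExpr.eval, succE, Function.update_self] at hi
        rcases Nat.lt_succ_iff_lt_or_eq.1 hi with h | h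
        · have hne : i ≠ s.ireg 8 := Nat.ne_of_lt h
          have := hl i h
          simpa [listBody, Cmd.run, IExpr.eval, Function.update_of_ne hne] using this
        · subst h
          simp [listBody, Cmd.run, IExpr.eval, h5, hr.twin, hr.face, DCEL.neighbour]
      · have e8 : (listBody.run s).ireg 8 = s.ireg 8 + 1 := by
          simp [listBody, Cmd.run, IExpr.eval, succE]
        rw [e8, show D.deg f - s.ireg 8 = D.deg f - (s.ireg 8 + 1) + 1 by omega, Nat.mul_succ]
        exact (Nat.add_comm _ _).le
    · refine ⟨h8.ge, by omega, by rw [h8]; exact h5, fun i hi => ?_⟩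
      obtain rfl : i = 0 := by omega
      exact h7
    · gcongr
      omega
    · rintro s ⟨⟨h1, h2, h5, hl⟩, hb, hfr⟩
      have hr : Ready D s := hr₀.frame hfr (by decide) (by decide) (by decide)
      have hf4 : s.ireg 4 = f := (hfr.ireg 4 (by decide)).trans hf₀
      have e0 : s.iarr 4 (s.ireg 4) = D.walk f 0 := by rw [hf4, hr.faceEdge]; rfl
      have h8 : s.ireg 8 = D.deg f := by
        refine (walk_eq_zero_iff f h1 h2).1 (Fin.ext ?_)
        simp only [listCond, Cond.Holds, not_not, IExpr.eval, firstE, e0, h5] at hb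
        omega
      exact ⟨h8, by rwa [h8] at hl⟩

/-! ## Elimination -/

/-- The normals in the window, repeated periodically. -/
def windowCycle (s : State) (i : ℕ) : Vec3 :=
  windowAt s (s.ireg 7 + i % (s.ireg 8 - s.ireg 7))

def neighbourNormals (D : DCEL) (f : Fin D.nF) : Set Vec3 :=
  Set.range fun i => D.faceNormal (D.neighbour f i)

theorem pullOutDirections_eq' (hP : IsConvexPolyhedron P) (hD : D.IsBoundaryOf P)
    (f : Fin D.nF) : pullOutDirections P (D.facet f) =
      {d | D.faceNormal f ⬝ᵥ d < 0 ∧ ∀ n ∈ neighbourNormals D f, 0 ≤ n ⬝ᵥ d} := by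
  rw [hD.pullOutDirections_eq hP]
  simp [neighbourNormals]

theorem elimination_init (hP : IsConvexPolyhedron P) (hD : D.IsBoundaryOf P) (f : Fin D.nF) :
    Elimination (D.faceNormal f) (neighbourNormals D f) (D.deg f) 0
      (fun i => D.faceNormal (D.neighbour f i)) where
  toAngularCycle := (hD.facetFan hP f).angularCycle
  two_le := by
    have H := (hD.facetFan hP f).angularCycle
    have h0 := hD.deg_pos f
    by_contra h
    have h1 : D.deg f = 1 := by omega
    have := H.turn 0
    have hp := H.periodic 0
    rw [h1] at hp
    rw [hp] at this
    simp [cross_self] at this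
  le := Nat.zero_le _
  cone d _ := by simp [neighbourNormals]
  good t h1 h2 := by omega

/-- What the elimination loop knows about the window. -/
structure ElimInv (P : Set Vec3) (D : DCEL) (f : Fin D.nF) (s : State) : Prop where
  lo_le : s.ireg 7 ≤ s.ireg 8
  size_le : s.ireg 8 - s.ireg 7 ≤ D.deg f
  window : 1 ≤ s.ireg 10 → Elimination (D.faceNormal f) (neighbourNormals D f)
    (s.ireg 8 - s.ireg 7) (s.ireg 9) (windowCycle s)
  infeasible : ¬ 1 ≤ s.ireg 10 → pullOutDirections P (D.facet f) = ∅

theorem goodCond_iff (s : State) :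
    goodCond.Holds s ↔ 0 ≤ windowAt s (s.ireg 8 - 2) ⬝ᵥ
      (windowAt s (s.ireg 8 - 1) ⨯₃ windowAt s (s.ireg 7)) := by
  simp only [goodCond, Cond.Holds, VExpr.eval_dot, VExpr.eval_cross, eval_windowE, RExpr.eval,
    IExpr.eval, Int.cast_zero]

theorem turnCond_iff (s : State) :
    turnCond.Holds s ↔ normalAt s (s.ireg 4) ⬝ᵥ
      (windowAt s (s.ireg 8 - 2) ⨯₃ windowAt s (s.ireg 7)) < 0 := by
  simp only [turnCond, Cond.Holds, VExpr.eval_dot, VExpr.eval_cross, eval_windowE, RExpr.eval,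
    IExpr.eval, Int.cast_zero, eval_normalE, not_le]

/-- The position overwritten lies just outside the window, and the entry read there after a full
turn is the old first one. -/
theorem windowCycle_rotate {s : State} (h : s.ireg 7 < s.ireg 8) :
    windowCycle (rotateCmd.run s) = fun i => windowCycle s (i + 1) := by
  have e7 : (rotateCmd.run s).ireg 7 = s.ireg 7 + 1 := by
    simp [rotateCmd, Cmd.run, IExpr.eval, succE]
  have e8 : (rotateCmd.run s).ireg 8 = s.ireg 8 + 1 := by
    simp [rotateCmd, Cmd.run, IExpr.eval, succE]
  have ea : (rotateCmd.run s).iarr 7 =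
      Function.update (s.iarr 7) (s.ireg 8) (s.iarr 7 (s.ireg 7)) := by
    simp [rotateCmd, Cmd.run, IExpr.eval]
  have er : (rotateCmd.run s).rarr = s.rarr := by simp [rotateCmd, Cmd.run]
  funext i
  simp only [windowCycle, windowAt, normalAt, e7, e8, ea, er]
  rw [show s.ireg 8 + 1 - (s.ireg 7 + 1) = s.ireg 8 - s.ireg 7 by omega]
  have hlt := Nat.mod_lt i (show 0 < s.ireg 8 - s.ireg 7 by omega)
  have : Function.update (s.iarr 7) (s.ireg 8) (s.iarr 7 (s.ireg 7))
      (s.ireg 7 + 1 + i % (s.ireg 8 - s.ireg 7)) =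
      s.iarr 7 (s.ireg 7 + (i + 1) % (s.ireg 8 - s.ireg 7)) := by
    rw [← Nat.mod_add_mod]
    by_cases hi : i % (s.ireg 8 - s.ireg 7) + 1 = s.ireg 8 - s.ireg 7
    · rw [hi, Nat.mod_self, show s.ireg 7 + 1 + i % (s.ireg 8 - s.ireg 7) = s.ireg 8 by omega,
        Function.update_self, add_zero]
    · rw [Nat.mod_eq_of_lt (show i % (s.ireg 8 - s.ireg 7) + 1 < s.ireg 8 - s.ireg 7 by omega),
        Function.update_of_ne (by omega)]
      congr 1; omega
  rw [this]

theorem windowCycle_delete {s : State} (h : s.ireg 7 + 2 ≤ s.ireg 8) :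
    windowCycle (deleteCmd.run s) =
      fun i => windowCycle s (i + i / (s.ireg 8 - s.ireg 7 - 1)) := by
  have e7 : (deleteCmd.run s).ireg 7 = s.ireg 7 := by simp [deleteCmd, Cmd.run]
  have e8 : (deleteCmd.run s).ireg 8 = s.ireg 8 - 1 := by simp [deleteCmd, Cmd.run, IExpr.eval]
  have ea : (deleteCmd.run s).iarr = s.iarr := by simp [deleteCmd, Cmd.run]
  have er : (deleteCmd.run s).rarr = s.rarr := by simp [deleteCmd, Cmd.run]
  funext i
  simp only [windowCycle, windowAt, normalAt, e7, e8, ea, er]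
  obtain ⟨n, hn⟩ : ∃ n, s.ireg 8 - s.ireg 7 = n + 1 := ⟨s.ireg 8 - s.ireg 7 - 1, by omega⟩
  rw [show s.ireg 8 - 1 - s.ireg 7 = n by omega, hn, Nat.add_sub_cancel]
  have : (i + i / n) % (n + 1) = i % n := by
    have h1 := Nat.mod_add_div i n
    have h2 := Nat.mod_lt i (show 0 < n by omega)
    rw [show i + i / n = i % n + (n + 1) * (i / n) by rw [add_mul, one_mul]; omega,
      Nat.add_mul_mod_self_left, Nat.mod_eq_of_lt (by omega)]
  rw [this]

theorem eliminate_spec (hP : IsConvexPolyhedron P) (hD : D.IsBoundaryOf P) {s : State}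
    (hs : Ready D s) (f : Fin D.nF) (hf : s.ireg 4 = f) (h8 : s.ireg 8 = D.deg f)
    (hl : ∀ i < D.deg f, s.iarr 7 i = D.neighbour f i) :
    Runs eliminate s
      (elimInit.bound + ((elimCond.cost + elimBody.bound) * (3 * D.deg f) + elimCond.cost))
      fun s' => ElimInv P D f s' ∧ (1 ≤ s'.ireg 10 → s'.ireg 8 - s'.ireg 7 ≤ s'.ireg 9) := by
  have hdeg := hD.deg_pos f
  have hinit : elimInit.Straight := ⟨trivial, trivial, trivial⟩
  refine Runs.seq (hinit.runs (Q := fun s' => ElimInv P D f s' ∧ Ready D s' ∧ s'.ireg 4 = f ∧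
    s'.ireg 7 = 0 ∧ s'.ireg 8 = D.deg f) ?_) fun s₀ hs₀ => ?_
  · have e7 : (elimInit.run s).ireg 7 = 0 := by simp [elimInit, Cmd.run, IExpr.eval]
    have e8 : (elimInit.run s).ireg 8 = D.deg f := by simpa [elimInit, Cmd.run, IExpr.eval] using h8
    have e9 : (elimInit.run s).ireg 9 = 0 := by simp [elimInit, Cmd.run, IExpr.eval]
    have e10 : (elimInit.run s).ireg 10 = 1 := by simp [elimInit, Cmd.run, IExpr.eval]
    have ea : (elimInit.run s).iarr = s.iarr := by simp [elimInit, Cmd.run]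
    have er : (elimInit.run s).rarr = s.rarr := by simp [elimInit, Cmd.run]
    have hw : windowCycle (elimInit.run s) = fun i => D.faceNormal (D.neighbour f i) := by
      funext i
      have hlt := Nat.mod_lt i hdeg
      have h1 : normalAt (elimInit.run s) (s.iarr 7 (i % D.deg f)) =
          D.faceNormal (D.neighbour f (i % D.deg f)) := by
        rw [normalAt_congr (s := s) (by rw [er]) (by rw [er]) (by rw [er]), hl _ hlt, hs.normal]
      rw [windowCycle, windowAt, e7, e8, ea, Nat.sub_zero, zero_add, h1]
      congr 1
      simp only [DCEL.neighbour, DCEL.walk, DCEL.deg, Function.iterate_mod_minimalPeriod_eq]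
    refine ⟨⟨by omega, by omega, fun _ => ?_, fun h => absurd e10.ge h⟩, ⟨?_, fun a ha => ?_,
      fun g => ?_⟩, ?_, e7, e8⟩
    · rw [e7, e8, e9, hw]
      exact elimination_init hP hD f
    · simpa [elimInit, Cmd.run] using hs.nF
    · rw [ea, hs.iarr a ha]
    · rw [normalAt_congr (s := s) (by rw [er]) (by rw [er]) (by rw [er]), hs.normal]
    · simpa [elimInit, Cmd.run] using hf
  · obtain ⟨hinv₀, hr₀, hf₀, h7₀, h8₀⟩ := hs₀
    -- The potential is three times the window size minus the number of good corners. A rotation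
    -- adds one good corner; a deletion costs at most two good corners but pays three; clearing the
    -- flag sets the potential to zero, which is a strict drop because the window still has at least
    -- three entries.
    refine (Runs.loop (b := elimCond) (c := elimBody) (s₀ := s₀) (ElimInv P D f)
      (fun s => (elimCond.cost + elimBody.bound) *
        (if 1 ≤ s.ireg 10 then 3 * (s.ireg 8 - s.ireg 7) - s.ireg 9 else 0)) ?_ hinv₀).mono ?_ ?_
    · rintro s hfr hinv hb
      have hr : Ready D s := hr₀.frame hfr (by decide) (by decide) (by decide)
      have hf4 : s.ireg 4 = f := (hfr.ireg 4 (by decide)).trans hf₀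
      simp only [elimCond, Cond.Holds, IExpr.eval, succE] at hb
      obtain ⟨h10, hg⟩ := hb
      have E := hinv.window h10
      have h3 := Elimination.three_le E.toAngularCycle E.two_le
      have hlo := hinv.lo_le
      have wp : windowCycle s (s.ireg 8 - s.ireg 7 - 2) = windowAt s (s.ireg 8 - 2) := by
        rw [windowCycle, Nat.mod_eq_of_lt (by omega)]; congr 1; omega
      have wk : windowCycle s (s.ireg 8 - s.ireg 7 - 2 + 1) = windowAt s (s.ireg 8 - 1) := by
        rw [windowCycle, Nat.mod_eq_of_lt (by omega)]; congr 1; omega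
      have wq : windowCycle s (s.ireg 8 - s.ireg 7) = windowAt s (s.ireg 7) := by
        rw [windowCycle, Nat.mod_self, add_zero]
      have wq' : windowCycle s (s.ireg 8 - s.ireg 7 - 2 + 2) = windowAt s (s.ireg 7) := by
        rw [← wq]; congr 1; omega
      have hc : normalAt s (s.ireg 4) = D.faceNormal f := by rw [hf4, hr.normal]
      have hstr : elimBody.Straight :=
        ⟨⟨trivial, trivial, trivial, trivial⟩, ⟨trivial, trivial⟩, trivial⟩
      refine ⟨_, hstr.runs ?_⟩
      rw [if_pos h10]
      have hpot : ∀ x y : ℕ, x < y → elimCond.cost + elimBody.bound +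
          (elimCond.cost + elimBody.bound) * x ≤ (elimCond.cost + elimBody.bound) * y := by
        intro x y hxy
        rw [Nat.add_comm, ← Nat.mul_succ]
        exact Nat.mul_le_mul_left _ hxy
      by_cases hgood : goodCond.Holds s
      · have hrun : elimBody.run s = rotateCmd.run s := by rw [elimBody, Cmd.run, if_pos hgood]
        rw [hrun]
        have e7 : (rotateCmd.run s).ireg 7 = s.ireg 7 + 1 := by
          simp [rotateCmd, Cmd.run, IExpr.eval, succE]
        have e8 : (rotateCmd.run s).ireg 8 = s.ireg 8 + 1 := by
          simp [rotateCmd, Cmd.run, IExpr.eval, succE]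
        have e9 : (rotateCmd.run s).ireg 9 = s.ireg 9 + 1 := by
          simp [rotateCmd, Cmd.run, IExpr.eval, succE]
        have e10 : (rotateCmd.run s).ireg 10 = s.ireg 10 := by simp [rotateCmd, Cmd.run]
        have esz : s.ireg 8 + 1 - (s.ireg 7 + 1) = s.ireg 8 - s.ireg 7 := by omega
        refine ⟨⟨by omega, by rw [e7, e8, esz]; exact hinv.size_le, fun _ => ?_,
          fun h => absurd h10 (by rwa [e10] at h)⟩, ?_⟩
        · rw [windowCycle_rotate (by omega), e7, e8, e9, esz]
          refine E.rotate (by omega) ?_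
          rw [goodCond_iff] at hgood
          rw [cornerDet, wp, wk, wq']
          exact hgood
        · rw [e7, e8, e9, e10, if_pos h10]
          exact hpot _ _ (by omega)
      · have hbad : cornerDet (windowCycle s) (s.ireg 8 - s.ireg 7 - 2) < 0 := by
          rw [goodCond_iff] at hgood
          rw [cornerDet, wp, wk, wq']
          exact not_le.1 hgood
        by_cases hturn : turnCond.Holds s
        · have hrun : elimBody.run s = deleteCmd.run s := by
            rw [elimBody, Cmd.run, if_neg hgood, Cmd.run, if_pos hturn]
          rw [hrun]
          have e7 : (deleteCmd.run s).ireg 7 = s.ireg 7 := by simp [deleteCmd, Cmd.run]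
          have e8 : (deleteCmd.run s).ireg 8 = s.ireg 8 - 1 := by
            simp [deleteCmd, Cmd.run, IExpr.eval]
          have e9 : (deleteCmd.run s).ireg 9 = s.ireg 9 - 2 := by
            simp [deleteCmd, Cmd.run, IExpr.eval]
          have e10 : (deleteCmd.run s).ireg 10 = s.ireg 10 := by simp [deleteCmd, Cmd.run]
          have esz : s.ireg 8 - 1 - s.ireg 7 = s.ireg 8 - s.ireg 7 - 1 := by omega
          have := hinv.size_le
          refine ⟨⟨by omega, by omega, fun _ => ?_, fun h => absurd h10 (by rwa [e10] at h)⟩, ?_⟩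
          · rw [windowCycle_delete (by omega), e7, e8, e9, esz]
            refine E.delete (by omega) hbad ?_
            rw [turnCond_iff, hc] at hturn
            rw [wp, wq]
            exact hturn
          · rw [e7, e8, e9, e10, if_pos h10]
            exact hpot _ _ (by omega)
        · have hrun : elimBody.run s = (Cmd.iset 10 (.const 0)).run s := by
            simp only [elimBody, Cmd.run, if_neg hgood, if_neg hturn]
          rw [hrun]
          have e7 : ((Cmd.iset 10 (.const 0)).run s).ireg 7 = s.ireg 7 := by simp [Cmd.run]
          have e8 : ((Cmd.iset 10 (.const 0)).run s).ireg 8 = s.ireg 8 := by simp [Cmd.run]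
          have e10 : ((Cmd.iset 10 (.const 0)).run s).ireg 10 = 0 := by simp [Cmd.run, IExpr.eval]
          refine ⟨⟨by omega, by rw [e7, e8]; exact hinv.size_le,
            fun h => absurd h (by rw [e10]; norm_num), fun _ => ?_⟩, ?_⟩
          · rw [pullOutDirections_eq' hP hD, Set.eq_empty_iff_forall_notMem]
            rintro d ⟨hd1, hd2⟩
            refine E.infeasible hbad ?_ d hd1 hd2
            rw [turnCond_iff, hc] at hturn
            rwa [wp, wq]
          · rw [e10, if_neg (by norm_num)]
            exact hpot _ _ (by omega)
    · gcongr
      split_ifs <;> omega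
    · rintro s ⟨hinv, hb, hfr⟩
      refine ⟨hinv, fun h10 => ?_⟩
      simp only [elimCond, Cond.Holds, IExpr.eval, succE] at hb
      by_contra h
      exact hb ⟨h10, by omega⟩

end AllFAD
end Casting

namespace Casting
namespace AllFAD

open RealRAM DCEL.IsBoundaryOf

variable {D : DCEL} {P : Set Vec3}

/-! ## Output -/

theorem run_outPut (s : State) (i : IExpr) :
    (outPut i).run s = { s with
      ireg := Function.update s.ireg 11 (s.ireg 11 + 1)
      rarr := fun d =>
        if d = 3 then Function.update (s.rarr 3) (s.ireg 11)
          ((windowAt s (i.eval s) ⨯₃ windowAt s (i.eval s + 1)) 0)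
        else if d = 4 then Function.update (s.rarr 4) (s.ireg 11)
          ((windowAt s (i.eval s) ⨯₃ windowAt s (i.eval s + 1)) 1)
        else if d = 5 then Function.update (s.rarr 5) (s.ireg 11)
          ((windowAt s (i.eval s) ⨯₃ windowAt s (i.eval s + 1)) 2) else s.rarr d } := by
  rw [outPut, Cmd.run, run_vput s (.reg 11) _ (by norm_num) (by norm_num) (by norm_num)]
  · rw [VExpr.eval_cross, eval_windowE, eval_windowE]
    rfl
  · intro r j hr
    fin_cases j <;>
    simp [VExpr.eval, VExpr.cross, windowE, normalE, VExpr.arr, RExpr.eval, eval_rarr, hr]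

theorem outAt_outPut (s : State) (i : IExpr) (j : ℕ) :
    outAt ((outPut i).run s) j = if j = s.ireg 11 then
      windowAt s (i.eval s) ⨯₃ windowAt s (i.eval s + 1) else outAt s j := by
  rw [run_outPut]
  by_cases h : j = s.ireg 11
  · subst h
    rw [if_pos rfl]
    ext k
    fin_cases k <;> simp [outAt]
  · rw [if_neg h]
    simp [outAt, Function.update_of_ne h]

theorem windowAt_congr {s s' : State} (ha : s'.iarr 7 = s.iarr 7) (h6 : s'.rarr 6 = s.rarr 6)
    (h7 : s'.rarr 7 = s.rarr 7) (h8 : s'.rarr 8 = s.rarr 8) (i : ℕ) :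
    windowAt s' i = windowAt s i := by
  rw [windowAt, windowAt, ha, normalAt_congr h6 h7 h8]

/-- The edges of positive length among the first `k`, with their ends in the output arrays. -/
structure Emitted (a : ℕ → Vec3) (out k r : ℕ) (idx : ℕ → ℕ) (s : State) : Prop where
  count : s.ireg 11 = out + r
  mono : ∀ i j, i < j → j < r → idx i < idx j
  lt : ∀ t < r, idx t < k
  pos : ∀ t < r, 0 < cornerDet a (idx t)
  all : ∀ i < k, 0 < cornerDet a i → ∃ t < r, idx t = i
  out : ∀ t < r, outAt s (out + t) = a (idx t + 1) ⨯₃ a (idx t + 2)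

theorem edgeCond_iff (s : State) :
    edgeCond.Holds s ↔ 0 < windowAt s (s.ireg 12) ⬝ᵥ
      (windowAt s (s.ireg 12 + 1) ⨯₃ windowAt s (s.ireg 12 + 1 + 1)) := by
  simp only [edgeCond, Cond.Holds, VExpr.eval_dot, VExpr.eval_cross, eval_windowE, RExpr.eval,
    IExpr.eval, Int.cast_zero, eval_succE, not_le]

theorem Emitted.skip {a : ℕ → Vec3} {out k r : ℕ} {idx : ℕ → ℕ} {s s' : State}
    (h : Emitted a out k r idx s) (hk : ¬ 0 < cornerDet a k) (h11 : s'.ireg 11 = s.ireg 11)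
    (ho : ∀ j, outAt s' j = outAt s j) : Emitted a out (k + 1) r idx s' where
  count := by rw [h11, h.count]
  mono := h.mono
  lt t ht := (h.lt t ht).trans (Nat.lt_succ_self k)
  pos := h.pos
  all i hi hp := by
    rcases Nat.lt_succ_iff_lt_or_eq.1 hi with h' | rfl
    · exact h.all i h' hp
    · exact absurd hp hk
  out t ht := by rw [ho, h.out t ht]

theorem Emitted.emit {a : ℕ → Vec3} {out k r : ℕ} {idx : ℕ → ℕ} {s s' : State}
    (h : Emitted a out k r idx s) (hk : 0 < cornerDet a k) (h11 : s'.ireg 11 = s.ireg 11 + 1)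
    (ho : ∀ j, outAt s' j = if j = s.ireg 11 then a (k + 1) ⨯₃ a (k + 2) else outAt s j) :
    Emitted a out (k + 1) (r + 1) (Function.update idx r k) s' where
  count := by rw [h11, h.count]; rfl
  mono i j hij hj := by
    rw [Function.update_of_ne (show i ≠ r by omega)]
    by_cases hjr : j = r
    · subst hjr; rw [Function.update_self]; exact h.lt i hij
    · rw [Function.update_of_ne hjr]; exact h.mono i j hij (by omega)
  lt t ht := by
    by_cases htr : t = r
    · subst htr; rw [Function.update_self]; omega
    · rw [Function.update_of_ne htr]; have := h.lt t (by omega); omega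
  pos t ht := by
    by_cases htr : t = r
    · subst htr; rwa [Function.update_self]
    · rw [Function.update_of_ne htr]; exact h.pos t (by omega)
  all i hi hp := by
    by_cases hik : i = k
    · exact ⟨r, by omega, by rw [Function.update_self, hik]⟩
    · obtain ⟨t, ht, e⟩ := h.all i (by omega) hp
      exact ⟨t, by omega, by rw [Function.update_of_ne (by omega), e]⟩
  out t ht := by
    rw [ho, h.count]
    by_cases htr : t = r
    · subst htr; rw [if_pos rfl, Function.update_self]
    · rw [if_neg (by omega), Function.update_of_ne htr]; exact h.out t (by omega)

theorem outInit_spec {s : State} (hm : s.ireg 7 + 2 ≤ s.ireg 8) :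
    ∀ i ≤ s.ireg 8 - s.ireg 7 + 1,
      windowAt (outInit.run s) (s.ireg 7 + i) = windowCycle s i := by
  have ea : (outInit.run s).iarr 7 = Function.update (Function.update (s.iarr 7) (s.ireg 8)
      (s.iarr 7 (s.ireg 7))) (s.ireg 8 + 1) (s.iarr 7 (s.ireg 7 + 1)) := by
    simp [outInit, Cmd.run, IExpr.eval, succE,
      Function.update_of_ne (show s.ireg 7 + 1 ≠ s.ireg 8 by omega)]
  have er : (outInit.run s).rarr = s.rarr := by simp [outInit, Cmd.run]
  intro i hi
  rw [windowCycle, windowAt, windowAt, ea,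
    normalAt_congr (s := s) (by rw [er]) (by rw [er]) (by rw [er])]
  congr 1
  rcases Nat.lt_trichotomy i (s.ireg 8 - s.ireg 7) with h | h | h
  · rw [Nat.mod_eq_of_lt h, Function.update_of_ne (by omega), Function.update_of_ne (by omega)]
  · rw [h, Nat.mod_self, show s.ireg 7 + (s.ireg 8 - s.ireg 7) = s.ireg 8 by omega,
      Function.update_of_ne (by omega), Function.update_self, add_zero]
  · rw [show i = 1 + (s.ireg 8 - s.ireg 7) by omega, Nat.add_mod_right,
      Nat.mod_eq_of_lt (by omega),
      show s.ireg 7 + (1 + (s.ireg 8 - s.ireg 7)) = s.ireg 8 + 1 by omega, Function.update_self]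

theorem outLoop_spec {s : State} {a : ℕ → Vec3} (hm : s.ireg 7 ≤ s.ireg 8)
    (hw : ∀ i ≤ s.ireg 8 - s.ireg 7 + 1, windowAt s (s.ireg 7 + i) = a i)
    (h12 : s.ireg 12 = s.ireg 7) :
    Runs (.loop outCond outBody) s
      ((outCond.cost + outBody.bound) * (s.ireg 8 - s.ireg 7) + outCond.cost)
      fun s' => Frame outBody s s' ∧ (∀ j < s.ireg 11, outAt s' j = outAt s j) ∧
        ∃ r idx, Emitted a (s.ireg 11) (s.ireg 8 - s.ireg 7) r idx s' := by
  refine (Runs.loop (b := outCond) (c := outBody) (s₀ := s)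
    (fun s' => s.ireg 7 ≤ s'.ireg 12 ∧ s'.ireg 12 ≤ s.ireg 8 ∧
      (∀ j < s.ireg 11, outAt s' j = outAt s j) ∧
      ∃ r idx, Emitted a (s.ireg 11) (s'.ireg 12 - s.ireg 7) r idx s')
    (fun s' => (outCond.cost + outBody.bound) * (s.ireg 8 - s'.ireg 12)) ?_ ?_).mono
    (by rw [h12]) ?_
  · rintro s₁ hfr ⟨h1, h2, hold, r, idx, he⟩ hb
    have h7 : s₁.ireg 7 = s.ireg 7 := hfr.ireg 7 (by decide)
    have h8 : s₁.ireg 8 = s.ireg 8 := hfr.ireg 8 (by decide)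
    have hlt : s₁.ireg 12 < s.ireg 8 := by
      simpa [outCond, Cond.Holds, IExpr.eval, succE, h8, Nat.succ_le_iff] using hb
    have hw₁ : ∀ i ≤ s.ireg 8 - s.ireg 7 + 1, windowAt s₁ (s.ireg 7 + i) = a i := fun i hi => by
      rw [windowAt_congr (s := s) (hfr.iarr 7 (by decide)) (hfr.rarr 6 (by decide))
        (hfr.rarr 7 (by decide)) (hfr.rarr 8 (by decide)), hw i hi]
    obtain ⟨k, hk⟩ : ∃ k, s₁.ireg 12 = s.ireg 7 + k := ⟨s₁.ireg 12 - s.ireg 7, by omega⟩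
    have hk' : s₁.ireg 12 - s.ireg 7 = k := by omega
    rw [hk'] at he
    have w0 : windowAt s₁ (s₁.ireg 12) = a k := by rw [hk]; exact hw₁ k (by omega)
    have w1 : windowAt s₁ (s₁.ireg 12 + 1) = a (k + 1) := by
      rw [hk, Nat.add_assoc]; exact hw₁ (k + 1) (by omega)
    have w2 : windowAt s₁ (s₁.ireg 12 + 1 + 1) = a (k + 2) := by
      rw [hk, Nat.add_assoc, Nat.add_assoc]; exact hw₁ (k + 2) (by omega)
    have hstr : outBody.Straight :=
      ⟨⟨⟨⟨trivial, trivial, trivial⟩, trivial⟩, trivial⟩, trivial⟩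
    have hcond : edgeCond.Holds s₁ ↔ 0 < cornerDet a k := by
      rw [edgeCond_iff, w0, w1, w2]; rfl
    -- Common end of both branches: `t` is the state before register 12 advances.
    have fin : ∀ t : State, outBody.run s₁ = (Cmd.iset 12 (succE (.reg 12))).run t →
        t.ireg 12 = s₁.ireg 12 →
        (∀ j < s.ireg 11, outAt t j = outAt s j) →
        (∃ r idx, Emitted a (s.ireg 11) (k + 1) r idx t) →
        ((s.ireg 7 ≤ (outBody.run s₁).ireg 12 ∧ (outBody.run s₁).ireg 12 ≤ s.ireg 8 ∧
          (∀ j < s.ireg 11, outAt (outBody.run s₁) j = outAt s j) ∧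
          ∃ r idx, Emitted a (s.ireg 11) ((outBody.run s₁).ireg 12 - s.ireg 7) r idx
            (outBody.run s₁)) ∧
          outCond.cost + outBody.bound + (outCond.cost + outBody.bound) *
            (s.ireg 8 - (outBody.run s₁).ireg 12) ≤
          (outCond.cost + outBody.bound) * (s.ireg 8 - s₁.ireg 12)) := by
      rintro t ht ht12 htold ⟨r, idx, hte⟩
      have e12 : (outBody.run s₁).ireg 12 = s₁.ireg 12 + 1 := by
        rw [ht]; simp [Cmd.run, IExpr.eval, succE, ht12]
      have e11 : (outBody.run s₁).ireg 11 = t.ireg 11 := by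
        rw [ht]; simp [Cmd.run]
      have eo : ∀ j, outAt (outBody.run s₁) j = outAt t j := fun j => by
        rw [ht]; simp [Cmd.run, outAt]
      refine ⟨⟨by omega, by omega, fun j hj => by rw [eo, htold j hj], r, idx, ?_⟩, ?_⟩
      · rw [show (outBody.run s₁).ireg 12 - s.ireg 7 = k + 1 by omega]
        exact ⟨by rw [e11, hte.count], hte.mono, hte.lt, hte.pos, hte.all,
          fun t ht => by rw [eo, hte.out t ht]⟩
      · rw [e12, show s.ireg 8 - s₁.ireg 12 = s.ireg 8 - (s₁.ireg 12 + 1) + 1 by omega,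
          Nat.mul_succ]
        exact (Nat.add_comm _ _).le
    refine ⟨_, hstr.runs ?_⟩
    by_cases hpos : edgeCond.Holds s₁
    · have ho : ∀ j, outAt ((outPut (succE (.reg 12))).run s₁) j =
          if j = s₁.ireg 11 then a (k + 1) ⨯₃ a (k + 2) else outAt s₁ j := fun j => by
        rw [outAt_outPut, eval_succE, IExpr.eval, w1, w2]
      refine fin ((outPut (succE (.reg 12))).run s₁) ?_ ?_ (fun j hj => ?_) ⟨_, _,
        he.emit (hcond.1 hpos) ?_ ho⟩
      · simp only [outBody, Cmd.run, if_pos hpos]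
      · rw [run_outPut]; simp
      · rw [ho, if_neg (by rw [he.count]; omega), hold j hj]
      · rw [run_outPut]; simp
    · refine fin s₁ ?_ rfl hold ⟨_, _, he.skip (mt hcond.2 hpos) rfl fun _ => rfl⟩
      simp only [outBody, Cmd.run, if_neg hpos]
  · refine ⟨h12.ge, by omega, fun _ _ => rfl, 0, id, rfl, fun i j _ hj => absurd hj (Nat.not_lt_zero _),
      fun t ht => absurd ht (Nat.not_lt_zero _), fun t ht => absurd ht (Nat.not_lt_zero _),
      fun i hi => by omega, fun t ht => absurd ht (Nat.not_lt_zero _)⟩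
  · rintro s₁ ⟨⟨h1, h2, hold, r, idx, he⟩, hb, hfr⟩
    have h8 : s₁.ireg 8 = s.ireg 8 := hfr.ireg 8 (by decide)
    have : s₁.ireg 12 = s.ireg 8 := by
      simp only [outCond, Cond.Holds, IExpr.eval, succE, h8] at hb
      omega
    rw [this] at he
    exact ⟨hfr, hold, r, idx, he⟩

theorem isRayCycle_congr {r n : ℕ} {v w : ℕ → Vec3} {S : Set Vec3} (hn : n = r)
    (hvw : ∀ t < r, v t = w t) (h : IsRayCycle (fun t : Fin r => w t) S) :
    IsRayCycle (fun t : Fin n => v t) S := by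
  subst hn
  have : (fun t : Fin n => v t) = fun t : Fin n => w t := funext fun t => hvw t t.2
  rwa [this]

/-- What processing a valid top facet changes. -/
structure Appended (f : ℕ) (S : Set Vec3) (s s' : State) : Prop where
  count : s'.ireg 3 = s.ireg 3 + 1
  list : s'.iarr 5 = Function.update (s.iarr 5) (s.ireg 3) f
  blocks : s'.iarr 6 = Function.update (s.iarr 6) (s.ireg 3 + 1) (s'.ireg 11)
  le : s.ireg 11 ≤ s'.ireg 11
  old : ∀ j < s.ireg 11, outAt s' j = outAt s j
  rays : IsRayCycle (fun t : Fin (s'.ireg 11 - s.ireg 11) => outAt s' (s.ireg 11 + t)) S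

def outTime (m : ℕ) : ℕ :=
  outInit.bound + ((outCond.cost + outBody.bound) * m + outCond.cost +
    (outSingle.bound + outEnd.bound))

theorem output_spec {s : State} {c : Vec3} {f : ℕ} (hf : s.ireg 4 = f)
    (H : ConvexChain c (s.ireg 8 - s.ireg 7) (windowCycle s)) (hm : s.ireg 7 + 2 ≤ s.ireg 8)
    (h6 : s.iarr 6 (s.ireg 3) = s.ireg 11) :
    Runs output s (outTime (s.ireg 8 - s.ireg 7))
      fun s' => Appended f (feasibleCone c (windowCycle s)) s s' := by
  have hinit : outInit.Straight := ⟨trivial, trivial, trivial, trivial⟩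
  refine Runs.seq (hinit.runs (Q := fun s' => s' = outInit.run s) rfl) ?_
  rintro s₀ rfl
  have i3 : (outInit.run s).ireg 3 = s.ireg 3 := by simp [outInit, Cmd.run]
  have i7 : (outInit.run s).ireg 7 = s.ireg 7 := by simp [outInit, Cmd.run]
  have i8 : (outInit.run s).ireg 8 = s.ireg 8 := by simp [outInit, Cmd.run]
  have i11 : (outInit.run s).ireg 11 = s.ireg 11 := by simp [outInit, Cmd.run]
  have i12 : (outInit.run s).ireg 12 = s.ireg 7 := by simp [outInit, Cmd.run, IExpr.eval]
  have a5 : (outInit.run s).iarr 5 = Function.update (s.iarr 5) (s.ireg 3) f := by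
    simp [outInit, Cmd.run, IExpr.eval, hf]
  have a6 : (outInit.run s).iarr 6 = s.iarr 6 := by simp [outInit, Cmd.run]
  have ho : ∀ j, outAt (outInit.run s) j = outAt s j := fun j => by simp [outInit, Cmd.run, outAt]
  have hw := outInit_spec hm
  generalize outInit.run s = s₀ at *
  have hl := outLoop_spec (s := s₀) (a := windowCycle s) (by omega) (by rwa [i7, i8])
    (by rw [i12, i7])
  rw [i7, i8] at hl
  refine Runs.seq hl ?_
  rintro s₁ ⟨hfr, hold, r, idx, he⟩
  rw [i11] at hold he
  have j3 : s₁.ireg 3 = s.ireg 3 := (hfr.ireg 3 (by decide)).trans i3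
  have j7 : s₁.ireg 7 = s.ireg 7 := (hfr.ireg 7 (by decide)).trans i7
  have b5 : s₁.iarr 5 = _ := (hfr.iarr 5 (by decide)).trans a5
  have b6 : s₁.iarr 6 = s.iarr 6 := (hfr.iarr 6 (by decide)).trans a6
  have hw₁ : ∀ i ≤ 1, windowAt s₁ (s.ireg 7 + i) = windowCycle s i := fun i hi => by
    rw [windowAt_congr (s := s₀) (hfr.iarr 7 (by decide)) (hfr.rarr 6 (by decide))
      (hfr.rarr 7 (by decide)) (hfr.rarr 8 (by decide)), hw i (by omega)]
  have hstr : Cmd.Straight (.seq outSingle outEnd) :=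
    ⟨⟨⟨⟨trivial, trivial, trivial⟩, trivial⟩, trivial⟩, trivial, trivial⟩
  -- The entry `6[reg 3]` is still the output position from before this block, so the test compares
  -- `r` with zero.
  have hsingle : (Cond.ile (.reg 11) (.arr 6 (.reg 3))).Holds s₁ ↔ r = 0 := by
    simp only [Cond.Holds, IExpr.eval, j3, b6, h6, he.count]
    omega
  have fin : ∀ t : State, outSingle.run s₁ = t → t.ireg 3 = s₁.ireg 3 → t.iarr = s₁.iarr →
      s.ireg 11 ≤ t.ireg 11 → (∀ j < s.ireg 11, outAt t j = outAt s j) →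
      IsRayCycle (fun k : Fin (t.ireg 11 - s.ireg 11) => outAt t (s.ireg 11 + k))
        (feasibleCone c (windowCycle s)) →
      Appended f (feasibleCone c (windowCycle s)) s ((Cmd.seq outSingle outEnd).run s₁) := by
    intro t ht t3 ta tle told tray
    rw [Cmd.run, ht]
    have u3 : (outEnd.run t).ireg 3 = s.ireg 3 + 1 := by
      simp [outEnd, Cmd.run, IExpr.eval, succE, t3, j3]
    have u11 : (outEnd.run t).ireg 11 = t.ireg 11 := by simp [outEnd, Cmd.run]
    have uo : ∀ j, outAt (outEnd.run t) j = outAt t j := fun j => by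
      simp [outEnd, Cmd.run, outAt]
    refine ⟨u3, ?_, ?_, by rwa [u11], fun j hj => by rw [uo, told j hj], ?_⟩
    · rw [← b5, ← ta]; simp [outEnd, Cmd.run]
    · rw [u11, ← b6, ← ta]
      simp [outEnd, Cmd.run, IExpr.eval, succE, t3, j3]
    · simp only [uo]; exact tray
  refine hstr.runs ?_
  by_cases hr : r = 0
  · have ho1 : ∀ j, outAt ((outPut (.reg 7)).run s₁) j = if j = s₁.ireg 11 then
        windowCycle s 0 ⨯₃ windowCycle s 1 else outAt s₁ j := fun j => by
      rw [outAt_outPut, IExpr.eval, j7, ← hw₁ 0 (by omega), ← hw₁ 1 (by omega)]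
      rfl
    have hc : s₁.ireg 11 = s.ireg 11 := by rw [he.count, hr]; rfl
    have h11 : ((outPut (.reg 7)).run s₁).ireg 11 = s.ireg 11 + 1 := by
      rw [run_outPut, ← hc]; simp
    refine fin ((outPut (.reg 7)).run s₁) ?_ ?_ ?_ ?_ (fun j hj => ?_) ?_
    · simp only [outSingle, Cmd.run, if_pos (hsingle.2 hr)]
    · rw [run_outPut]; simp
    · rw [run_outPut]
    · omega
    · rw [ho1, if_neg (by omega), hold j hj, ho]
    · refine isRayCycle_congr (w := fun _ => windowCycle s 0 ⨯₃ windowCycle s 1) (r := 1)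
        (v := fun k => outAt ((outPut (.reg 7)).run s₁) (s.ireg 11 + k)) (by omega)
        (fun t ht => ?_) (H.isRayCycle_single fun i hi hp => ?_)
      · rw [ho1, if_pos (by omega)]
      · obtain ⟨t, ht, _⟩ := he.all i hi hp
        omega
  · refine fin s₁ ?_ rfl rfl ?_ (fun j hj => ?_) ?_
    · simp only [outSingle, Cmd.run, if_neg (mt hsingle.1 hr)]
    · rw [he.count]; omega
    · rw [hold j hj, ho]
    · exact isRayCycle_congr (w := fun t => windowCycle s (idx t + 1) ⨯₃ windowCycle s (idx t + 2))
        (v := fun k => outAt s₁ (s.ireg 11 + k)) (by rw [he.count]; omega) he.out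
        (H.isRayCycle hr idx he.mono he.lt he.pos he.all)

end AllFAD
end Casting

namespace Casting
namespace AllFAD

open RealRAM DCEL.IsBoundaryOf

variable {D : DCEL} {P : Set Vec3}

/-! ## The loop over the facets -/

/-- The output is unchanged. -/
structure Unchanged (s s' : State) : Prop where
  count : s'.ireg 3 = s.ireg 3
  top : s'.ireg 11 = s.ireg 11
  list : s'.iarr 5 = s.iarr 5
  blocks : s'.iarr 6 = s.iarr 6
  out : ∀ j, outAt s' j = outAt s j

theorem Unchanged.frame {s s' : State} {c : Cmd} (h : Frame c s s') (h3 : 3 ∉ c.wI)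
    (h11 : 11 ∉ c.wI) (h5 : 5 ∉ c.wIA) (h6 : 6 ∉ c.wIA) (hr : ∀ a, 3 ≤ a → a < 6 → a ∉ c.wRA) :
    Unchanged s s' where
  count := h.ireg 3 h3
  top := h.ireg 11 h11
  list := h.iarr 5 h5
  blocks := h.iarr 6 h6
  out j := by
    rw [outAt, outAt, h.rarr 3 (hr 3 (by norm_num) (by norm_num)),
      h.rarr 4 (hr 4 (by norm_num) (by norm_num)), h.rarr 5 (hr 5 (by norm_num) (by norm_num))]

theorem Unchanged.trans {s s' s'' : State} (h : Unchanged s s') (h' : Unchanged s' s'') :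
    Unchanged s s'' where
  count := h'.count.trans h.count
  top := h'.top.trans h.top
  list := h'.list.trans h.list
  blocks := h'.blocks.trans h.blocks
  out j := (h'.out j).trans (h.out j)

theorem Appended.after {f : ℕ} {S : Set Vec3} {s s' s'' : State} (h : Unchanged s s')
    (h' : Appended f S s' s'') : Appended f S s s'' where
  count := by rw [h'.count, h.count]
  list := by rw [h'.list, h.list, h.count]
  blocks := by rw [h'.blocks, h.blocks, h.count]
  le := h.top ▸ h'.le
  old j hj := by rw [h'.old j (by rwa [h.top]), h.out]
  rays := h.top ▸ h'.rays

theorem Appended.before {f : ℕ} {S : Set Vec3} {s s' s'' : State} (h : Appended f S s s')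
    (h' : Unchanged s' s'') : Appended f S s s'' where
  count := by rw [h'.count, h.count]
  list := by rw [h'.list, h.list]
  blocks := by rw [h'.blocks, h.blocks, h'.top]
  le := h'.top ▸ h.le
  old j hj := by rw [h'.out, h.old j hj]
  rays := isRayCycle_congr (v := fun a => outAt s'' (s.ireg 11 + a))
    (w := fun a => outAt s' (s.ireg 11 + a)) (by rw [h'.top]) (fun _ _ => h'.out _) h.rays

def facetTime (m : ℕ) : ℕ :=
  listInit.bound + ((listCond.cost + listBody.bound) * m + listCond.cost) +
    (elimInit.bound + ((elimCond.cost + elimBody.bound) * (3 * m) + elimCond.cost) +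
      ((Cond.ile (.const 1) (.reg 10)).cost + outTime m + nextFacet.bound))

theorem elimination_bounded (hP : IsConvexPolyhedron P) (hD : D.IsBoundaryOf P) (f : Fin D.nF)
    (w : Vec3) (hc : D.faceNormal f ⬝ᵥ w = 0) (hw : ∀ n ∈ neighbourNormals D f, 0 ≤ n ⬝ᵥ w) :
    w = 0 :=
  (hD.facetFan hP f).bounded hP.convex hP.isCompact hc fun i => hw _ ⟨i, rfl⟩

theorem facetBody_spec (hP : IsConvexPolyhedron P) (hD : D.IsBoundaryOf P) {s : State}
    (hs : Ready D s) (f : Fin D.nF) (hf : s.ireg 4 = f) (h6 : s.iarr 6 (s.ireg 3) = s.ireg 11) :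
    Runs facetBody s (facetTime (D.deg f)) fun s' => s'.ireg 4 = f + 1 ∧
      (pullOutDirections P (D.facet f) = ∅ ∧ Unchanged s s' ∨
        (pullOutDirections P (D.facet f)).Nonempty ∧
          Appended f (pullOutDirections P (D.facet f)) s s') := by
  refine Runs.seq (listNeighbours_spec hD hs f hf).frame ?_
  rintro s₁ ⟨⟨h8, hl⟩, fr₁⟩
  have hs₁ : Ready D s₁ := hs.frame fr₁ (by decide) (by decide) (by decide)
  have hf₁ : s₁.ireg 4 = f := (fr₁.ireg 4 (by decide)).trans hf
  have u₁ : Unchanged s s₁ :=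
    .frame fr₁ (by decide) (by decide) (by decide) (by decide) (by decide)
  refine Runs.seq (eliminate_spec hP hD hs₁ f hf₁ h8 hl).frame ?_
  rintro s₂ ⟨⟨hinv, hgood⟩, fr₂⟩
  have hf₂ : s₂.ireg 4 = f := (fr₂.ireg 4 (by decide)).trans hf₁
  have u₂ : Unchanged s s₂ := u₁.trans
    (.frame fr₂ (by decide) (by decide) (by decide) (by decide) (by decide))
  refine Runs.seq (Q₁ := fun s' => s'.ireg 4 = f ∧
    (pullOutDirections P (D.facet f) = ∅ ∧ Unchanged s s' ∨
      (pullOutDirections P (D.facet f)).Nonempty ∧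
        Appended f (pullOutDirections P (D.facet f)) s s')) (Runs.ite ?_ ?_) ?_
  · intro h10
    have E := hinv.window h10
    have H := E.convexChain (hgood h10) (elimination_bounded hP hD f)
    have hcone : feasibleCone (D.faceNormal f) (windowCycle s₂) =
        pullOutDirections P (D.facet f) := by
      rw [E.feasibleCone_eq, pullOutDirections_eq' hP hD]
    have h2 := E.two_le
    refine (output_spec hf₂ H (by omega) (by rw [u₂.blocks, u₂.count, h6, u₂.top])).frame.mono ?_ ?_
    · have := hinv.size_le
      unfold outTime
      gcongr
    · rintro s₃ ⟨ha, fr₃⟩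
      refine ⟨(fr₃.ireg 4 (by decide)).trans hf₂, Or.inr ⟨?_, ?_⟩⟩
      -- A surviving chain always has a feasible corner, so reaching the output stage proves the
      -- facet valid.
      · rw [← hcone]; exact ⟨_, H.cross_mem 0⟩
      · rw [← hcone]; exact ha.after u₂
  · intro h10
    refine ⟨1, s₂, .skip s₂, ?_, hf₂, Or.inl ⟨hinv.infeasible h10, u₂⟩⟩
    simp only [outTime, outInit, Cmd.bound]
    omega
  · rintro s₃ ⟨hf₃, h⟩
    refine (Cmd.Straight.runs (c := nextFacet) trivial (Q := fun s' => s' = nextFacet.run s₃)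
      rfl).frame.mono le_rfl ?_
    rintro s₄ ⟨rfl, fr⟩
    have u : Unchanged s₃ (nextFacet.run s₃) :=
      .frame fr (by decide) (by decide) (by decide) (by decide) (by decide)
    refine ⟨by simp [nextFacet, Cmd.run, succE, IExpr.eval, hf₃], ?_⟩
    exact h.imp (fun ⟨h, h'⟩ => ⟨h, h'.trans u⟩) fun ⟨h, h'⟩ => ⟨h, h'.before u⟩

/-- The output is correct for the first `k` facets. -/
structure Progress (P : Set Vec3) (D : DCEL) (k : ℕ) (s : State) : Prop where
  lt : ∀ j < s.ireg 3, s.iarr 5 j < k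
  nodup : ∀ i < s.ireg 3, ∀ j < s.ireg 3, s.iarr 5 i = s.iarr 5 j → i = j
  facets : ∀ f : Fin D.nF, f < k →
    ((∃ j < s.ireg 3, s.iarr 5 j = f) ↔ (pullOutDirections P (D.facet f)).Nonempty)
  block_le : ∀ j < s.ireg 3, s.iarr 6 j ≤ s.iarr 6 (j + 1)
  block_top : ∀ j ≤ s.ireg 3, s.iarr 6 j ≤ s.ireg 11
  block_end : s.iarr 6 (s.ireg 3) = s.ireg 11
  directions : ∀ j < s.ireg 3, ∀ f : Fin D.nF, s.iarr 5 j = f →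
    IsRayCycle (fun a : Fin (s.iarr 6 (j + 1) - s.iarr 6 j) => outAt s (s.iarr 6 j + a))
      (pullOutDirections P (D.facet f))

theorem Progress.skip {s s' : State} (f : Fin D.nF) (h : Progress P D f s) (u : Unchanged s s')
    (he : pullOutDirections P (D.facet f) = ∅) : Progress P D (f + 1) s' where
  lt j hj := by
    rw [u.list]
    exact (h.lt j (by rwa [← u.count])).trans (Nat.lt_succ_self _)
  nodup := by rw [u.count, u.list]; exact h.nodup
  facets g hg := by
    rw [u.count, u.list]
    rcases Nat.lt_succ_iff_lt_or_eq.1 hg with hg | hg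
    · exact h.facets g hg
    · obtain rfl := Fin.ext hg
      rw [he]
      refine ⟨fun ⟨j, hj, e⟩ => absurd (h.lt j hj) (by omega), fun ⟨_, hx⟩ => hx.elim⟩
  block_le := by rw [u.count, u.blocks]; exact h.block_le
  block_top := by rw [u.count, u.blocks, u.top]; exact h.block_top
  block_end := by rw [u.count, u.blocks, u.top]; exact h.block_end
  directions j hj g hg := by
    rw [u.count] at hj
    rw [u.list] at hg
    exact isRayCycle_congr (v := fun a => outAt s' (s'.iarr 6 j + a))
      (w := fun a => outAt s (s.iarr 6 j + a)) (by rw [u.blocks])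
      (fun _ _ => by rw [u.out, u.blocks]) (h.directions j hj g hg)

theorem Progress.append {s s' : State} (f : Fin D.nF) (h : Progress P D f s)
    (u : Appended f (pullOutDirections P (D.facet f)) s s')
    (hne : (pullOutDirections P (D.facet f)).Nonempty) : Progress P D (f + 1) s' := by
  have l1 : ∀ j < s.ireg 3, s'.iarr 5 j = s.iarr 5 j := fun j hj => by
    rw [u.list, Function.update_of_ne hj.ne]
  have l2 : s'.iarr 5 (s.ireg 3) = f := by rw [u.list, Function.update_self]
  have b1 : ∀ j ≤ s.ireg 3, s'.iarr 6 j = s.iarr 6 j := fun j hj => by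
    rw [u.blocks, Function.update_of_ne (by omega)]
  have b2 : s'.iarr 6 (s.ireg 3 + 1) = s'.ireg 11 := by
    conv_lhs => rw [u.blocks, Function.update_self]
  have hc := u.count
  refine ⟨fun j hj => ?_, fun i hi j hj e => ?_, fun g hg => ?_, fun j hj => ?_, fun j hj => ?_,
    by rw [hc, b2], fun j hj g hg => ?_⟩
  · rcases Nat.lt_succ_iff_lt_or_eq.1 (hc ▸ hj) with hj | rfl
    · rw [l1 j hj]; exact (h.lt j hj).trans (Nat.lt_succ_self _)
    · rw [l2]; exact Nat.lt_succ_self _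
  · rcases Nat.lt_succ_iff_lt_or_eq.1 (hc ▸ hi) with hi | rfl <;>
    rcases Nat.lt_succ_iff_lt_or_eq.1 (hc ▸ hj) with hj | rfl
    · rw [l1 i hi, l1 j hj] at e; exact h.nodup i hi j hj e
    · rw [l1 i hi, l2] at e; exact absurd (h.lt i hi) (by omega)
    · rw [l2, l1 j hj] at e; exact absurd (h.lt j hj) (by omega)
    · rfl
  · rcases Nat.lt_succ_iff_lt_or_eq.1 hg with hg | hg
    · rw [← h.facets g hg]
      constructor
      · rintro ⟨j, hj, e⟩
        rcases Nat.lt_succ_iff_lt_or_eq.1 (hc ▸ hj) with hj | rfl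
        · exact ⟨j, hj, by rw [← l1 j hj, e]⟩
        · rw [l2] at e; omega
      · rintro ⟨j, hj, e⟩
        exact ⟨j, by omega, by rw [l1 j hj, e]⟩
    · obtain rfl := Fin.ext hg
      exact ⟨fun _ => hne, fun _ => ⟨s.ireg 3, by omega, l2⟩⟩
  · rcases Nat.lt_succ_iff_lt_or_eq.1 (hc ▸ hj) with hj | rfl
    · rw [b1 j hj.le, b1 (j + 1) hj]; exact h.block_le j hj
    · rw [b1 _ le_rfl, b2, h.block_end]; exact u.le
  · rcases Nat.le_succ_iff.1 (hc ▸ hj) with hj | rfl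
    · rw [b1 j hj]; exact (h.block_top j hj).trans u.le
    · exact b2.le
  · rcases Nat.lt_succ_iff_lt_or_eq.1 (hc ▸ hj) with hj | rfl
    · rw [l1 j hj] at hg
      refine isRayCycle_congr (v := fun a => outAt s' (s'.iarr 6 j + a))
        (w := fun a => outAt s (s.iarr 6 j + a)) (by rw [b1 j hj.le, b1 (j + 1) hj])
        (fun a ha => ?_) (h.directions j hj g hg)
      -- Earlier blocks end at or below the old output position, where nothing is overwritten.
      have := h.block_top (j + 1) hj
      rw [b1 j hj.le, u.old _ (by omega)]
    · obtain rfl : f = g := Fin.ext (l2.symm.trans hg)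
      exact isRayCycle_congr (v := fun a => outAt s' (s'.iarr 6 (s.ireg 3) + a))
        (w := fun a => outAt s' (s.ireg 11 + a)) (by rw [b1 _ le_rfl, b2, h.block_end])
        (fun a ha => by rw [b1 _ le_rfl, h.block_end]) u.rays

theorem Progress.solves (hD : D.IsBoundaryOf P) {s : State} (h : Progress P D D.nF s) :
    SolvesAllFAD P D s where
  isFace := h.lt
  nodup := h.nodup
  facets f := by
    rw [h.facets f f.2]
    exact ⟨fun h => ⟨hD.isFacet f, h⟩, fun h => h.2⟩
  block_le := h.block_le
  directions := h.directions

/-- The time for the facets from number `k` on. -/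
noncomputable def remainingTime (D : DCEL) (k : ℕ) : ℕ :=
  ∑ f : Fin D.nF, if k ≤ f then facetCond.cost + facetTime (D.deg f) else 0

theorem remainingTime_succ (f : Fin D.nF) :
    remainingTime D f = facetCond.cost + facetTime (D.deg f) + remainingTime D (f + 1) := by
  classical
  rw [remainingTime, remainingTime, Fintype.sum_eq_add_sum_compl f, Fintype.sum_eq_add_sum_compl f,
    if_pos le_rfl, if_neg (by omega), zero_add]
  congr 1
  refine Finset.sum_congr rfl fun g hg => ?_
  have : (g : ℕ) ≠ f := fun h => by simp [Fin.ext h] at hg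
  exact if_congr (by omega) rfl rfl

/-- The time is an affine function of `m`, whose slope is at most its value at `1`. -/
theorem facetTime_le (m : ℕ) : facetTime m ≤ facetTime 1 * m + facetTime 0 := by
  simp only [facetTime, outTime]
  ring_nf
  omega

theorem remainingTime_le (hP : IsConvexPolyhedron P) (hD : D.IsBoundaryOf P) :
    remainingTime D 0 ≤ (6 * facetTime 1 + facetTime 0 + facetCond.cost) * D.nF := by
  have h1 := hD.sum_deg_le
  have h2 := hD.card_halfEdges_le hP
  calc remainingTime D 0
      ≤ ∑ f : Fin D.nF, (facetTime 1 * D.deg f + (facetTime 0 + facetCond.cost)) := by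
        refine Finset.sum_le_sum fun f _ => ?_
        rw [if_pos (Nat.zero_le _)]
        have := facetTime_le (D.deg f)
        omega
    _ = facetTime 1 * ∑ f, D.deg f + (facetTime 0 + facetCond.cost) * D.nF := by
        rw [Finset.sum_add_distrib, Finset.mul_sum, Finset.sum_const, Finset.card_univ,
          Fintype.card_fin, smul_eq_mul, mul_comm D.nF]
    _ ≤ facetTime 1 * (6 * D.nF) + (facetTime 0 + facetCond.cost) * D.nF := by
        gcongr
        exact h1.trans h2
    _ = _ := by ring

/-- The constants paid once are included in the factor of `n`, which is legitimate since `n` is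
positive. The factor `6` comes from `card_halfEdges_le`. -/
def linearTime : ℕ :=
  facetCond.cost + normalBody.bound + facetCond.cost + 2 +
    (6 * facetTime 1 + facetTime 0 + facetCond.cost + facetCond.cost)

theorem program_spec (hP : IsConvexPolyhedron P) (hD : D.IsBoundaryOf P) :
    Runs program D.load (linearTime * D.nF) (SolvesAllFAD P D) := by
  have hpos := hD.nF_pos hP
  have hmain : Runs program D.load
      ((facetCond.cost + normalBody.bound) * D.nF + facetCond.cost + 2 +
        (remainingTime D 0 + facetCond.cost)) (SolvesAllFAD P D) := by
    refine Runs.seq normals_spec ?_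
    rintro s₀ ⟨hs₀, h4, fr₀⟩
    have z3 : s₀.ireg 3 = 0 := fr₀.ireg 3 (by decide)
    have z11 : s₀.ireg 11 = 0 := fr₀.ireg 11 (by decide)
    have z6 : s₀.iarr 6 = fun _ => 0 := fr₀.iarr 6 (by decide)
    refine (Runs.loop (b := facetCond) (c := facetBody) (s₀ := s₀)
      (fun s => s.ireg 4 ≤ D.nF ∧ Progress P D (s.ireg 4) s)
      (fun s => remainingTime D (s.ireg 4)) ?_ ?_).mono (by rw [h4]) ?_
    · rintro s fr ⟨hle, hpr⟩ hb
      have hs : Ready D s := hs₀.frame fr (by decide) (by decide) (by decide)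
      have hlt : s.ireg 4 < D.nF := by
        simpa [facetCond, Cond.Holds, succE, IExpr.eval, hs.nF, Nat.succ_le_iff] using hb
      refine ⟨_, (facetBody_spec hP hD hs ⟨s.ireg 4, hlt⟩ rfl hpr.block_end).mono le_rfl ?_⟩
      rintro s' ⟨h4', h⟩
      refine ⟨⟨by rw [h4']; exact hlt, ?_⟩, ?_⟩
      · rw [h4']
        rcases h with ⟨he, u⟩ | ⟨hne, u⟩
        · exact hpr.skip ⟨s.ireg 4, hlt⟩ u he
        · exact hpr.append ⟨s.ireg 4, hlt⟩ u hne
      · rw [h4']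
        exact (remainingTime_succ ⟨s.ireg 4, hlt⟩).ge
    · refine ⟨by omega, ?_⟩
      rw [h4]
      exact ⟨by simp [z3], by simp [z3], by simp, by simp [z3], by simp [z6], by simp [z6, z11],
        by simp [z3]⟩
    · rintro s ⟨⟨hle, hpr⟩, hb, fr⟩
      have hs : Ready D s := hs₀.frame fr (by decide) (by decide) (by decide)
      have : s.ireg 4 = D.nF := by
        simp only [facetCond, Cond.Holds, succE, IExpr.eval, hs.nF] at hb
        omega
      rw [this] at hpr
      exact hpr.solves hD
  refine hmain.mono ?_ fun _ h => h
  have := remainingTime_le hP hD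
  rw [linearTime]
  nlinarith

end AllFAD
end Casting

open Casting RealRAM in
/-- One real RAM program solves the problem "all facets, all directions" for every convex
polyhedron with `n` facets in at most `C * n` time units. -/
theorem mainTheorem3 :
    ∃ (prog : Cmd) (C : ℕ), ∀ (P : Set Vec3) (D : DCEL) (n : ℕ),
      IsConvexPolyhedron P → D.IsBoundaryOf P → {F | IsFacet P F}.ncard = n →
      ∃ (t : ℕ) (s : State), Exec prog D.load t s ∧ t ≤ C * n ∧ SolvesAllFAD P D s := by
  refine ⟨AllFAD.program, AllFAD.linearTime, fun P D n hP hD hn => ?_⟩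
  obtain rfl : D.nF = n := hD.ncard_facets.symm.trans hn
  exact AllFAD.program_spec hP hD
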